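/- For a finite connected graph $G=(V,E)$ with $n=|V|\ge 2$ and $\theta\in(0,1]$, the binary noisy voter model on $G$ with noise $\theta$ is the continuous-time Markov chain on $\{0,1\}^V$ in which each vertex $u$ carries an independent rate-$1$ Poisson clock; when the clock at $u$ rings, then with probability $1-\theta$ the value at $u$ is replaced by that of a uniformly chosen neighbor of $u$, and with probability $\theta$ by a uniform element of $\{0,1\}$. Let $\mu_G$ be its (unique) stationary distribution and, for an initial state $\mathsf{x}_0$, let $t_{\mathrm{mix}}^{\mathsf{x}_0}(\epsilon)=\inf\{t\ge 0:\|\mathbb{P}_{\mathsf{x}_0}(X_t\in\cdot)-\mu_G\|_{\mathrm{TV}}<\epsilon\}$. If $G$ is bipartite with parts $V_1,V_2$, let $\mathsf{x}_{\mathrm{alt}}(v)=\mathbf{1}_{\{v\in V_1\}}$. For $c_0>0$ and $\alpha\in(0,1)$ say that $G$ satisfies $(\star)$ if $|B_v(r)|\le c_0\exp(r^{1-\alpha})$ for every $v\in V$ and every integer $r\ge 1$, where $B_v(r)$ is the ball of radius $r$ around $v$ in graph distance. Fix $\theta\in(0,1]$, $c_0>0$, $\alpha\in(0,1)$ and $0<\epsilon<1$.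 (1) There is a constant $C=C(\epsilon,\theta,\alpha,c_0)$ such that for every connected bipartite graph $G$ on $n\ge 2$ vertices satisfying $(\star)$, $$t_{\mathrm{mix}}^{\mathsf{x}_{\mathrm{alt}}}(\epsilon)=\frac{1+\delta}{\min\{4-2\theta,\,4\theta\}}\log n\quad\text{for some }\delta\text{ with }|\delta|\le C(\log n)^{-\alpha/2}.$$ (2) For every sequence of connected bipartite graphs $G^{(k)}$ satisfying $(\star)$ with these $c_0,\alpha$, whose numbers of vertices tend to infinity, and every sequence of initial states $\mathsf{x}_0=\mathsf{x}_0^{(k)}$ on $G^{(k)}$, $$\liminf_{k\to\infty}\frac{t_{\mathrm{mix}}^{\mathsf{x}_0}(\epsilon)}{t_{\mathrm{mix}}^{\mathsf{x}_{\mathrm{alt}}}(\epsilon)}\ge 1,$$ i.e. the alternating state is asymptotically the fastest initial state. (3) In particular, consider continuous-time (rate-$1$, heat-bath) Glauber dynamics for the Ising model on the cycle $\mathbb{Z}/n\mathbb{Z}$, $n$ even, at any inverse temperature $\beta>0$, with mixing times measured to the Ising Gibbs measure. For every fixed $0<\epsilon<1$ and every sequence of initial states $\mathsf{x}_0=\mathsf{x}_0^{(n)}$,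 $\liminf t_{\mathrm{mix}}^{\mathsf{x}_0}(\epsilon)/t_{\mathrm{mix}}^{\mathsf{x}_{\mathrm{alt}}}(\epsilon)\ge 1$ as $n\to\infty$ along even $n$, where $\mathsf{x}_{\mathrm{alt}}=(0,1,0,1,\dots)$ (and $0,1$ stand for the spins $-1,+1$). -/

import Mathlib

universe u

noncomputable section

namespace SpinDynamics

/-! ### Continuous-time Markov chains on a finite set -/

section Chain

variable {Ω : Type*} [Fintype Ω] [DecidableEq Ω]

/-- The law `P_x(X_t = ·)` at time `t` of the continuous-time Markov chain on the finite set `Ω` with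
generator (rate matrix) `Q` started from `x`: the row `x` of the transition matrix `exp (t Q)`. -/
def law (Q : Matrix Ω Ω ℝ) (x : Ω) (t : ℝ) : Ω → ℝ :=
  fun y => NormedSpace.exp (t • Q) x y

/-- Total variation distance between two probability vectors. -/
def tvDist (μ ν : Ω → ℝ) : ℝ :=
  (1 / 2) * ∑ y, |μ y - ν y|

/-- `μ` is a stationary distribution of the chain with generator `Q`: a probability vector with
`μ Q = 0`. -/
structure IsStationary (Q : Matrix Ω Ω ℝ) (μ : Ω → ℝ) : Prop where
  nonneg : ∀ x, 0 ≤ μ x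
  sum_eq_one : ∑ x, μ x = 1
  balance : Matrix.vecMul μ Q = 0

/-- `inf {t ≥ 0 : ‖P_x(X_t ∈ ·) - μ‖_TV < ε}`. -/
def mixingTime (Q : Matrix Ω Ω ℝ) (μ : Ω → ℝ) (x : Ω) (ε : ℝ) : ℝ :=
  sInf {t : ℝ | 0 ≤ t ∧ tvDist (law Q x t) μ < ε}

end Chain

/-! ### Single-site dynamics, the noisy voter model, and Glauber dynamics for the Ising model -/

section Models

variable {V : Type*} [Fintype V] [DecidableEq V]

/-- Generator of the single-site dynamics on `V → S`: every site `u` has an independent rate-1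
Poisson clock, and when it rings in state `x`, the value at `u` is replaced by `j` with
probability `p u x j`. -/
def siteGenerator {S : Type*} [Fintype S] [DecidableEq S] (p : V → (V → S) → S → ℝ) :
    Matrix (V → S) (V → S) ℝ :=
  fun x y => ∑ u, ((∑ j, if Function.update x u j = y then p u x j else 0)
    - if x = y then 1 else 0)

variable (G : SimpleGraph V) [DecidableRel G.Adj]

/-- Update rule of the `q`-state noisy voter model: with probability `1 - θ` copy the value of a
uniformly chosen neighbour, with probability `θ` take a uniform value in `{0, …, q - 1}`. -/
def noisyVoterUpdate (q : ℕ) (θ : ℝ) (u : V) (x : V → Fin q) (j : Fin q) : ℝ :=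
  (1 - θ) * (((G.neighborFinset u).filter (fun v => x v = j)).card / G.degree u) + θ / q

/-- Generator of the `q`-state noisy voter model on `G` with noise `θ`. -/
def noisyVoterGenerator (q : ℕ) (θ : ℝ) : Matrix (V → Fin q) (V → Fin q) ℝ :=
  siteGenerator (noisyVoterUpdate G q θ)

/-- The stationary distribution `μ_G` of the noisy voter model; it exists and is unique, see
`existsUnique_isStationary` and `isStationary_noisyVoterStationary` below. -/
def noisyVoterStationary (q : ℕ) (θ : ℝ) : (V → Fin q) → ℝ :=
  Classical.epsilon (IsStationary (noisyVoterGenerator G q θ))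

/-- Mixing time `t_mix^x(ε)` of the noisy voter model from the initial state `x`. -/
def noisyVoterMixingTime (q : ℕ) (θ : ℝ) (x : V → Fin q) (ε : ℝ) : ℝ :=
  mixingTime (noisyVoterGenerator G q θ) (noisyVoterStationary G q θ) x ε

/-- Sub-exponential growth of balls: `|B_v(r)| ≤ c₀ exp (r^(1-α))` for all `v` and `r ≥ 1`. -/
def SubexpGrowth (c₀ α : ℝ) : Prop :=
  ∀ (v : V) (r : ℕ), 1 ≤ r →
    (({w : V | G.dist v w ≤ r}.ncard : ℕ) : ℝ) ≤ c₀ * Real.exp ((r : ℝ) ^ (1 - α))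

open Classical in
/-- The alternating state `1_{v ∈ V₁}`. -/
def alternating (V₁ : Set V) : V → Fin 2 :=
  fun v => if v ∈ V₁ then 1 else 0

/-- The spin `-1` or `+1` encoded by `0` or `1`. -/
def spin (j : Fin 2) : ℝ := if j = 1 then 1 else -1

/-- Heat-bath update rule of the Ising model at inverse temperature `β` (no external field):
the new spin `s = ±1` at `u` has probability `(1 + s tanh (β ∑_{v ∼ u} σ_v)) / 2`. -/
def isingUpdate (β : ℝ) (u : V) (x : V → Fin 2) (j : Fin 2) : ℝ :=
  (1 + spin j * Real.tanh (β * ∑ v ∈ G.neighborFinset u, spin (x v))) / 2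

/-- Generator of (continuous-time, heat-bath) Glauber dynamics for the Ising model on `G`. -/
def isingGenerator (β : ℝ) : Matrix (V → Fin 2) (V → Fin 2) ℝ :=
  siteGenerator (isingUpdate G β)

/-- The Boltzmann weight `exp (β ∑_{uv ∈ E} σ_u σ_v)`; the double sum runs over ordered pairs,
so that every edge occurs twice. -/
def isingWeight (β : ℝ) (x : V → Fin 2) : ℝ :=
  Real.exp (β * ((1 / 2) * ∑ u, ∑ v ∈ G.neighborFinset u, spin (x u) * spin (x v)))

/-- The Ising Gibbs measure on `G`. -/
def isingGibbs (β : ℝ) (x : V → Fin 2) : ℝ :=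
  isingWeight G β x / ∑ y, isingWeight G β y

/-- Mixing time of Glauber dynamics for the Ising model from the initial state `x`. -/
def isingMixingTime (β : ℝ) (x : V → Fin 2) (ε : ℝ) : ℝ :=
  mixingTime (isingGenerator G β) (isingGibbs G β) x ε

end Models

/-! ### The stationary distribution of the noisy voter model exists and is unique -/

section Stationary

lemma sum_siteGenerator {V S : Type*} [Fintype V] [DecidableEq V] [Fintype S] [DecidableEq S]
    (p : V → (V → S) → S → ℝ) (hp : ∀ u x, ∑ j, p u x j = 1) (x : V → S) :
    ∑ y, siteGenerator p x y = 0 := by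
  unfold siteGenerator
  rw [Finset.sum_comm]
  refine Finset.sum_eq_zero fun u _ => ?_
  rw [Finset.sum_sub_distrib, Finset.sum_comm]
  simp [hp]

lemma siteGenerator_ge {V S : Type*} [Fintype V] [DecidableEq V] [Fintype S] [DecidableEq S]
    (p : V → (V → S) → S → ℝ) (hp0 : ∀ u x j, 0 ≤ p u x j) {x y : V → S} (hxy : x ≠ y)
    (u : V) (j : S) (hj : Function.update x u j = y) : p u x j ≤ siteGenerator p x y := by
  have h0 : ∀ (w : V) (i : S), 0 ≤ (if Function.update x w i = y then p w x i else 0) := by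
    intro w i; split_ifs
    · exact hp0 w x i
    · exact le_rfl
  have h1 : siteGenerator p x y
      = ∑ w, ∑ i, if Function.update x w i = y then p w x i else 0 := by
    simp [siteGenerator, hxy]
  rw [h1]
  calc p u x j = if Function.update x u j = y then p u x j else 0 := by simp [hj]
    _ ≤ ∑ i, if Function.update x u i = y then p u x i else 0 :=
        Finset.single_le_sum (f := fun i => if Function.update x u i = y then p u x i else 0)
          (fun i _ => h0 u i) (Finset.mem_univ j)
    _ ≤ _ := Finset.single_le_sum
          (f := fun w => ∑ i, if Function.update x w i = y then p w x i else 0)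
          (fun w _ => Finset.sum_nonneg fun i _ => h0 w i) (Finset.mem_univ u)

lemma siteGenerator_nonneg {V S : Type*} [Fintype V] [DecidableEq V] [Fintype S] [DecidableEq S]
    (p : V → (V → S) → S → ℝ) (hp0 : ∀ u x j, 0 ≤ p u x j) {x y : V → S} (hxy : x ≠ y) :
    0 ≤ siteGenerator p x y := by
  simp only [siteGenerator, hxy, if_false, sub_zero]
  refine Finset.sum_nonneg fun u _ => Finset.sum_nonneg fun j _ => ?_
  split_ifs
  · exact hp0 u x j
  · exact le_rfl

/-- The absolute value of a left null vector of a rate matrix is a left null vector. -/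
lemma vecMul_abs {Ω : Type*} [Fintype Ω] [DecidableEq Ω] (Q : Matrix Ω Ω ℝ)
    (hrow : ∀ x, ∑ y, Q x y = 0) (hoff : ∀ x y, x ≠ y → 0 ≤ Q x y) (w : Ω → ℝ)
    (hw : Matrix.vecMul w Q = 0) : Matrix.vecMul (fun x => |w x|) Q = 0 := by
  have hdiag : ∀ x, Q x x ≤ 0 := by
    intro x
    have h := hrow x
    rw [← Finset.add_sum_erase _ _ (Finset.mem_univ x)] at h
    have : 0 ≤ ∑ y ∈ Finset.univ.erase x, Q x y :=
      Finset.sum_nonneg fun y hy => hoff x y (Finset.ne_of_mem_erase hy).symm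
    linarith
  have hnn : ∀ y, 0 ≤ Matrix.vecMul (fun x => |w x|) Q y := by
    intro y
    have h := congrFun hw y
    simp only [Matrix.vecMul, dotProduct, Pi.zero_apply] at h ⊢
    rw [← Finset.add_sum_erase _ _ (Finset.mem_univ y)] at h ⊢
    have h1 : |w y| * Q y y = -|w y * Q y y| := by
      rw [abs_mul, abs_of_nonpos (hdiag y)]; ring
    have h2 : |w y * Q y y| = |∑ x ∈ Finset.univ.erase y, w x * Q x y| := by
      rw [← abs_neg]; congr 1; linarith
    have h3 : |∑ x ∈ Finset.univ.erase y, w x * Q x y|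
        ≤ ∑ x ∈ Finset.univ.erase y, |w x| * Q x y := by
      refine (Finset.abs_sum_le_sum_abs _ _).trans (le_of_eq ?_)
      refine Finset.sum_congr rfl fun x hx => ?_
      rw [abs_mul, abs_of_nonneg (hoff x y (Finset.ne_of_mem_erase hx))]
    linarith
  have hsum : ∑ y, Matrix.vecMul (fun x => |w x|) Q y = 0 := by
    simp only [Matrix.vecMul, dotProduct]
    rw [Finset.sum_comm]
    simp [← Finset.mul_sum, hrow]
  funext y
  exact (Finset.sum_eq_zero_iff_of_nonneg fun y _ => hnn y).1 hsum y (Finset.mem_univ y)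

/-- If every site can be updated to every value, a nonzero nonnegative left null vector is
positive everywhere. -/
lemma pos_of_vecMul {V S : Type*} [Fintype V] [DecidableEq V] [Fintype S] [DecidableEq S]
    (p : V → (V → S) → S → ℝ) (hp0 : ∀ u x j, 0 < p u x j) (w : (V → S) → ℝ) (hw0 : ∀ x, 0 ≤ w x)
    (hw : Matrix.vecMul w (siteGenerator p) = 0) {x : V → S} (hx : 0 < w x) (y : V → S) :
    0 < w y := by
  have step : ∀ (z : V → S) (u : V) (j : S), 0 < w z → 0 < w (Function.update z u j) := by
    intro z u j hz
    by_cases hzy : z = Function.update z u j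
    · rwa [← hzy]
    by_contra hneg
    have hzero : w (Function.update z u j) = 0 := le_antisymm (not_lt.1 hneg) (hw0 _)
    have h := congrFun hw (Function.update z u j)
    simp only [Matrix.vecMul, dotProduct, Pi.zero_apply] at h
    have hterm : ∀ a ∈ Finset.univ,
        0 ≤ w a * siteGenerator p a (Function.update z u j) := by
      intro a _
      by_cases ha : a = Function.update z u j
      · rw [ha, hzero, zero_mul]
      · exact mul_nonneg (hw0 a) (siteGenerator_nonneg p (fun u x j => (hp0 u x j).le) ha)
    have h2 := (Finset.sum_eq_zero_iff_of_nonneg hterm).1 h z (Finset.mem_univ z)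
    have h3 := siteGenerator_ge p (fun u x j => (hp0 u x j).le) hzy u j rfl
    have h4 := hp0 u z j
    have := mul_pos hz (h4.trans_le h3)
    linarith
  have key : ∀ s : Finset V, 0 < w (fun v => if v ∈ s then y v else x v) := by
    intro s
    induction s using Finset.induction_on with
    | empty => simpa using hx
    | insert a s _ ih =>
      have h := step _ a (y a) ih
      convert h using 2
      funext v
      by_cases hv : v = a
      · subst hv; simp
      · simp [hv]
  simpa using key Finset.univ

theorem existsUnique_isStationary {V S : Type*} [Fintype V] [DecidableEq V] [Fintype S]
    [DecidableEq S] [Nonempty S] (p : V → (V → S) → S → ℝ) (hp0 : ∀ u x j, 0 < p u x j)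
    (hp1 : ∀ u x, ∑ j, p u x j = 1) : ∃! μ, IsStationary (siteGenerator p) μ := by
  have hrow := sum_siteGenerator p hp1
  have hoff : ∀ x y : V → S, x ≠ y → 0 ≤ siteGenerator p x y := fun x y h =>
    siteGenerator_nonneg p (fun u x j => (hp0 u x j).le) h
  have hdet : (siteGenerator p).det = 0 := by
    apply Matrix.exists_mulVec_eq_zero_iff.1
    refine ⟨fun _ => 1, ?_, ?_⟩
    · intro h
      exact one_ne_zero (congrFun h (fun _ => Classical.arbitrary S))
    · funext x
      simpa [Matrix.mulVec, dotProduct] using hrow x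
  obtain ⟨w, hw0, hw⟩ := Matrix.exists_vecMul_eq_zero_iff.2 hdet
  have habs := vecMul_abs _ hrow hoff w hw
  have hpos : 0 < ∑ x, |w x| := by
    obtain ⟨x, hx⟩ := Function.ne_iff.1 hw0
    exact Finset.sum_pos' (fun _ _ => abs_nonneg _) ⟨x, Finset.mem_univ x, abs_pos.2 hx⟩
  refine ⟨fun x => (∑ x, |w x|)⁻¹ * |w x|, ⟨fun x => by positivity, ?_, ?_⟩, ?_⟩
  · rw [← Finset.mul_sum, inv_mul_cancel₀ hpos.ne']
  · have h : (fun x => (∑ x, |w x|)⁻¹ * |w x|) = (∑ x, |w x|)⁻¹ • (fun x => |w x|) := rfl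
    rw [h, Matrix.smul_vecMul, habs, smul_zero]
  · have uniq : ∀ μ ν, IsStationary (siteGenerator p) μ → IsStationary (siteGenerator p) ν →
        ∀ x, μ x ≤ ν x := by
      intro μ ν hμ hν
      by_contra! hne
      obtain ⟨x, hx⟩ := hne
      have hd : Matrix.vecMul (μ - ν) (siteGenerator p) = 0 := by
        rw [Matrix.sub_vecMul, hμ.balance, hν.balance, sub_zero]
      have hda := vecMul_abs _ hrow hoff _ hd
      have hplus : Matrix.vecMul ((fun x => |(μ - ν) x|) + (μ - ν)) (siteGenerator p) = 0 := by
        rw [Matrix.add_vecMul, hd, hda, add_zero]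
      have hall := pos_of_vecMul p hp0 _
        (fun z => by
          have := neg_abs_le ((μ - ν) z)
          simp only [Pi.add_apply]; linarith) hplus (x := x)
        (by
          have h1 : 0 < (μ - ν) x := by simpa using hx
          have := abs_nonneg ((μ - ν) x)
          simp only [Pi.add_apply]; linarith)
      have hgt : ∀ z, ν z < μ z := by
        intro z
        by_contra hz
        have h1 := hall z
        have h2 : (μ - ν) z ≤ 0 := by
          have := not_lt.1 hz
          simp only [Pi.sub_apply]; linarith
        simp only [Pi.add_apply, abs_of_nonpos h2] at h1
        linarith
      have := Finset.sum_lt_sum (s := Finset.univ) (fun z _ => (hgt z).le)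
        ⟨x, Finset.mem_univ x, hgt x⟩
      rw [hμ.sum_eq_one, hν.sum_eq_one] at this
      exact lt_irrefl _ this
    intro ν hν
    funext x
    have hμ : IsStationary (siteGenerator p) (fun x => (∑ x, |w x|)⁻¹ * |w x|) := by
      refine ⟨fun x => by positivity, ?_, ?_⟩
      · rw [← Finset.mul_sum, inv_mul_cancel₀ hpos.ne']
      · have h : (fun x => (∑ x, |w x|)⁻¹ * |w x|) = (∑ x, |w x|)⁻¹ • (fun x => |w x|) := rfl
        rw [h, Matrix.smul_vecMul, habs, smul_zero]
    exact le_antisymm (uniq _ _ hν hμ x) (uniq _ _ hμ hν x)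

theorem isStationary_noisyVoterStationary {V : Type*} [Fintype V] [DecidableEq V] [Nontrivial V]
    (G : SimpleGraph V) [DecidableRel G.Adj] (hG : G.Connected) (q : ℕ) (hq : 1 ≤ q) (θ : ℝ)
    (hθ0 : 0 < θ) (hθ1 : θ ≤ 1) :
    IsStationary (noisyVoterGenerator G q θ) (noisyVoterStationary G q θ) ∧
      ∀ μ, IsStationary (noisyVoterGenerator G q θ) μ → μ = noisyVoterStationary G q θ := by
  have hq0 : (0 : ℝ) < q := by exact_mod_cast hq
  have : Nonempty (Fin q) := ⟨⟨0, hq⟩⟩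
  have hp0 : ∀ u x j, 0 < noisyVoterUpdate G q θ u x j := by
    intro u x j
    have h1 : 0 < θ / q := div_pos hθ0 hq0
    have h2 : 0 ≤ 1 - θ := by linarith
    unfold noisyVoterUpdate
    positivity
  have hp1 : ∀ u x, ∑ j, noisyVoterUpdate G q θ u x j = 1 := by
    intro u x
    have hdeg : (0 : ℝ) < G.degree u := by
      exact_mod_cast hG.preconnected.degree_pos_of_nontrivial u
    have hcard : ∑ j, (((G.neighborFinset u).filter (fun v => x v = j)).card : ℝ)
        = G.degree u := by
      rw [← SimpleGraph.card_neighborFinset_eq_degree]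
      exact_mod_cast (Finset.card_eq_sum_card_fiberwise
        (f := x) (t := Finset.univ) (fun _ _ => by simp)).symm
    unfold noisyVoterUpdate
    rw [Finset.sum_add_distrib, ← Finset.mul_sum, ← Finset.sum_div, hcard, div_self hdeg.ne']
    simp only [Finset.sum_const, Finset.card_univ, Fintype.card_fin, nsmul_eq_mul]
    field_simp
    ring
  have hex := existsUnique_isStationary _ hp0 hp1
  have hst : IsStationary (noisyVoterGenerator G q θ) (noisyVoterStationary G q θ) :=
    Classical.epsilon_spec hex.exists
  exact ⟨hst, fun μ hμ => hex.unique hμ hst⟩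

end Stationary

end SpinDynamics

end

/-! Spins are ±1, n is the number of vertices, L = log n. The voter semigroup is computed by a dual:
each site points to the place its value comes from, the arrows move as coalescing walks, and an
arrow hit by noise is frozen at a fixed value (`evolve_eq_dualEv`). Surviving walks are
exponentially rare and exponentially localized, so at every time and in equilibrium distant sets of
spins are nearly independent, with error a sum of `overlap` terms (`abs_evolve_diag_sub_le`,
packaged as `Decoupled`). Under subexponential growth this gives variance bounds of order n, up to
subpolynomial factors, for local statistics.

Lower bound, every initial state. With z_v the mean spin at time t, the statistic ∑ z_v σ_v has mean
∑ z_v² at time t and mean 0 in equilibrium, while its variance is O(∑ z_v²). Since ((1-θ)P - 1) is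
at least -(2-θ) in the degree-weighted inner product, ∑ z_v² is at least of order n e^{-(4-2θ)t}
(`energy_lower_bound`), so there is no mixing before L/(4-2θ). For the other rate one sums σ_u σ_v
over nearby pairs. The deviation of the two-point function from equilibrium evolves by two
independent killed walks stopped on meeting; its initial value is x_u x_v minus the equilibrium
correlation. The first part contributes at most z_u z_v (`evolve_pair_le`). The second is negative
and decays hardly faster than e^{-2θt}, because a radius at which balls grow slowly gives a Rayleigh
quotient near -2θ (`exists_slow_radius`, `rayleigh_near`, `rayleigh_lower_bound`). Either the means
are small and the quadratic statistic separates the laws until about L/(4θ), or they are large and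
the linear one does (`lower_bound_radius`).

Upper bound, alternating state. Here the mean is an exact eigenfunction decaying like e^{-(2-θ)t},
and correlations of two or more spins relax at rate at least min(2-θ, 2θ) (`abs_corrGap_le`). Hence
every marginal is within 2e^{-mt} of equilibrium, m = min(2-θ, 2θ), and on a set of at most K
vertices the χ² distance is at most (2e^{-mt}(2/θ)^K)². To pass from small sets to the whole graph,
run for a further short time s: the final configuration is a function of the configuration at time t
on the random set of vertices still hit by the dual. That set has no chain of K+1 vertices with gaps
at most R, except with small probability (`dualEv_occupied_le`, `card_chains_le`), so it splits into
distant clusters of at most K vertices. The law is then almost a product over clusters and χ²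
tensorizes (`hasProductApprox_of_chains`): about nχ has to be small, that is 2mt ≈ L.

The relative error L^{-α/2} comes from a pair radius of order √L in the lower bound, and from K ≈
L^{α/2}, R ≈ L, s ≈ L^{1-α/2} in the upper one. Since the lower bound is uniform in the initial
state and matches the alternating one, the second assertion follows. On the cycle, heat-bath Ising
is the noisy voter model with θ = 1 - tanh 2β (`isingGenerator_eq`), which gives the third. -/

noncomputable section

set_option linter.unusedSectionVars false

namespace SpinDynamics

/-! ### Exponentials of matrices with nonnegative off-diagonal entries -/

section Comparison

variable {ι : Type*} [Fintype ι] [DecidableEq ι]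

/-- The action of a matrix on functions. -/
def act {ι : Type*} [Fintype ι] (A : Matrix ι ι ℝ) (f : ι → ℝ) : ι → ℝ :=
  fun i => ∑ j, A i j * f j

open scoped Matrix.Norms.Operator in
theorem hasDerivAt_law (A : Matrix ι ι ℝ) (t : ℝ) (i j : ι) :
    HasDerivAt (fun s : ℝ => law A i s j) (∑ k, law A i t k * A k j) t := by
  have h := hasDerivAt_exp_smul_const (𝕂 := ℝ) A t
  have h2 := (hasDerivAt_pi.1 (hasDerivAt_pi.1 h i) j)
  exact h2

open scoped Matrix.Norms.Operator in
theorem hasDerivAt_law' (A : Matrix ι ι ℝ) (t : ℝ) (i j : ι) :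
    HasDerivAt (fun s : ℝ => law A i s j) (∑ k, A i k * law A k t j) t := by
  have h := hasDerivAt_exp_smul_const' (𝕂 := ℝ) A t
  have h2 := (hasDerivAt_pi.1 (hasDerivAt_pi.1 h i) j)
  exact h2

open scoped Matrix.Norms.Operator in
theorem hasSum_exp_apply (A : Matrix ι ι ℝ) (i j : ι) :
    HasSum (fun k : ℕ => (k.factorial : ℝ)⁻¹ * (A ^ k) i j) (NormedSpace.exp A i j) := by
  have h := NormedSpace.exp_series_hasSum_exp' (𝕂 := ℝ) A
  exact (Pi.hasSum.1 (Pi.hasSum.1 h i) j)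

theorem law_zero (A : Matrix ι ι ℝ) (i j : ι) : law A i 0 j = if i = j then 1 else 0 := by
  have : law A i 0 j = (1 : Matrix ι ι ℝ) i j := by
    unfold law; rw [zero_smul, NormedSpace.exp_zero]
  rw [this, Matrix.one_apply]

theorem law_add (A : Matrix ι ι ℝ) (s t : ℝ) (i j : ι) :
    law A i (s + t) j = ∑ k, law A i s k * law A k t j := by
  have h : NormedSpace.exp ((s + t) • A)
      = NormedSpace.exp (s • A) * NormedSpace.exp (t • A) := by
    rw [add_smul, Matrix.exp_add_of_commute]
    exact ((Commute.refl A).smul_left s).smul_right t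
  unfold law
  rw [h]
  exact Matrix.mul_apply

/-- A matrix with nonnegative off-diagonal entries. -/
def IsMetzler (A : Matrix ι ι ℝ) : Prop := ∀ i j, i ≠ j → 0 ≤ A i j

theorem pow_apply_nonneg {A : Matrix ι ι ℝ} (hA : ∀ i j, 0 ≤ A i j) (k : ℕ) (i j : ι) :
    0 ≤ (A ^ k) i j := by
  induction k generalizing i j with
  | zero => rw [pow_zero, Matrix.one_apply]; split_ifs <;> norm_num
  | succ k ih =>
    rw [pow_succ, Matrix.mul_apply]
    exact Finset.sum_nonneg fun l _ => mul_nonneg (ih i l) (hA l j)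

theorem exp_apply_nonneg_of_nonneg {A : Matrix ι ι ℝ} (hA : ∀ i j, 0 ≤ A i j) (i j : ι) :
    0 ≤ (NormedSpace.exp A : Matrix ι ι ℝ) i j :=
  (hasSum_exp_apply A i j).nonneg fun k => mul_nonneg (by positivity) (pow_apply_nonneg hA k i j)

/-- Adding c·I with c large makes every entry nonnegative and changes the exponential only by a
positive scalar factor; the exponential series then has nonnegative terms. -/
theorem IsMetzler.law_nonneg {A : Matrix ι ι ℝ} (hA : IsMetzler A) {t : ℝ} (ht : 0 ≤ t)
    (i j : ι) : 0 ≤ law A i t j := by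
  set c : ℝ := ∑ i, |A i i|
  have hc : ∀ i, 0 ≤ A i i + c := fun i => by
    have h1 : |A i i| ≤ c :=
      Finset.single_le_sum (f := fun i => |A i i|) (fun _ _ => abs_nonneg _) (Finset.mem_univ i)
    linarith [neg_abs_le (A i i)]
  have hsplit : t • A = t • (A + c • (1 : Matrix ι ι ℝ)) + (-(t * c)) • (1 : Matrix ι ι ℝ) := by
    rw [smul_add, smul_smul, neg_smul, add_neg_cancel_right]
  have hone : NormedSpace.exp ((-(t * c)) • (1 : Matrix ι ι ℝ))
      = Real.exp (-(t * c)) • (1 : Matrix ι ι ℝ) := by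
    rw [Matrix.smul_one_eq_diagonal, Matrix.exp_diagonal, Matrix.smul_one_eq_diagonal]
    congr 1
    funext k
    rw [Pi.coe_exp, ← Real.exp_eq_exp_ℝ]
  have hexp : law A i t j = Real.exp (-(t * c)) *
      (NormedSpace.exp (t • (A + c • (1 : Matrix ι ι ℝ))) : Matrix ι ι ℝ) i j := by
    unfold law
    rw [hsplit, Matrix.exp_add_of_commute _ _ (((Commute.one_right _).smul_right _)), hone,
      mul_smul_comm, mul_one]
    rfl
  rw [hexp]
  refine mul_nonneg (Real.exp_pos _).le (exp_apply_nonneg_of_nonneg (fun i j => ?_) i j)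
  rw [Matrix.smul_apply, Matrix.add_apply, Matrix.smul_apply, smul_eq_mul, smul_eq_mul]
  refine mul_nonneg ht ?_
  by_cases hij : i = j
  · subst hij; simpa using hc i
  · simpa [hij] using hA i j hij

/-- The solution `exp (t A) f` of the linear system `y' = A y`. -/
def evolve (A : Matrix ι ι ℝ) (t : ℝ) (f : ι → ℝ) : ι → ℝ :=
  fun i => ∑ j, law A i t j * f j

theorem evolve_zero (A : Matrix ι ι ℝ) (f : ι → ℝ) : evolve A 0 f = f := by
  funext i
  simp [evolve, law_zero]

theorem evolve_add (A : Matrix ι ι ℝ) (s t : ℝ) (f : ι → ℝ) :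
    evolve A (s + t) f = evolve A s (evolve A t f) := by
  funext i
  simp only [evolve, law_add, Finset.sum_mul, Finset.mul_sum]
  rw [Finset.sum_comm]
  simp only [mul_assoc]

theorem hasDerivAt_evolve (A : Matrix ι ι ℝ) (t : ℝ) (f : ι → ℝ) (i : ι) :
    HasDerivAt (fun s => evolve A s f i) (evolve A t (act A f) i) t := by
  have h := HasDerivAt.fun_sum (u := Finset.univ)
    (fun j _ => (hasDerivAt_law A t i j).mul_const (f j))
  refine h.congr_deriv ?_
  simp only [evolve, act, Finset.sum_mul, Finset.mul_sum]
  rw [Finset.sum_comm]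
  simp only [mul_assoc]

theorem hasDerivAt_evolve' (A : Matrix ι ι ℝ) (t : ℝ) (f : ι → ℝ) (i : ι) :
    HasDerivAt (fun s => evolve A s f i) (act A (evolve A t f) i) t := by
  have h := HasDerivAt.fun_sum (u := Finset.univ)
    (fun j _ => (hasDerivAt_law' A t i j).mul_const (f j))
  refine h.congr_deriv ?_
  simp only [evolve, act, Finset.sum_mul, Finset.mul_sum]
  rw [Finset.sum_comm]
  simp only [mul_assoc]

/-- Derivative of `s ↦ exp ((t - s) A) (w s)`. -/
theorem hasDerivAt_evolve_sub (A : Matrix ι ι ℝ) (t s : ℝ) (w : ℝ → ι → ℝ) (w' : ι → ℝ)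
    (hw : ∀ i, HasDerivAt (fun r => w r i) (w' i) s) (i : ι) :
    HasDerivAt (fun r => evolve A (t - r) (w r) i)
      (evolve A (t - s) (fun j => w' j - act A (w s) j) i) s := by
  have h1 : ∀ j, HasDerivAt (fun r : ℝ => law A i (t - r) j)
      (-(∑ k, law A i (t - s) k * A k j)) s := by
    intro j
    exact (hasDerivAt_law A (t - s) i j).comp_const_sub t s
  have h := HasDerivAt.fun_sum (u := Finset.univ) (fun j _ => (h1 j).mul (hw j))
  refine h.congr_deriv ?_
  simp only [evolve, act, mul_sub, Finset.sum_add_distrib, Finset.sum_sub_distrib, neg_mul,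
    Finset.sum_neg_distrib]
  have : ∑ j, law A i (t - s) j * ∑ k, A j k * w s k
      = ∑ k, (∑ j, law A i (t - s) j * A j k) * w s k := by
    simp only [Finset.sum_mul, Finset.mul_sum]
    rw [Finset.sum_comm]
    simp only [mul_assoc]
  rw [this]; ring

theorem IsMetzler.evolve_nonneg {A : Matrix ι ι ℝ} (hA : IsMetzler A) {t : ℝ} (ht : 0 ≤ t)
    {f : ι → ℝ} (hf : ∀ i, 0 ≤ f i) (i : ι) : 0 ≤ evolve A t f i :=
  Finset.sum_nonneg fun j _ => mul_nonneg (hA.law_nonneg ht i j) (hf j)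

/-- Comparison principle: `w' ≥ A w` and `w 0 ≥ 0` imply `w ≥ 0`. -/
theorem IsMetzler.nonneg_of_deriv {A : Matrix ι ι ℝ} (hA : IsMetzler A) {w w' : ℝ → ι → ℝ}
    (hw : ∀ t i, HasDerivAt (fun r => w r i) (w' t i) t)
    (hge : ∀ t, 0 ≤ t → ∀ i, act A (w t) i ≤ w' t i) (h0 : ∀ i, 0 ≤ w 0 i)
    {t : ℝ} (ht : 0 ≤ t) (i : ι) : 0 ≤ w t i := by
  have hder := fun s => hasDerivAt_evolve_sub A t s w (w' s) (hw s) i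
  -- The curve exp((t-s)A) w(s) interpolates between exp(tA) w(0) and w(t), with derivative
  -- exp((t-s)A)(w' - A w) ≥ 0.
  have hmono : MonotoneOn (fun r => evolve A (t - r) (w r) i) (Set.Icc 0 t) := by
    refine monotoneOn_of_deriv_nonneg (convex_Icc 0 t)
      (fun s _ => (hder s).continuousAt.continuousWithinAt)
      (fun s _ => (hder s).differentiableAt.differentiableWithinAt) (fun s hs => ?_)
    rw [interior_Icc] at hs
    rw [(hder s).deriv]
    exact hA.evolve_nonneg (by linarith [hs.2]) (fun j => sub_nonneg.2 (hge s hs.1.le j)) i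
  have h := hmono (Set.left_mem_Icc.2 ht) (Set.right_mem_Icc.2 ht) ht
  simp only [sub_zero, sub_self, evolve_zero] at h
  exact (hA.evolve_nonneg ht h0 i).trans h

theorem act_sub {ι : Type*} [Fintype ι] (A : Matrix ι ι ℝ) (f g : ι → ℝ) (i : ι) :
    act A (fun j => f j - g j) i = act A f i - act A g i := by
  simp [act, mul_sub, Finset.sum_sub_distrib]

theorem IsMetzler.le_of_deriv {A : Matrix ι ι ℝ} (hA : IsMetzler A) {y y' Y Y' : ℝ → ι → ℝ}
    (hy : ∀ t i, HasDerivAt (fun r => y r i) (y' t i) t)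
    (hY : ∀ t i, HasDerivAt (fun r => Y r i) (Y' t i) t)
    (hle : ∀ t, 0 ≤ t → ∀ i, y' t i ≤ act A (y t) i)
    (hge : ∀ t, 0 ≤ t → ∀ i, act A (Y t) i ≤ Y' t i) (h0 : ∀ i, y 0 i ≤ Y 0 i)
    {t : ℝ} (ht : 0 ≤ t) (i : ι) : y t i ≤ Y t i := by
  have := hA.nonneg_of_deriv (w := fun t i => Y t i - y t i) (w' := fun t i => Y' t i - y' t i)
    (fun t i => (hY t i).sub (hy t i))
    (fun t ht i => by rw [act_sub]; linarith [hle t ht i, hge t ht i])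
    (fun i => sub_nonneg.2 (h0 i)) ht i
  linarith

/-- Uniqueness for linear systems. -/
theorem eq_evolve_of_deriv {A : Matrix ι ι ℝ} {y : ℝ → ι → ℝ}
    (hy : ∀ t i, HasDerivAt (fun r => y r i) (act A (y t) i) t) (t : ℝ) :
    y t = evolve A t (y 0) := by
  funext i
  have hder := fun s => hasDerivAt_evolve_sub A t s y (act A (y s)) (hy s) i
  have hz : ∀ s, HasDerivAt (fun r => evolve A (t - r) (y r) i) 0 s := by
    intro s
    have := hder s
    simpa [evolve] using this
  have h := is_const_of_deriv_eq_zero (fun s => (hz s).differentiableAt)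
    (fun s => (hz s).deriv) 0 t
  simpa [evolve_zero] using h.symm

/-- Gronwall: `g' ≤ -c g` implies `g t ≤ exp (-c t) g 0`. -/
theorem le_exp_of_deriv_le {g g' : ℝ → ℝ} {c : ℝ} (hg : ∀ t, HasDerivAt g (g' t) t)
    (hle : ∀ t, 0 ≤ t → g' t ≤ -c * g t) {t : ℝ} (ht : 0 ≤ t) :
    g t ≤ Real.exp (-c * t) * g 0 := by
  have h := IsMetzler.le_of_deriv (ι := Unit) (A := fun _ _ => -c) (y := fun t _ => g t)
    (y' := fun t _ => g' t) (Y := fun t _ => Real.exp (-c * t) * g 0)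
    (Y' := fun t _ => Real.exp (-c * t) * (-c) * g 0)
    (fun i j hij => (hij rfl).elim) (fun t _ => hg t)
    (fun t _ => by
      have : HasDerivAt (fun r : ℝ => -c * r) (-c) t := by
        simpa using (hasDerivAt_id t).const_mul (-c)
      exact this.exp.mul_const _)
    (fun t ht _ => by simpa [act] using hle t ht)
    (fun t _ _ => by simp [act]; linarith) (fun _ => by simp) ht ()
  exact h

/-- Gronwall: `-c g ≤ g'` implies `exp (-c t) g 0 ≤ g t`. -/
theorem exp_le_of_le_deriv {g g' : ℝ → ℝ} {c : ℝ} (hg : ∀ t, HasDerivAt g (g' t) t)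
    (hle : ∀ t, 0 ≤ t → -c * g t ≤ g' t) {t : ℝ} (ht : 0 ≤ t) :
    Real.exp (-c * t) * g 0 ≤ g t := by
  have := le_exp_of_deriv_le (g := fun t => -g t) (g' := fun t => -g' t) (c := c)
    (fun t => (hg t).neg) (fun t ht => by linarith [hle t ht]) ht
  linarith

end Comparison

/-! ### Rate matrices -/

section RateMatrix

variable {ι : Type*} [Fintype ι] [DecidableEq ι]

/-- Generators of conservative Markov chains. -/
structure IsRate (Q : Matrix ι ι ℝ) : Prop where
  metzler : IsMetzler Q
  row_sum : ∀ i, ∑ j, Q i j = 0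

theorem IsRate.evolve_const {Q : Matrix ι ι ℝ} (hQ : IsRate Q) (t c : ℝ) :
    evolve Q t (fun _ => c) = fun _ => c := by
  have h := eq_evolve_of_deriv (A := Q) (y := fun _ _ => c) (fun t i => by
    have h0 : act Q (fun _ => c) i = 0 := by
      simp [act, ← Finset.sum_mul, hQ.row_sum]
    rw [h0]; exact hasDerivAt_const _ _) t
  exact h.symm

theorem IsRate.law_nonneg {Q : Matrix ι ι ℝ} (hQ : IsRate Q) {t : ℝ} (ht : 0 ≤ t) (x y : ι) :
    0 ≤ law Q x t y := hQ.metzler.law_nonneg ht x y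

theorem IsRate.sum_law {Q : Matrix ι ι ℝ} (hQ : IsRate Q) (t : ℝ) (x : ι) :
    ∑ y, law Q x t y = 1 := by
  have := congrFun (hQ.evolve_const t 1) x
  simpa [evolve, law] using this

theorem sum_law_mul (Q : Matrix ι ι ℝ) (x : ι) (t : ℝ) (f : ι → ℝ) :
    ∑ y, law Q x t y * f y = evolve Q t f x := rfl

theorem IsRate.abs_evolve_le {Q : Matrix ι ι ℝ} (hQ : IsRate Q) {t : ℝ} (ht : 0 ≤ t)
    {f : ι → ℝ} {c : ℝ} (hf : ∀ i, |f i| ≤ c) (i : ι) : |evolve Q t f i| ≤ c := by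
  calc |evolve Q t f i| ≤ ∑ j, |law Q i t j * f j| :=
        Finset.abs_sum_le_sum_abs _ _
    _ ≤ ∑ j, law Q i t j * c := by
        refine Finset.sum_le_sum fun j _ => ?_
        rw [abs_mul, abs_of_nonneg (hQ.law_nonneg ht i j)]
        exact mul_le_mul_of_nonneg_left (hf j) (hQ.law_nonneg ht i j)
    _ = c := by rw [← Finset.sum_mul, hQ.sum_law, one_mul]

theorem IsStationary.sum_mul_act {ι : Type*} [Fintype ι] {Q : Matrix ι ι ℝ} {μ : ι → ℝ}
    (hμ : IsStationary Q μ) (f : ι → ℝ) : ∑ x, μ x * act Q f x = 0 := by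
  have h : ∑ x, μ x * act Q f x = ∑ y, (Matrix.vecMul μ Q) y * f y := by
    simp only [act, Matrix.vecMul, dotProduct, Finset.mul_sum, Finset.sum_mul]
    rw [Finset.sum_comm]
    simp only [mul_assoc]
  rw [h, hμ.balance]; simp

theorem IsStationary.sum_mul_evolve {Q : Matrix ι ι ℝ} {μ : ι → ℝ} (hμ : IsStationary Q μ)
    (f : ι → ℝ) (t : ℝ) : ∑ x, μ x * evolve Q t f x = ∑ x, μ x * f x := by
  have hd : ∀ t, HasDerivAt (fun t => ∑ x, μ x * evolve Q t f x) 0 t := by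
    intro t
    have h := HasDerivAt.fun_sum (u := Finset.univ)
      (fun x _ => (hasDerivAt_evolve' Q t f x).const_mul (μ x))
    rwa [hμ.sum_mul_act] at h
  have h := is_const_of_deriv_eq_zero (fun s => (hd s).differentiableAt)
    (fun s => (hd s).deriv) t 0
  simpa [evolve_zero] using h

theorem sum_mul_le_tvDist {ι : Type*} [Fintype ι] {μ ν : ι → ℝ} {f : ι → ℝ} (hf : ∀ i, |f i| ≤ 1) :
    ∑ i, (μ i - ν i) * f i ≤ 2 * tvDist μ ν := by
  unfold tvDist
  rw [← mul_assoc]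
  norm_num
  refine Finset.sum_le_sum fun i _ => ?_
  calc (μ i - ν i) * f i ≤ |(μ i - ν i) * f i| := le_abs_self _
    _ = |μ i - ν i| * |f i| := abs_mul _ _
    _ ≤ |μ i - ν i| * 1 := mul_le_mul_of_nonneg_left (hf i) (abs_nonneg _)
    _ = _ := mul_one _

theorem exists_sum_mul_eq_tvDist {ι : Type*} [Fintype ι] (μ ν : ι → ℝ) :
    ∃ f : ι → ℝ, (∀ i, |f i| ≤ 1) ∧ 2 * tvDist μ ν = ∑ i, (μ i - ν i) * f i := by
  refine ⟨fun i => SignType.sign (μ i - ν i), fun i => ?_, ?_⟩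
  · rcases lt_trichotomy (μ i - ν i) 0 with h | h | h
    · simp [h]
    · simp [h]
    · simp [h]
  · unfold tvDist
    rw [← mul_assoc]
    norm_num

/-- Second moment lower bound for the total variation distance. -/
theorem one_sub_le_tvDist {ι : Type*} [Fintype ι] {μ ν : ι → ℝ} (hμ : ∀ i, 0 ≤ μ i)
    (hν : ∀ i, 0 ≤ ν i) (hμ1 : ∑ i, μ i = 1) (hν1 : ∑ i, ν i = 1) (f : ι → ℝ) {a b g v w : ℝ} (hg : 0 < g)
    (hab : g ≤ |a - b|) (hv : ∑ i, μ i * (f i - a) ^ 2 ≤ v) (hw : ∑ i, ν i * (f i - b) ^ 2 ≤ w) :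
    1 - 4 * (v + w) / g ^ 2 ≤ tvDist μ ν := by
  classical
  -- Cut at half the gap around `a` and test with 2e - 1. Chebyshev bounds the mass of `μ` outside
  -- the cut and the mass of `ν` inside it.
  let e : ι → ℝ := fun i => if |f i - a| < g / 2 then 1 else 0
  have h1 : ∀ i, 1 - e i ≤ 4 / g ^ 2 * (f i - a) ^ 2 := by
    intro i
    by_cases h : |f i - a| < g / 2
    · simp only [e, h, if_true, sub_self]; positivity
    · simp only [e, h, if_false, sub_zero]
      have h2 : (g / 2) ^ 2 ≤ (f i - a) ^ 2 := by
        rw [← sq_abs (f i - a)]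
        exact pow_le_pow_left₀ (by positivity) (not_lt.1 h) 2
      rw [div_mul_eq_mul_div, le_div_iff₀ (by positivity)]
      nlinarith
  have h2 : ∀ i, e i ≤ 4 / g ^ 2 * (f i - b) ^ 2 := by
    intro i
    by_cases h : |f i - a| < g / 2
    · simp only [e, h, if_true]
      have h3 : g / 2 ≤ |f i - b| := by
        have : |a - b| ≤ |f i - a| + |f i - b| := by
          have := abs_sub_le a (f i) b
          rwa [abs_sub_comm a (f i)] at this
        linarith
      have h2 : (g / 2) ^ 2 ≤ (f i - b) ^ 2 := by
        rw [← sq_abs (f i - b)]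
        exact pow_le_pow_left₀ (by positivity) h3 2
      rw [div_mul_eq_mul_div, le_div_iff₀ (by positivity)]
      nlinarith
    · simp only [e, h, if_false]; positivity
  have hbnd : ∀ i, |2 * e i - 1| ≤ 1 := by
    intro i
    simp only [e]; split_ifs <;> norm_num
  have key := sum_mul_le_tvDist (μ := μ) (ν := ν) hbnd
  have hexp : ∑ i, (μ i - ν i) * (2 * e i - 1)
      = 2 * (1 - ∑ i, μ i * (1 - e i)) - 2 * ∑ i, ν i * e i := by
    have : ∀ i, (μ i - ν i) * (2 * e i - 1)
        = (μ i + ν i) - 2 * (μ i * (1 - e i)) - 2 * (ν i * e i) := fun i => by ring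
    simp only [this, Finset.sum_sub_distrib, Finset.sum_add_distrib, hμ1, hν1, ← Finset.mul_sum]
    ring
  have h3 : ∑ i, μ i * (1 - e i) ≤ 4 / g ^ 2 * v := by
    calc ∑ i, μ i * (1 - e i) ≤ ∑ i, 4 / g ^ 2 * (μ i * (f i - a) ^ 2) :=
          Finset.sum_le_sum fun i _ => by
            calc μ i * (1 - e i) ≤ μ i * (4 / g ^ 2 * (f i - a) ^ 2) :=
                  mul_le_mul_of_nonneg_left (h1 i) (hμ i)
              _ = _ := by ring
      _ ≤ _ := by rw [← Finset.mul_sum]; gcongr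
  have h4 : ∑ i, ν i * e i ≤ 4 / g ^ 2 * w := by
    calc ∑ i, ν i * e i ≤ ∑ i, 4 / g ^ 2 * (ν i * (f i - b) ^ 2) :=
          Finset.sum_le_sum fun i _ => by
            calc ν i * e i ≤ ν i * (4 / g ^ 2 * (f i - b) ^ 2) :=
                  mul_le_mul_of_nonneg_left (h2 i) (hν i)
              _ = _ := by ring
      _ ≤ _ := by rw [← Finset.mul_sum]; gcongr
  have h5 : 4 * (v + w) / g ^ 2 = 4 / g ^ 2 * v + 4 / g ^ 2 * w := by ring
  rw [h5]
  linarith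

end RateMatrix

/-! ### The noisy voter generator and its coalescing dual -/

section Voter

variable {V : Type*} [Fintype V] [DecidableEq V]

theorem spin_mul_self (j : Fin 2) : spin j * spin j = 1 := by
  unfold spin; split_ifs <;> norm_num

theorem abs_spin (j : Fin 2) : |spin j| = 1 := by
  unfold spin; split_ifs <;> norm_num

theorem spin_zero : spin 0 = -1 := by norm_num [spin]

theorem spin_one : spin 1 = 1 := by norm_num [spin]

theorem act_siteGenerator {S : Type*} [Fintype S] [DecidableEq S] (p : V → (V → S) → S → ℝ)
    (f : (V → S) → ℝ) (x : V → S) :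
    act (siteGenerator p) f x = ∑ u, (∑ j, p u x j * f (Function.update x u j) - f x) := by
  simp only [act, siteGenerator, Finset.sum_mul, sub_mul]
  rw [Finset.sum_comm]
  refine Finset.sum_congr rfl fun u _ => ?_
  rw [Finset.sum_sub_distrib]
  congr 1
  · rw [Finset.sum_comm]
    simp [ite_mul]
  · simp [ite_mul]

variable (G : SimpleGraph V) [DecidableRel G.Adj] (θ : ℝ)

/-- Standing assumptions on the graph and the noise. -/
structure Admissible : Prop where
  connected : G.Connected
  nontrivial : Nontrivial V
  pos : 0 < θ
  le_one : θ ≤ 1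

/-- Average of `g` over the neighbours of `u`. -/
def nbrAvg (g : V → ℝ) (u : V) : ℝ := (∑ w ∈ G.neighborFinset u, g w) / G.degree u

/-- The rate at which `u` copies a vertex, or takes a fresh value. -/
def copyRate (u : V) : V ⊕ Fin 2 → ℝ
  | Sum.inl w => if G.Adj u w then (1 - θ) / G.degree u else 0
  | Sum.inr _ => θ / 2

/-- The value read off at a vertex, or a fixed value. -/
def readOff (x : V → Fin 2) : V ⊕ Fin 2 → Fin 2 := Sum.elim x id

/-- Redirect the vertex `u` to `d`. -/
def redirect (u : V) (d : V ⊕ Fin 2) : V ⊕ Fin 2 → V ⊕ Fin 2 := Function.update id (Sum.inl u) d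

/-- The pathwise form of duality: redirecting all arrows at `u` and then reading `x` is the same as
reading `x` after the update at `u`. -/
theorem readOff_comp_redirect (x : V → Fin 2) (u : V) (d : V ⊕ Fin 2) :
    readOff x ∘ redirect u d = readOff (Function.update x u (readOff x d)) := by
  funext e
  rcases e with v | j
  · by_cases h : v = u
    · subst h; simp [readOff, redirect]
    · simp [readOff, redirect, h]
  · simp [readOff, redirect]

variable {G θ}

theorem Admissible.degree_pos (h : Admissible G θ) (u : V) : (0 : ℝ) < G.degree u := by
  have := h.nontrivial
  exact_mod_cast h.connected.preconnected.degree_pos_of_nontrivial u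

theorem Admissible.one_le_degree (h : Admissible G θ) (u : V) : (1 : ℝ) ≤ G.degree u := by
  have := h.nontrivial
  exact_mod_cast h.connected.preconnected.degree_pos_of_nontrivial u

theorem Admissible.copyRate_nonneg (h : Admissible G θ) (u : V) (d : V ⊕ Fin 2) :
    0 ≤ copyRate G θ u d := by
  rcases d with w | j
  · simp only [copyRate]; split_ifs
    · exact div_nonneg (sub_nonneg.2 h.le_one) (h.degree_pos u).le
    · exact le_rfl
  · simp only [copyRate]; linarith [h.pos]

theorem sum_copyRate_mul (u : V) (q : V ⊕ Fin 2 → ℝ) :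
    ∑ d, copyRate G θ u d * q d = (1 - θ) * nbrAvg G (fun w => q (Sum.inl w)) u
      + θ / 2 * (q (Sum.inr 0) + q (Sum.inr 1)) := by
  rw [Fintype.sum_sum_type]
  congr 1
  · simp only [copyRate, nbrAvg, ite_mul, zero_mul, ← Finset.sum_filter]
    rw [← SimpleGraph.neighborFinset_eq_filter, ← Finset.mul_sum]
    ring
  · rw [Fin.sum_univ_two]; simp only [copyRate]; ring

theorem nbrAvg_const (h : Admissible G θ) (c : ℝ) (u : V) : nbrAvg G (fun _ => c) u = c := by
  unfold nbrAvg
  rw [Finset.sum_const, SimpleGraph.card_neighborFinset_eq_degree, nsmul_eq_mul]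
  exact mul_div_cancel_left₀ c (h.degree_pos u).ne'

theorem Admissible.sum_copyRate (h : Admissible G θ) (u : V) : ∑ d, copyRate G θ u d = 1 := by
  have := sum_copyRate_mul (G := G) (θ := θ) u (fun _ => 1)
  simp only [mul_one, nbrAvg_const h] at this
  rw [this]; ring

/-- Copying and noise become one mechanism, reading a value from a random source. The law of the
source does not depend on the configuration, which is what makes a dual possible. -/
theorem noisyVoterUpdate_eq (u : V) (x : V → Fin 2) (j : Fin 2) :
    noisyVoterUpdate G 2 θ u x j = ∑ d, copyRate G θ u d * if readOff x d = j then 1 else 0 := by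
  rw [sum_copyRate_mul]
  unfold noisyVoterUpdate nbrAvg
  congr 1
  · rw [Finset.sum_boole]; rfl
  · fin_cases j <;> simp [readOff]

theorem act_noisyVoter (f : (V → Fin 2) → ℝ) (x : V → Fin 2) :
    act (noisyVoterGenerator G 2 θ) f x
      = ∑ u, (∑ d, copyRate G θ u d * f (Function.update x u (readOff x d)) - f x) := by
  unfold noisyVoterGenerator
  rw [act_siteGenerator]
  refine Finset.sum_congr rfl fun u _ => ?_
  congr 1
  simp only [noisyVoterUpdate_eq, Finset.sum_mul]
  rw [Finset.sum_comm]
  refine Finset.sum_congr rfl fun d _ => ?_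
  simp

theorem Admissible.isRate (h : Admissible G θ) : IsRate (noisyVoterGenerator G 2 θ) where
  metzler x y hxy := by
    refine siteGenerator_nonneg _ (fun u x j => ?_) hxy
    rw [noisyVoterUpdate_eq]
    refine Finset.sum_nonneg fun d _ => mul_nonneg (h.copyRate_nonneg u d) ?_
    split_ifs <;> norm_num
  row_sum x := by
    have h1 := act_noisyVoter (G := G) (θ := θ) (fun _ => 1) x
    simp only [mul_one, h.sum_copyRate] at h1
    simpa [act] using h1

theorem Admissible.isStationary (h : Admissible G θ) :
    IsStationary (noisyVoterGenerator G 2 θ) (noisyVoterStationary G 2 θ) := by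
  have := h.nontrivial
  exact (isStationary_noisyVoterStationary G h.connected 2 (by norm_num) θ h.pos h.le_one).1

/-- The generator on a function that is affine in the spin of each site. -/
theorem act_noisyVoter_affine (h : Admissible G θ) {f : (V → Fin 2) → ℝ} {x : V → Fin 2}
    {a b : V → ℝ} (hf : ∀ u j, f (Function.update x u j) = a u + b u * spin j) :
    act (noisyVoterGenerator G 2 θ) f x
      = ∑ u, (a u + b u * ((1 - θ) * nbrAvg G (fun w => spin (x w)) u) - f x) := by
  rw [act_noisyVoter]
  refine Finset.sum_congr rfl fun u _ => ?_
  congr 1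
  simp only [hf, mul_add, Finset.sum_add_distrib, ← Finset.sum_mul, h.sum_copyRate, one_mul]
  congr 1
  have := sum_copyRate_mul (G := G) (θ := θ) u (fun d => spin (readOff x d))
  simp only [mul_left_comm _ (b u), ← Finset.mul_sum, this]
  congr 1
  simp [readOff, spin_zero, spin_one]

/-- Generator of the coalescing dual: all arrows pointing to `u` are redirected. -/
def dualGenerator (G : SimpleGraph V) [DecidableRel G.Adj] (θ : ℝ) :
    Matrix (V → V ⊕ Fin 2) (V → V ⊕ Fin 2) ℝ :=
  fun ξ η => ∑ u, ((∑ d, if redirect u d ∘ ξ = η then copyRate G θ u d else 0)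
    - if ξ = η then 1 else 0)

theorem act_dualGenerator (f : (V → V ⊕ Fin 2) → ℝ) (ξ : V → V ⊕ Fin 2) :
    act (dualGenerator G θ) f ξ
      = ∑ u, (∑ d, copyRate G θ u d * f (redirect u d ∘ ξ) - f ξ) := by
  simp only [act, dualGenerator, Finset.sum_mul, sub_mul]
  rw [Finset.sum_comm]
  refine Finset.sum_congr rfl fun u _ => ?_
  rw [Finset.sum_sub_distrib]
  congr 1
  · rw [Finset.sum_comm]
    simp [ite_mul]
  · simp [ite_mul]

theorem Admissible.isRate_dual (h : Admissible G θ) : IsRate (dualGenerator G θ) where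
  metzler ξ η hne := by
    simp only [dualGenerator, hne, if_false, sub_zero]
    refine Finset.sum_nonneg fun u _ => Finset.sum_nonneg fun d _ => ?_
    split_ifs
    · exact h.copyRate_nonneg u d
    · exact le_rfl
  row_sum ξ := by
    have h1 := act_dualGenerator (G := G) (θ := θ) (fun _ => 1) ξ
    simp only [mul_one, h.sum_copyRate] at h1
    simpa [act] using h1

/-- Expectation of a functional of the dual at time `t`, started from the identity. -/
def dualEv (G : SimpleGraph V) [DecidableRel G.Adj] (θ t : ℝ) (f : (V → V ⊕ Fin 2) → ℝ) : ℝ :=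
  evolve (dualGenerator G θ) t f Sum.inl

theorem dualEv_mono (h : Admissible G θ) {t : ℝ} (ht : 0 ≤ t) {f g : (V → V ⊕ Fin 2) → ℝ}
    (hfg : ∀ ξ, f ξ ≤ g ξ) : dualEv G θ t f ≤ dualEv G θ t g :=
  Finset.sum_le_sum fun ξ _ =>
    mul_le_mul_of_nonneg_left (hfg ξ) (h.isRate_dual.law_nonneg ht _ _)

theorem dualEv_nonneg (h : Admissible G θ) {t : ℝ} (ht : 0 ≤ t) {f : (V → V ⊕ Fin 2) → ℝ}
    (hf : ∀ ξ, 0 ≤ f ξ) : 0 ≤ dualEv G θ t f :=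
  h.isRate_dual.metzler.evolve_nonneg ht hf _

theorem dualEv_sub (t : ℝ) (f g : (V → V ⊕ Fin 2) → ℝ) :
    dualEv G θ t (fun ξ => f ξ - g ξ) = dualEv G θ t f - dualEv G θ t g := by
  simp [dualEv, evolve, mul_sub, Finset.sum_sub_distrib]

theorem dualEv_add (t : ℝ) (f g : (V → V ⊕ Fin 2) → ℝ) :
    dualEv G θ t (fun ξ => f ξ + g ξ) = dualEv G θ t f + dualEv G θ t g := by
  simp [dualEv, evolve, mul_add, Finset.sum_add_distrib]

theorem dualEv_const_mul (t c : ℝ) (f : (V → V ⊕ Fin 2) → ℝ) :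
    dualEv G θ t (fun ξ => c * f ξ) = c * dualEv G θ t f := by
  simp [dualEv, evolve, Finset.mul_sum, mul_left_comm]

theorem dualEv_sum {κ : Type*} (t : ℝ) (s : Finset κ) (f : κ → (V → V ⊕ Fin 2) → ℝ) :
    dualEv G θ t (fun ξ => ∑ k ∈ s, f k ξ) = ∑ k ∈ s, dualEv G θ t (f k) := by
  simp only [dualEv, evolve, Finset.mul_sum]
  rw [Finset.sum_comm]

theorem dualEv_const (h : Admissible G θ) (t c : ℝ) : dualEv G θ t (fun _ => c) = c :=
  congrFun (h.isRate_dual.evolve_const t c) _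

theorem abs_dualEv_le (h : Admissible G θ) {t : ℝ} (ht : 0 ≤ t) {f g : (V → V ⊕ Fin 2) → ℝ}
    (hfg : ∀ ξ, |f ξ| ≤ g ξ) : |dualEv G θ t f| ≤ dualEv G θ t g := by
  rw [abs_le]
  constructor
  · have := dualEv_mono h ht (f := fun ξ => -1 * g ξ) (g := f)
      (fun ξ => by linarith [(abs_le.1 (hfg ξ)).1])
    rw [dualEv_const_mul] at this
    linarith
  · exact dualEv_mono h ht fun ξ => (abs_le.1 (hfg ξ)).2

theorem dualEv_zero (f : (V → V ⊕ Fin 2) → ℝ) : dualEv G θ 0 f = f Sum.inl := by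
  rw [dualEv, evolve_zero]

theorem hasDerivAt_dualEv (t : ℝ) (f : (V → V ⊕ Fin 2) → ℝ) :
    HasDerivAt (fun s => dualEv G θ s f) (dualEv G θ t (act (dualGenerator G θ) f)) t :=
  hasDerivAt_evolve _ _ _ _

/-- Duality between the noisy voter model and coalescing random walks with killing. -/
theorem evolve_eq_dualEv (t : ℝ) (F : (V → Fin 2) → ℝ) (x : V → Fin 2) :
    evolve (noisyVoterGenerator G 2 θ) t F x = dualEv G θ t (fun η => F (readOff x ∘ η)) := by
  -- As a function of `x`, the dual expectation solves the backward equation of the voter model: by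
  -- `readOff_comp_redirect` the dual generator acting on the arrows equals the voter generator
  -- acting on `x`. Uniqueness for linear systems concludes.
  have key := eq_evolve_of_deriv (A := noisyVoterGenerator G 2 θ)
    (y := fun t x => dualEv G θ t (fun η => F (readOff x ∘ η))) (fun t x => by
      refine (hasDerivAt_dualEv t _).congr_deriv ?_
      rw [act_noisyVoter]
      have : act (dualGenerator G θ) (fun η => F (readOff x ∘ η)) = fun η =>
          ∑ u, (∑ d, copyRate G θ u d * F (readOff (Function.update x u (readOff x d)) ∘ η)
            - F (readOff x ∘ η)) := by
        funext η
        rw [act_dualGenerator]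
        simp only [← readOff_comp_redirect, Function.comp_assoc]
      rw [this, dualEv_sum]
      refine Finset.sum_congr rfl fun u _ => ?_
      rw [dualEv_sub, dualEv_sum]
      simp only [dualEv_const_mul]) t
  have h := congrFun key x
  rw [h]
  simp only [dualEv_zero]
  rfl

/-- The dual generator on functions of a single arrow. -/
theorem act_dualGenerator_apply (h : Admissible G θ) (w : V) (q : V ⊕ Fin 2 → ℝ)
    (ξ : V → V ⊕ Fin 2) :
    act (dualGenerator G θ) (fun η => q (η w)) ξ
      = Sum.elim (fun v => (1 - θ) * nbrAvg G (fun w => q (Sum.inl w)) v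
          + θ / 2 * (q (Sum.inr 0) + q (Sum.inr 1)) - q (Sum.inl v)) (fun _ => 0) (ξ w) := by
  rw [act_dualGenerator]
  rcases hw : ξ w with v | j
  · rw [Finset.sum_eq_single v]
    · simp only [Function.comp, hw, redirect, Function.update_self, Sum.elim_inl]
      rw [sum_copyRate_mul]
    · intro u _ hu
      have : ∀ d, redirect u d (Sum.inl v) = Sum.inl v := fun d => by
        simp [redirect, hu.symm]
      simp only [Function.comp, hw, this, ← Finset.sum_mul, h.sum_copyRate]
      ring
    · simp
  · simp only [Sum.elim_inr]
    refine Finset.sum_eq_zero fun u _ => ?_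
    have : ∀ d, redirect u d (Sum.inr j) = Sum.inr j := fun d => by simp [redirect]
    simp only [Function.comp, hw, this, ← Finset.sum_mul, h.sum_copyRate]
    ring

/-- Transition probabilities of the killed walk. -/
def walkProb (G : SimpleGraph V) [DecidableRel G.Adj] (θ t : ℝ) (w v : V) : ℝ :=
  dualEv G θ t (fun η => if η w = Sum.inl v then 1 else 0)

theorem walkProb_nonneg (h : Admissible G θ) {t : ℝ} (ht : 0 ≤ t) (w v : V) :
    0 ≤ walkProb G θ t w v :=
  dualEv_nonneg h ht fun η => by split_ifs <;> norm_num

theorem nbrAvg_le_of_le (h : Admissible G θ) {g : V → ℝ} {c : ℝ} {u : V}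
    (hg : ∀ w, G.Adj u w → g w ≤ c) : nbrAvg G g u ≤ c := by
  unfold nbrAvg
  rw [div_le_iff₀ (h.degree_pos u)]
  calc ∑ w ∈ G.neighborFinset u, g w ≤ ∑ w ∈ G.neighborFinset u, c :=
        Finset.sum_le_sum fun w hw => hg w ((G.mem_neighborFinset u w).1 hw)
    _ = c * G.degree u := by
        rw [Finset.sum_const, SimpleGraph.card_neighborFinset_eq_degree, nsmul_eq_mul]; ring

/-- The weighted survival bound for the killed walk. -/
theorem dualEv_weight_le (h : Admissible G θ) {t : ℝ} (ht : 0 ≤ t) (w : V) :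
    dualEv G θ t (fun η => Sum.elim (fun v => (1 + θ) ^ G.dist w v) (fun _ => (0 : ℝ)) (η w))
      ≤ Real.exp (-θ ^ 2 * t) := by
  set q : V ⊕ Fin 2 → ℝ := Sum.elim (fun v => (1 + θ) ^ G.dist w v) (fun _ => (0 : ℝ))
  have hθ := h.pos
  -- A jump changes the distance by at most 1 and happens without killing with weight 1-θ, so the
  -- drift is at most (1-θ)(1+θ) - 1 = -θ². Frozen walks have weight 0.
  have hact : ∀ ξ, act (dualGenerator G θ) (fun η => q (η w)) ξ ≤ -θ ^ 2 * q (ξ w) := by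
    intro ξ
    rw [act_dualGenerator_apply h]
    rcases ξ w with v | j
    · simp only [Sum.elim_inl, q, Sum.elim_inr]
      have h1 : nbrAvg G (fun w' => (1 + θ) ^ G.dist w w') v ≤ (1 + θ) * (1 + θ) ^ G.dist w v := by
        refine nbrAvg_le_of_le h fun w' hw' => ?_
        rw [← pow_succ']
        refine pow_le_pow_right₀ (by linarith) ?_
        have := h.connected.dist_triangle (u := w) (v := v) (w := w')
        rw [SimpleGraph.dist_eq_one_iff_adj.2 hw'] at this
        exact this
      have h2 := mul_le_mul_of_nonneg_left h1 (sub_nonneg.2 h.le_one)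
      nlinarith
    · simp [q]
  have := le_exp_of_deriv_le (c := θ ^ 2) (fun t => hasDerivAt_dualEv (G := G) (θ := θ) t
    (fun η => q (η w))) (fun t ht => by
      rw [← dualEv_const_mul]
      exact dualEv_mono h ht hact) ht
  rw [dualEv_zero] at this
  simpa [q] using this

/-- Markov's inequality for the exponentially weighted survival bound. -/
theorem walkProb_le (h : Admissible G θ) {t : ℝ} (ht : 0 ≤ t) (w v : V) :
    walkProb G θ t w v ≤ Real.exp (-θ ^ 2 * t) * (1 + θ)⁻¹ ^ G.dist w v := by
  have hθ := h.pos
  have hpos : (0 : ℝ) < (1 + θ) ^ G.dist w v := by positivity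
  rw [inv_pow, ← div_eq_mul_inv, le_div_iff₀ hpos, mul_comm]
  refine le_trans ?_ (dualEv_weight_le h ht w)
  unfold walkProb
  rw [← dualEv_const_mul]
  refine dualEv_mono h ht fun η => ?_
  rcases hw : η w with v' | j
  · by_cases hv : v' = v
    · subst hv; simp
    · simp only [Sum.inl.injEq, hv, if_false, mul_zero, Sum.elim_inl]; positivity
  · simp

theorem sum_walkProb_le (h : Admissible G θ) {t : ℝ} (ht : 0 ≤ t) (w : V) :
    ∑ v, walkProb G θ t w v ≤ Real.exp (-θ ^ 2 * t) := by
  have hθ := h.pos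
  refine le_trans ?_ (dualEv_weight_le h ht w)
  unfold walkProb
  rw [← dualEv_sum]
  refine dualEv_mono h ht fun η => ?_
  rcases hw : η w with v' | j
  · simp only [Sum.inl.injEq, Finset.sum_ite_eq, Finset.mem_univ, if_true, Sum.elim_inl]
    exact one_le_pow₀ (by linarith)
  · simp

/-- Influence of changing the configuration on the law of the spins in `A`. -/
theorem abs_evolve_sub_le (h : Admissible G θ) {t : ℝ} (ht : 0 ≤ t) {F : (V → Fin 2) → ℝ}
    {A : Finset V} (hF : DependsOn F (A : Set V)) {c : ℝ} (hc : ∀ x, |F x| ≤ c)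
    (x x' : V → Fin 2) (D : Finset V) (hD : ∀ v, v ∉ D → x v = x' v) :
    |evolve (noisyVoterGenerator G 2 θ) t F x - evolve (noisyVoterGenerator G 2 θ) t F x'|
      ≤ 2 * c * ∑ a ∈ A, ∑ u ∈ D, walkProb G θ t a u := by
  have hc0 : 0 ≤ c := (abs_nonneg _).trans (hc x)
  rw [evolve_eq_dualEv, evolve_eq_dualEv, ← dualEv_sub]
  have h1 : dualEv G θ t (fun η => 2 * c * ∑ a ∈ A, ∑ u ∈ D, if η a = Sum.inl u then 1 else 0)
      = 2 * c * ∑ a ∈ A, ∑ u ∈ D, walkProb G θ t a u := by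
    simp only [dualEv_const_mul, dualEv_sum, walkProb]
  rw [← h1]
  refine abs_dualEv_le h ht fun η => ?_
  have hnn : ∀ a ∈ A, (0 : ℝ) ≤ ∑ u ∈ D, if η a = Sum.inl u then 1 else 0 := fun a _ =>
    Finset.sum_nonneg fun u _ => by split_ifs <;> norm_num
  -- Union bound: the two readings agree on `A` unless some walk started in `A` sits in `D`.
  by_cases hη : ∃ a ∈ A, ∃ u ∈ D, η a = Sum.inl u
  · obtain ⟨a, ha, u, hu, hau⟩ := hη
    have h2 : (1 : ℝ) ≤ ∑ a ∈ A, ∑ u ∈ D, if η a = Sum.inl u then 1 else 0 := by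
      refine le_trans ?_ (Finset.single_le_sum hnn ha)
      have := Finset.single_le_sum (f := fun u => if η a = Sum.inl u then (1 : ℝ) else 0)
        (fun u _ => by split_ifs <;> norm_num) hu
      simpa [hau] using this
    calc _ ≤ |F (readOff x ∘ η)| + |F (readOff x' ∘ η)| := abs_sub _ _
      _ ≤ 2 * c * 1 := by linarith [hc (readOff x ∘ η), hc (readOff x' ∘ η)]
      _ ≤ _ := by gcongr
  · push Not at hη
    have : F (readOff x ∘ η) = F (readOff x' ∘ η) := by
      refine hF fun a ha => ?_
      rcases hw : η a with v | j
      · have : v ∉ D := fun hv => hη a ha v hv hw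
        simp [readOff, hw, hD v this]
      · simp [readOff, hw]
    rw [this, sub_self, abs_zero]
    exact mul_nonneg (by positivity) (Finset.sum_nonneg hnn)

/-- Convergence to equilibrium. -/
theorem abs_evolve_sub_stationary_le (h : Admissible G θ) {t : ℝ} (ht : 0 ≤ t)
    {F : (V → Fin 2) → ℝ} {c : ℝ} (hc : ∀ x, |F x| ≤ c) (x : V → Fin 2) :
    |evolve (noisyVoterGenerator G 2 θ) t F x - ∑ y, noisyVoterStationary G 2 θ y * F y|
      ≤ 2 * c * (Fintype.card V * Real.exp (-θ ^ 2 * t)) := by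
  have hμ := h.isStationary
  have hc0 : 0 ≤ c := (abs_nonneg _).trans (hc x)
  rw [← hμ.sum_mul_evolve F t]
  have h1 : evolve (noisyVoterGenerator G 2 θ) t F x
      = ∑ y, noisyVoterStationary G 2 θ y * evolve (noisyVoterGenerator G 2 θ) t F x := by
    rw [← Finset.sum_mul, hμ.sum_eq_one, one_mul]
  rw [h1, ← Finset.sum_sub_distrib]
  have hb : ∀ y, |evolve (noisyVoterGenerator G 2 θ) t F x
      - evolve (noisyVoterGenerator G 2 θ) t F y|
      ≤ 2 * c * (Fintype.card V * Real.exp (-θ ^ 2 * t)) := by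
    intro y
    refine (abs_evolve_sub_le h ht (A := Finset.univ) (fun a b hab => ?_) hc x y
      Finset.univ (by simp)).trans ?_
    · congr 1; funext v; exact hab v (by simp)
    · gcongr
      refine (Finset.sum_le_sum fun a _ => sum_walkProb_le h ht a).trans ?_
      rw [Finset.sum_const, nsmul_eq_mul, Finset.card_univ]
  calc _ ≤ ∑ y, |noisyVoterStationary G 2 θ y * evolve (noisyVoterGenerator G 2 θ) t F x
        - noisyVoterStationary G 2 θ y * evolve (noisyVoterGenerator G 2 θ) t F y| :=
        Finset.abs_sum_le_sum_abs _ _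
    _ ≤ ∑ y, noisyVoterStationary G 2 θ y * (2 * c * (Fintype.card V * Real.exp (-θ ^ 2 * t))) := by
        refine Finset.sum_le_sum fun y _ => ?_
        rw [← mul_sub, abs_mul, abs_of_nonneg (hμ.nonneg y)]
        exact mul_le_mul_of_nonneg_left (hb y) (hμ.nonneg y)
    _ = _ := by rw [← Finset.sum_mul, hμ.sum_eq_one, one_mul]

theorem tendsto_evolve (h : Admissible G θ) (F : (V → Fin 2) → ℝ) (x : V → Fin 2) :
    Filter.Tendsto (fun t => evolve (noisyVoterGenerator G 2 θ) t F x) Filter.atTop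
      (nhds (∑ y, noisyVoterStationary G 2 θ y * F y)) := by
  have hc : ∀ y, |F y| ≤ ∑ y, |F y| := fun y =>
    Finset.single_le_sum (f := fun y => |F y|) (fun _ _ => abs_nonneg _) (Finset.mem_univ y)
  rw [tendsto_iff_dist_tendsto_zero]
  have h2 : Filter.Tendsto (fun t : ℝ => 2 * (∑ y, |F y|) *
      (Fintype.card V * Real.exp (-θ ^ 2 * t))) Filter.atTop (nhds 0) := by
    have h3 : Filter.Tendsto (fun t : ℝ => -θ ^ 2 * t) Filter.atTop Filter.atBot :=
      Filter.tendsto_id.const_mul_atTop_of_neg (by have := h.pos; nlinarith)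
    have := ((Real.tendsto_exp_atBot.comp h3).const_mul (Fintype.card V : ℝ)).const_mul
      (2 * (∑ y, |F y|))
    simpa using this
  refine squeeze_zero' (Filter.Eventually.of_forall fun _ => dist_nonneg) ?_ h2
  filter_upwards [Filter.eventually_ge_atTop 0] with t ht
  exact abs_evolve_sub_stationary_le h ht hc x

end Voter

/-! ### Asymptotic independence of distant sets of spins -/

section Decoupling

variable {V : Type*} [Fintype V] [DecidableEq V] {G : SimpleGraph V} [DecidableRel G.Adj] {θ : ℝ}

/-- Bound on the dependence between the spins at `a` and `b`. -/
def overlap (G : SimpleGraph V) (θ : ℝ) (a b : V) : ℝ :=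
  2 / θ ^ 2 * ∑ u, (1 + θ)⁻¹ ^ G.dist a u * (1 + θ)⁻¹ ^ G.dist b u

/-- A probability vector under which the spins in two sets `A`, `B` are independent up to an error
`∑ overlap` in total variation. -/
structure Decoupled (G : SimpleGraph V) (θ : ℝ) (ν : (V → Fin 2) → ℝ) : Prop where
  nonneg : ∀ x, 0 ≤ ν x
  sum_eq_one : ∑ x, ν x = 1
  decouple : ∀ (A B : Finset V) (F : (V → Fin 2) → (V → Fin 2) → ℝ),
    (∀ x', DependsOn (fun x => F x x') (A : Set V)) → (∀ x, DependsOn (F x) (B : Set V)) →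
    (∀ x x', |F x x'| ≤ 1) →
    |∑ x, ν x * F x x - ∑ x, ∑ x', ν x * (ν x' * F x x')| ≤ ∑ a ∈ A, ∑ b ∈ B, overlap G θ a b

/-- `H + K exp(-c s)` is nonincreasing on [0, t]; this replaces integrating the derivative bound. -/
theorem le_of_deriv_le_exp {H H' : ℝ → ℝ} {c K t : ℝ} (hK : 0 ≤ K) (ht : 0 ≤ t)
    (hH : ∀ s, HasDerivAt H (H' s) s)
    (hle : ∀ s, 0 ≤ s → s ≤ t → H' s ≤ c * K * Real.exp (-c * s)) : H t - H 0 ≤ K := by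
  have hd : ∀ s, HasDerivAt (fun s => H s + K * Real.exp (-c * s))
      (H' s + K * (Real.exp (-c * s) * (-c))) s := by
    intro s
    have : HasDerivAt (fun r : ℝ => -c * r) (-c) s := by
      simpa using (hasDerivAt_id s).const_mul (-c)
    exact (hH s).add (this.exp.const_mul K)
  have hanti : AntitoneOn (fun s => H s + K * Real.exp (-c * s)) (Set.Icc 0 t) := by
    refine antitoneOn_of_deriv_nonpos (convex_Icc 0 t)
      (fun s _ => (hd s).continuousAt.continuousWithinAt)
      (fun s _ => (hd s).differentiableAt.differentiableWithinAt) (fun s hs => ?_)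
    rw [interior_Icc] at hs
    rw [(hd s).deriv]
    have := hle s hs.1.le hs.2.le
    linarith
  have h := hanti (Set.left_mem_Icc.2 ht) (Set.right_mem_Icc.2 ht) ht
  simp only [mul_zero, Real.exp_zero, mul_one] at h
  have : 0 ≤ K * Real.exp (-c * t) := by positivity
  linarith

/-- Two independent copies of the chain, evaluated on a function of two configurations. -/
def evolveTwo {ι : Type*} [Fintype ι] [DecidableEq ι] (Q : Matrix ι ι ℝ) (t : ℝ) (F : ι → ι → ℝ)
    (x x' : ι) : ℝ := evolve Q t (fun y => evolve Q t (F y) x') x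

theorem hasDerivAt_evolveTwo_diag {ι : Type*} [Fintype ι] [DecidableEq ι] (Q : Matrix ι ι ℝ)
    (t : ℝ) (F : ι → ι → ℝ) (x : ι) :
    HasDerivAt (fun s => evolveTwo Q s F x x)
      (act Q (fun z => evolveTwo Q t F z x) x + act Q (fun z => evolveTwo Q t F x z) x) t := by
  have h := HasDerivAt.fun_sum (u := Finset.univ)
    (fun y _ => (hasDerivAt_law' Q t x y).mul (hasDerivAt_evolve' Q t (F y) x))
  refine h.congr_deriv ?_
  rw [Finset.sum_add_distrib]
  congr 1
  · have key : ∀ e : ι → ℝ, ∑ y, (∑ k, Q x k * law Q k t y) * e y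
        = ∑ k, Q x k * evolve Q t e k := by
      intro e
      simp only [evolve, Finset.sum_mul, Finset.mul_sum]
      rw [Finset.sum_comm]
      simp only [mul_assoc]
    exact key _
  · simp only [act, evolveTwo, evolve, Finset.mul_sum]
    rw [Finset.sum_comm]
    refine Finset.sum_congr rfl fun k _ => Finset.sum_congr rfl fun y _ =>
      Finset.sum_congr rfl fun z _ => by ring

theorem overlap_nonneg (h : Admissible G θ) (a b : V) : 0 ≤ overlap G θ a b := by
  have := h.pos
  unfold overlap; positivity

/-- Two applications of the influence bound. The difference in the second argument is a function of
the first, depends only on `A`, and is bounded by twice the hitting probability from `B`; its own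
variation at `u` brings the factor from `A`. -/
theorem abs_mixed_difference_le (h : Admissible G θ) {s : ℝ} (hs : 0 ≤ s) {A B : Finset V}
    {F : (V → Fin 2) → (V → Fin 2) → ℝ}
    (hA : ∀ x', DependsOn (fun x => F x x') (A : Set V)) (hB : ∀ x, DependsOn (F x) (B : Set V))
    (hF : ∀ x x', |F x x'| ≤ 1) (x : V → Fin 2) (u : V) (j : Fin 2) :
    |evolveTwo (noisyVoterGenerator G 2 θ) s F (Function.update x u j) (Function.update x u j)
      - evolveTwo (noisyVoterGenerator G 2 θ) s F (Function.update x u j) x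
      - evolveTwo (noisyVoterGenerator G 2 θ) s F x (Function.update x u j)
      + evolveTwo (noisyVoterGenerator G 2 θ) s F x x|
      ≤ 4 * ((∑ a ∈ A, walkProb G θ s a u) * ∑ b ∈ B, walkProb G θ s b u) := by
  set Q := noisyVoterGenerator G 2 θ
  set x₁ := Function.update x u j
  have hD : ∀ v, v ∉ ({u} : Finset V) → x₁ v = x v := fun v hv => by
    have : v ≠ u := by simpa using hv
    simp [x₁, this]
  set g : (V → Fin 2) → ℝ := fun y => evolve Q s (F y) x₁ - evolve Q s (F y) x
  have hg : ∀ y, |g y| ≤ 2 * ∑ b ∈ B, walkProb G θ s b u := by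
    intro y
    have := abs_evolve_sub_le h hs (hB y) (hF y) x₁ x {u} hD
    simpa using this
  have hgA : DependsOn g (A : Set V) := by
    intro y z hyz
    have : F y = F z := funext fun x' => hA x' hyz
    simp only [g, this]
  have h2 := abs_evolve_sub_le h hs hgA hg x₁ x {u} hD
  have h3 : ∀ z, evolve Q s g z = evolveTwo Q s F z x₁ - evolveTwo Q s F z x := by
    intro z
    simp [evolveTwo, g, evolve, mul_sub, Finset.sum_sub_distrib]
  rw [h3, h3] at h2
  simp only [Finset.sum_singleton] at h2
  calc _ = |evolveTwo Q s F x₁ x₁ - evolveTwo Q s F x₁ x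
        - (evolveTwo Q s F x x₁ - evolveTwo Q s F x x)| := by congr 1; ring
    _ ≤ _ := h2
    _ = _ := by ring

/-- Duhamel interpolation: use two independent copies up to time s and a single shared copy for the
remaining t - s. The derivative in s compares the generator on the diagonal with the sum of two
separate generators, which leaves only mixed second differences at one updated site. These are at
most 4 ∑_u of products of hitting probabilities, of order e^{-2θ²s}; total mass 4/(2θ²) is the
constant in `overlap`. -/
theorem abs_evolve_diag_sub_le (h : Admissible G θ) {t : ℝ} (ht : 0 ≤ t) {A B : Finset V}
    {F : (V → Fin 2) → (V → Fin 2) → ℝ}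
    (hA : ∀ x', DependsOn (fun x => F x x') (A : Set V)) (hB : ∀ x, DependsOn (F x) (B : Set V))
    (hF : ∀ x x', |F x x'| ≤ 1) (x : V → Fin 2) :
    |evolve (noisyVoterGenerator G 2 θ) t (fun y => F y y) x
      - evolveTwo (noisyVoterGenerator G 2 θ) t F x x| ≤ ∑ a ∈ A, ∑ b ∈ B, overlap G θ a b := by
  set Q := noisyVoterGenerator G 2 θ
  set K := ∑ a ∈ A, ∑ b ∈ B, overlap G θ a b
  have hθ := h.pos
  have hK : 0 ≤ K := Finset.sum_nonneg fun a _ => Finset.sum_nonneg fun b _ =>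
    overlap_nonneg h a b
  set w' : ℝ → (V → Fin 2) → ℝ := fun s x =>
    act Q (fun z => evolveTwo Q s F z x) x + act Q (fun z => evolveTwo Q s F x z) x
  have hd : ∀ s, HasDerivAt (fun r => evolve Q (t - r) (fun y => evolveTwo Q r F y y) x)
      (evolve Q (t - s) (fun y => w' s y - act Q (fun y => evolveTwo Q s F y y) y) x) s := fun s =>
    hasDerivAt_evolve_sub Q t s (fun r y => evolveTwo Q r F y y) (w' s)
      (fun y => hasDerivAt_evolveTwo_diag Q s F y) x
  have hb : ∀ s, 0 ≤ s → ∀ y, |w' s y - act Q (fun y => evolveTwo Q s F y y) y|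
      ≤ (2 * θ ^ 2) * K * Real.exp (-(2 * θ ^ 2) * s) := by
    intro s hs y
    -- Updating both arguments together minus updating each alone: the first-order terms cancel and
    -- minus the mixed difference remains.
    have e1 : w' s y - act Q (fun y => evolveTwo Q s F y y) y
        = ∑ u, ∑ d, copyRate G θ u d *
          -(evolveTwo Q s F (Function.update y u (readOff y d)) (Function.update y u (readOff y d))
            - evolveTwo Q s F (Function.update y u (readOff y d)) y
            - evolveTwo Q s F y (Function.update y u (readOff y d)) + evolveTwo Q s F y y) := by
      simp only [w', Q, act_noisyVoter]
      rw [← Finset.sum_add_distrib, ← Finset.sum_sub_distrib]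
      refine Finset.sum_congr rfl fun u _ => ?_
      simp only [mul_neg, mul_add, mul_sub, Finset.sum_add_distrib, Finset.sum_sub_distrib,
        Finset.sum_neg_distrib, ← Finset.sum_mul, h.sum_copyRate, one_mul]
      ring
    rw [e1]
    calc _ ≤ ∑ u, ∑ d, copyRate G θ u d *
          (4 * ((∑ a ∈ A, walkProb G θ s a u) * ∑ b ∈ B, walkProb G θ s b u)) := by
          refine (Finset.abs_sum_le_sum_abs _ _).trans (Finset.sum_le_sum fun u _ =>
            (Finset.abs_sum_le_sum_abs _ _).trans (Finset.sum_le_sum fun d _ => ?_))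
          rw [abs_mul, abs_of_nonneg (h.copyRate_nonneg u d), abs_neg]
          exact mul_le_mul_of_nonneg_left (abs_mixed_difference_le h hs hA hB hF y u _)
            (h.copyRate_nonneg u d)
      _ = ∑ u, 4 * ((∑ a ∈ A, walkProb G θ s a u) * ∑ b ∈ B, walkProb G θ s b u) := by
          simp only [← Finset.sum_mul, h.sum_copyRate, one_mul]
      _ ≤ ∑ u, 4 * ((∑ a ∈ A, Real.exp (-θ ^ 2 * s) * (1 + θ)⁻¹ ^ G.dist a u)
            * ∑ b ∈ B, Real.exp (-θ ^ 2 * s) * (1 + θ)⁻¹ ^ G.dist b u) := by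
          have hnn : ∀ (C : Finset V) u, 0 ≤ ∑ b ∈ C, walkProb G θ s b u := fun C u =>
            Finset.sum_nonneg fun b _ => walkProb_nonneg h hs b u
          have hle : ∀ (C : Finset V) u, ∑ b ∈ C, walkProb G θ s b u
              ≤ ∑ b ∈ C, Real.exp (-θ ^ 2 * s) * (1 + θ)⁻¹ ^ G.dist b u := fun C u =>
            Finset.sum_le_sum fun b _ => walkProb_le h hs b u
          refine Finset.sum_le_sum fun u _ => mul_le_mul_of_nonneg_left ?_ (by norm_num)
          exact mul_le_mul (hle A u) (hle B u) (hnn B u) ((hnn A u).trans (hle A u))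
      _ = _ := by
          have hexp : Real.exp (-(2 * θ ^ 2) * s)
              = Real.exp (-θ ^ 2 * s) * Real.exp (-θ ^ 2 * s) := by
            rw [← Real.exp_add]; congr 1; ring
          simp only [K, overlap, hexp, ← Finset.mul_sum]
          have hsw : ∑ a ∈ A, ∑ b ∈ B, ∑ u, (1 + θ)⁻¹ ^ G.dist a u * (1 + θ)⁻¹ ^ G.dist b u
              = ∑ u, (∑ a ∈ A, (1 + θ)⁻¹ ^ G.dist a u) * ∑ b ∈ B, (1 + θ)⁻¹ ^ G.dist b u := by
            simp only [Finset.sum_mul_sum]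
            rw [Finset.sum_comm (s := Finset.univ) (t := A)]
            refine Finset.sum_congr rfl fun a _ => ?_
            rw [Finset.sum_comm]
          rw [hsw, Finset.mul_sum, Finset.mul_sum, Finset.mul_sum, Finset.sum_mul]
          refine Finset.sum_congr rfl fun u _ => ?_
          field_simp
          ring
  have hb2 : ∀ s, 0 ≤ s → s ≤ t →
      |evolve Q (t - s) (fun y => w' s y - act Q (fun y => evolveTwo Q s F y y) y) x|
        ≤ (2 * θ ^ 2) * K * Real.exp (-(2 * θ ^ 2) * s) := fun s hs hst =>
    h.isRate.abs_evolve_le (sub_nonneg.2 hst) (hb s hs) x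
  have h1 := le_of_deriv_le_exp (c := 2 * θ ^ 2) hK ht hd
    (fun s hs hst => (abs_le.1 (hb2 s hs hst)).2)
  have h2 := le_of_deriv_le_exp (c := 2 * θ ^ 2) hK ht (fun s => (hd s).neg)
    (fun s hs hst => by linarith [(abs_le.1 (hb2 s hs hst)).1])
  have e0 : evolve Q (t - 0) (fun y => evolveTwo Q 0 F y y) x
      = evolve Q t (fun y => F y y) x := by
    simp only [sub_zero, evolveTwo, evolve_zero]
  have et : evolve Q (t - t) (fun y => evolveTwo Q t F y y) x = evolveTwo Q t F x x := by
    rw [sub_self, evolve_zero]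
  simp only [Pi.neg_apply] at h2
  rw [e0, et] at h1 h2
  rw [abs_le]
  constructor <;> linarith

theorem Admissible.decoupled_law (h : Admissible G θ) {t : ℝ} (ht : 0 ≤ t) (x : V → Fin 2) :
    Decoupled G θ (law (noisyVoterGenerator G 2 θ) x t) where
  nonneg := h.isRate.law_nonneg ht x
  sum_eq_one := h.isRate.sum_law t x
  decouple A B F hA hB hF := by
    have := abs_evolve_diag_sub_le h ht hA hB hF x
    simpa only [evolveTwo, evolve, Finset.mul_sum] using this

theorem tendsto_law (h : Admissible G θ) (x y : V → Fin 2) :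
    Filter.Tendsto (fun t => law (noisyVoterGenerator G 2 θ) x t y) Filter.atTop
      (nhds (noisyVoterStationary G 2 θ y)) := by
  have := tendsto_evolve h (fun z => if z = y then 1 else 0) x
  simpa [evolve] using this

/-- The bound at time t does not depend on t and passes to the limit of the law from any fixed
state. -/
theorem Admissible.decoupled_stationary (h : Admissible G θ) :
    Decoupled G θ (noisyVoterStationary G 2 θ) where
  nonneg := h.isStationary.nonneg
  sum_eq_one := h.isStationary.sum_eq_one
  decouple A B F hA hB hF := by
    have x : V → Fin 2 := fun _ => 0
    have hl := fun y => tendsto_law h x y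
    have h1 := tendsto_finsetSum Finset.univ (fun y _ => (hl y).mul_const (F y y))
    have h2 := tendsto_finsetSum Finset.univ (fun y _ => tendsto_finsetSum Finset.univ
      (fun y' _ => (hl y).mul ((hl y').mul_const (F y y'))))
    refine le_of_tendsto (h1.sub h2).abs ?_
    filter_upwards [Filter.eventually_ge_atTop 0] with t ht
    exact (h.decoupled_law ht x).decouple A B F hA hB hF

/-- Covariance bound. -/
theorem Decoupled.abs_cov_le {ν : (V → Fin 2) → ℝ} (hν : Decoupled G θ ν) {A B : Finset V}
    {f g : (V → Fin 2) → ℝ} (hf : DependsOn f (A : Set V)) (hg : DependsOn g (B : Set V))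
    (hf1 : ∀ x, |f x| ≤ 1) (hg1 : ∀ x, |g x| ≤ 1) :
    |∑ x, ν x * (f x * g x) - (∑ x, ν x * f x) * ∑ x, ν x * g x|
      ≤ ∑ a ∈ A, ∑ b ∈ B, overlap G θ a b := by
  have := hν.decouple A B (fun x x' => f x * g x') (fun x' y z hyz => by simp only [hf hyz])
    (fun x y z hyz => by simp only [hg hyz])
    (fun x x' => by rw [abs_mul]; exact mul_le_one₀ (hf1 x) (abs_nonneg _) (hg1 x'))
  convert this using 3
  rw [Finset.sum_mul_sum]
  refine Finset.sum_congr rfl fun x _ => Finset.sum_congr rfl fun x' _ => by ring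

end Decoupling

/-! ### Consequences of the growth condition, second moments, and the linear test function -/

section Moments

variable {V : Type*} [Fintype V] [DecidableEq V] {G : SimpleGraph V} [DecidableRel G.Adj] {θ : ℝ}

theorem eventually_rpow_le {α γ : ℝ} (hα : 0 < α) (hγ : 0 < γ) :
    ∀ᶠ r : ℕ in Filter.atTop, (r : ℝ) ^ (1 - α) ≤ γ * r := by
  have h := (tendsto_rpow_neg_atTop hα).comp (tendsto_natCast_atTop_atTop (R := ℝ))
  filter_upwards [h.eventually (ge_mem_nhds hγ), Filter.eventually_gt_atTop 0] with r hr hr0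
  have h0 : (0 : ℝ) < r := by exact_mod_cast hr0
  simp only [Function.comp] at hr
  rw [sub_eq_neg_add, Real.rpow_add h0, Real.rpow_one]
  exact mul_le_mul_of_nonneg_right hr h0.le

/-- r^{1-α} is eventually below half of r·log(1+θ), so the terms are dominated by a geometric
series. -/
theorem summable_growth {θ α : ℝ} (c₀ : ℝ) (hθ : 0 < θ) (hα : 0 < α) :
    Summable fun r : ℕ => c₀ * Real.exp ((r : ℝ) ^ (1 - α)) * (1 + θ)⁻¹ ^ r := by
  simp only [mul_assoc]
  refine Summable.mul_left c₀ ?_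
  have hlog : 0 < Real.log (1 + θ) := Real.log_pos (by linarith)
  have hgeo : Summable fun r : ℕ => Real.exp (-(Real.log (1 + θ) / 2)) ^ r :=
    summable_geometric_of_lt_one (Real.exp_pos _).le (by rw [Real.exp_lt_one_iff]; linarith)
  refine summable_of_isBigO_nat hgeo (Asymptotics.IsBigO.of_bound 1 ?_)
  filter_upwards [eventually_rpow_le hα (half_pos hlog)] with r hr
  have h1 : (1 + θ)⁻¹ ^ r = Real.exp (-(Real.log (1 + θ)) * r) := by
    rw [mul_comm, Real.exp_nat_mul, Real.exp_neg, Real.exp_log (by linarith)]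
  rw [h1, ← Real.exp_add, ← Real.exp_nat_mul, one_mul, Real.norm_eq_abs, Real.norm_eq_abs,
    Real.abs_exp, Real.abs_exp, Real.exp_le_exp]
  linarith

/-- Bound for `∑ u, (1 + θ)⁻¹ ^ dist w u` on graphs of subexponential growth. -/
def growthConst (θ α c₀ : ℝ) : ℝ :=
  1 + ∑' r : ℕ, c₀ * Real.exp ((r : ℝ) ^ (1 - α)) * (1 + θ)⁻¹ ^ r

theorem SubexpGrowth.card_le {α c₀ : ℝ} (hg : SubexpGrowth G c₀ α) {v : V} {r : ℕ} (hr : 1 ≤ r)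
    {s : Finset V} (hs : ∀ u ∈ s, G.dist v u ≤ r) :
    (s.card : ℝ) ≤ c₀ * Real.exp ((r : ℝ) ^ (1 - α)) := by
  refine le_trans ?_ (hg v r hr)
  have h : (s : Set V) ⊆ {w : V | G.dist v w ≤ r} := fun u hu => hs u hu
  have := Set.ncard_le_ncard h (Set.toFinite _)
  rw [Set.ncard_coe_finset] at this
  exact_mod_cast this

theorem sum_pow_dist_le {α c₀ : ℝ} (h : Admissible G θ) (hα : 0 < α) (hc : 0 < c₀)
    (hg : SubexpGrowth G c₀ α) (w : V) :
    ∑ u, (1 + θ)⁻¹ ^ G.dist w u ≤ growthConst θ α c₀ := by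
  have hθ := h.pos
  set N := (Finset.univ.sup fun u => G.dist w u) + 1
  have hfib : ∑ u, (1 + θ)⁻¹ ^ G.dist w u
      = ∑ r ∈ Finset.range N, ∑ u ∈ Finset.univ.filter (fun u => G.dist w u = r),
        (1 + θ)⁻¹ ^ G.dist w u :=
    (Finset.sum_fiberwise_of_maps_to (fun u _ => Finset.mem_range.2
      (Nat.lt_succ_of_le (Finset.le_sup (f := fun u => G.dist w u) (Finset.mem_univ u)))) _).symm
  -- The growth condition starts at radius 1; the sphere of radius 0 is one point and is paid for by
  -- the extra 1 in `growthConst`.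
  have hterm : ∀ r, ∑ u ∈ Finset.univ.filter (fun u => G.dist w u = r), (1 + θ)⁻¹ ^ G.dist w u
      ≤ (if r = 0 then 1 else 0) + c₀ * Real.exp ((r : ℝ) ^ (1 - α)) * (1 + θ)⁻¹ ^ r := by
    intro r
    have h1 : ∑ u ∈ Finset.univ.filter (fun u => G.dist w u = r), (1 + θ)⁻¹ ^ G.dist w u
        = ((Finset.univ.filter (fun u => G.dist w u = r)).card : ℝ) * (1 + θ)⁻¹ ^ r := by
      rw [Finset.sum_congr rfl (fun u hu => by rw [(Finset.mem_filter.1 hu).2]),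
        Finset.sum_const, nsmul_eq_mul]
    rw [h1]
    rcases Nat.eq_zero_or_pos r with rfl | hr
    · have : (Finset.univ.filter (fun u => G.dist w u = 0)) = {w} := by
        ext u
        simp only [Finset.mem_filter, Finset.mem_univ, true_and, Finset.mem_singleton]
        rw [(h.connected w u).dist_eq_zero_iff, eq_comm]
      rw [this]
      simp only [Finset.card_singleton, Nat.cast_one, pow_zero, mul_one, if_true]
      have : 0 ≤ c₀ * Real.exp (((0 : ℕ) : ℝ) ^ (1 - α)) := by positivity
      linarith
    · rw [if_neg hr.ne', zero_add]
      gcongr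
      exact hg.card_le hr fun u hu => (Finset.mem_filter.1 hu).2.le
  rw [hfib]
  refine (Finset.sum_le_sum fun r _ => hterm r).trans ?_
  rw [Finset.sum_add_distrib]
  unfold growthConst
  gcongr
  · rw [Finset.sum_ite_eq']; split_ifs <;> norm_num
  · exact (summable_growth c₀ hθ hα).sum_le_tsum _ (fun r _ => by positivity)

theorem degree_le {α c₀ : ℝ} (hg : SubexpGrowth G c₀ α) (u : V) :
    (G.degree u : ℝ) ≤ c₀ * Real.exp 1 := by
  have h1 := hg.card_le (v := u) (s := G.neighborFinset u) le_rfl fun w hw =>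
    (SimpleGraph.dist_eq_one_iff_adj.2 ((G.mem_neighborFinset u w).1 hw)).le
  simpa only [Nat.cast_one, Real.one_rpow, SimpleGraph.card_neighborFinset_eq_degree] using h1

theorem overlap_comm (a b : V) : overlap G θ a b = overlap G θ b a := by
  unfold overlap
  simp only [mul_comm]

theorem sum_overlap_le (h : Admissible G θ) {B : ℝ}
    (hB : ∀ w, ∑ u, (1 + θ)⁻¹ ^ G.dist w u ≤ B) (a : V) :
    ∑ b, overlap G θ a b ≤ 2 / θ ^ 2 * B ^ 2 := by
  have hθ := h.pos
  have hB0 : 0 ≤ B := le_trans (Finset.sum_nonneg fun u _ => by positivity) (hB a)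
  unfold overlap
  rw [← Finset.mul_sum, Finset.sum_comm]
  gcongr
  calc ∑ u, ∑ b, (1 + θ)⁻¹ ^ G.dist a u * (1 + θ)⁻¹ ^ G.dist b u
      = ∑ u, (1 + θ)⁻¹ ^ G.dist a u * ∑ b, (1 + θ)⁻¹ ^ G.dist u b := by
        refine Finset.sum_congr rfl fun u _ => ?_
        rw [Finset.mul_sum]
        refine Finset.sum_congr rfl fun b _ => ?_
        rw [G.dist_comm (u := b)]
    _ ≤ ∑ u, (1 + θ)⁻¹ ^ G.dist a u * B := by
        gcongr with u _; exact hB u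
    _ = (∑ u, (1 + θ)⁻¹ ^ G.dist a u) * B := (Finset.sum_mul _ _ _).symm
    _ ≤ B * B := by gcongr; exact hB a
    _ = B ^ 2 := (sq B).symm

/-- Variance of a sum of local observables. -/
theorem Decoupled.variance_le {ν : (V → Fin 2) → ℝ} (hν : Decoupled G θ ν) {I : Type*} [Fintype I]
    {A : I → Finset V} {f : I → (V → Fin 2) → ℝ} (hf : ∀ i, DependsOn (f i) (A i : Set V))
    (hf1 : ∀ i x, |f i x| ≤ 1) (c : I → ℝ) :
    ∑ x, ν x * (∑ i, c i * f i x - ∑ i, c i * ∑ x, ν x * f i x) ^ 2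
      ≤ ∑ i, ∑ j, |c i| * |c j| * ∑ a ∈ A i, ∑ b ∈ A j, overlap G θ a b := by
  set m : I → ℝ := fun i => ∑ x, ν x * f i x
  have h1 : ∑ x, ν x * (∑ i, c i * f i x - ∑ i, c i * m i) ^ 2
      = ∑ i, ∑ j, c i * c j * (∑ x, ν x * (f i x * f j x) - m i * m j) := by
    have e1 : ∀ x, (∑ i, c i * f i x - ∑ i, c i * m i) ^ 2
        = ∑ i, ∑ j, c i * c j * ((f i x - m i) * (f j x - m j)) := by
      intro x
      rw [← Finset.sum_sub_distrib, sq, Finset.sum_mul_sum]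
      refine Finset.sum_congr rfl fun i _ => Finset.sum_congr rfl fun j _ => by ring
    simp only [e1, Finset.mul_sum]
    rw [Finset.sum_comm]
    refine Finset.sum_congr rfl fun i _ => ?_
    rw [Finset.sum_comm]
    refine Finset.sum_congr rfl fun j _ => ?_
    have e2 : ∀ x, ν x * (c i * c j * ((f i x - m i) * (f j x - m j)))
        = c i * c j * (ν x * (f i x * f j x) - m j * (ν x * f i x) - m i * (ν x * f j x)
          + m i * m j * ν x) := fun x => by ring
    simp only [e2]
    rw [← Finset.mul_sum, Finset.sum_add_distrib, Finset.sum_sub_distrib, Finset.sum_sub_distrib,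
      ← Finset.mul_sum, ← Finset.mul_sum, ← Finset.mul_sum, hν.sum_eq_one]
    change c i * c j * (_ - m j * m i - m i * m j + _) = _
    ring
  rw [h1]
  refine Finset.sum_le_sum fun i _ => Finset.sum_le_sum fun j _ => ?_
  refine (le_abs_self _).trans ?_
  rw [abs_mul, abs_mul]
  exact mul_le_mul_of_nonneg_left (hν.abs_cov_le (hf i) (hf j) (hf1 i) (hf1 j)) (by positivity)

theorem dependsOn_spin (v : V) :
    DependsOn (fun x : V → Fin 2 => spin (x v)) (({v} : Finset V) : Set V) := by
  intro x y hxy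
  have : x v = y v := hxy v (by simp)
  simp only [this]

/-- Schur test: |c_i c_j| ≤ (c_i² + c_j²)/2, and the symmetric kernel `overlap` has bounded row
sums. -/
theorem Decoupled.variance_linear_le {ν : (V → Fin 2) → ℝ} (hν : Decoupled G θ ν)
    (h : Admissible G θ) {B : ℝ} (hB : ∀ w, ∑ u, (1 + θ)⁻¹ ^ G.dist w u ≤ B) (c : V → ℝ) :
    ∑ x, ν x * (∑ v, c v * spin (x v) - ∑ v, c v * ∑ x, ν x * spin (x v)) ^ 2
      ≤ 2 / θ ^ 2 * B ^ 2 * ∑ v, c v ^ 2 := by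
  refine (hν.variance_le (A := fun v => {v}) (f := fun v x => spin (x v)) dependsOn_spin
    (fun v x => (abs_spin _).le) c).trans ?_
  simp only [Finset.sum_singleton]
  have h1 : ∀ i j, |c i| * |c j| * overlap G θ i j
      ≤ c i ^ 2 / 2 * overlap G θ i j + c j ^ 2 / 2 * overlap G θ j i := by
    intro i j
    rw [overlap_comm j i, ← add_mul]
    refine mul_le_mul_of_nonneg_right ?_ (overlap_nonneg h i j)
    have := two_mul_le_add_sq |c i| |c j|
    rw [sq_abs, sq_abs] at this
    linarith
  have h2 : ∑ i, ∑ j, c i ^ 2 / 2 * overlap G θ i j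
      ≤ 2 / θ ^ 2 * B ^ 2 * ∑ v, c v ^ 2 / 2 := by
    rw [Finset.mul_sum]
    refine Finset.sum_le_sum fun i _ => ?_
    rw [← Finset.mul_sum, mul_comm]
    exact mul_le_mul_of_nonneg_right (sum_overlap_le h hB i) (by positivity)
  calc _ ≤ ∑ i, ∑ j, (c i ^ 2 / 2 * overlap G θ i j + c j ^ 2 / 2 * overlap G θ j i) :=
        Finset.sum_le_sum fun i _ => Finset.sum_le_sum fun j _ => h1 i j
    _ = ∑ i, ∑ j, c i ^ 2 / 2 * overlap G θ i j + ∑ i, ∑ j, c i ^ 2 / 2 * overlap G θ i j := by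
        simp only [Finset.sum_add_distrib]
        congr 1
        rw [Finset.sum_comm]
    _ ≤ _ := by
        rw [← Finset.sum_div] at h2
        linarith

theorem sum_mul_nbrAvg {I : Type*} (s : Finset I) (c : I → ℝ) (g : I → V → ℝ) (u : V) :
    ∑ i ∈ s, c i * nbrAvg G (g i) u = nbrAvg G (fun w => ∑ i ∈ s, c i * g i w) u := by
  unfold nbrAvg
  simp only [← mul_div_assoc, ← Finset.sum_div, Finset.mul_sum]
  rw [Finset.sum_comm]

theorem act_spin (h : Admissible G θ) (v : V) (x : V → Fin 2) :
    act (noisyVoterGenerator G 2 θ) (fun x => spin (x v)) x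
      = (1 - θ) * nbrAvg G (fun w => spin (x w)) v - spin (x v) := by
  rw [act_noisyVoter_affine h (a := fun u => if u = v then 0 else spin (x v))
    (b := fun u => if u = v then 1 else 0)]
  · rw [Finset.sum_eq_single v]
    · simp
    · intro u _ hu; simp [hu]
    · simp
  · intro u j
    by_cases hu : u = v
    · subst hu; simp
    · simp [hu, Ne.symm hu]

/-- Expected spin at `v` at time `t`. -/
def meanSpin (G : SimpleGraph V) [DecidableRel G.Adj] (θ : ℝ) (x : V → Fin 2) (t : ℝ) (v : V) : ℝ :=
  evolve (noisyVoterGenerator G 2 θ) t (fun x => spin (x v)) x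

theorem hasDerivAt_meanSpin (h : Admissible G θ) (x : V → Fin 2) (t : ℝ) (v : V) :
    HasDerivAt (fun s => meanSpin G θ x s v)
      ((1 - θ) * nbrAvg G (meanSpin G θ x t) v - meanSpin G θ x t v) t := by
  refine (hasDerivAt_evolve _ t _ x).congr_deriv ?_
  have : act (noisyVoterGenerator G 2 θ) (fun x => spin (x v))
      = fun x => (1 - θ) * nbrAvg G (fun w => spin (x w)) v - spin (x v) :=
    funext fun x => act_spin h v x
  rw [this]
  simp only [evolve, mul_sub, Finset.sum_sub_distrib]
  congr 1
  simp only [mul_left_comm _ (1 - θ), ← Finset.mul_sum]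
  rw [sum_mul_nbrAvg]
  rfl

theorem meanSpin_zero (x : V → Fin 2) (v : V) : meanSpin G θ x 0 v = spin (x v) := by
  rw [meanSpin, evolve_zero]

theorem abs_nbrAvg_le (h : Admissible G θ) {g : V → ℝ} {c : ℝ} {u : V}
    (hg : ∀ w, |g w| ≤ c) : |nbrAvg G g u| ≤ c := by
  rw [abs_le]
  constructor
  · have := nbrAvg_le_of_le h (g := fun w => -g w) (u := u)
      (fun w _ => (neg_le_abs (g w)).trans (hg w))
    have e : nbrAvg G (fun w => -g w) u = -nbrAvg G g u := by
      simp [nbrAvg, neg_div]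
    linarith
  · exact nbrAvg_le_of_le h fun w _ => (le_abs_self _).trans (hg w)

/-- Maximum principle: the stationary mean equals (1-θ) times its neighbour average, so its largest
absolute value is at most (1-θ) times itself. -/
theorem stationary_mean_spin (h : Admissible G θ) (v : V) :
    ∑ x, noisyVoterStationary G 2 θ x * spin (x v) = 0 := by
  set m : V → ℝ := fun v => ∑ x, noisyVoterStationary G 2 θ x * spin (x v)
  have hm : ∀ v, m v = (1 - θ) * nbrAvg G m v := by
    intro v
    have h1 := h.isStationary.sum_mul_act (fun x => spin (x v))
    simp only [act_spin h, mul_sub, Finset.sum_sub_distrib, mul_left_comm _ (1 - θ),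
      ← Finset.mul_sum] at h1
    rw [sum_mul_nbrAvg] at h1
    linarith
  obtain ⟨w, -, hw⟩ := Finset.exists_max_image Finset.univ (fun v => |m v|) ⟨v, Finset.mem_univ v⟩
  have hle : |m w| ≤ (1 - θ) * |m w| := by
    conv_lhs => rw [hm w]
    rw [abs_mul, abs_of_nonneg (sub_nonneg.2 h.le_one)]
    exact mul_le_mul_of_nonneg_left (abs_nbrAvg_le h fun u => hw u (Finset.mem_univ u))
      (sub_nonneg.2 h.le_one)
  have h0 : |m w| ≤ 0 := by
    have := h.pos
    nlinarith [abs_nonneg (m w)]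
  exact abs_eq_zero.1 (le_antisymm ((hw v (Finset.mem_univ v)).trans h0) (abs_nonneg _))

/-- Lower bound from the linear test function `∑ z_v σ_v`, where `z` is the mean at time `t`. -/
theorem linear_lower_bound (h : Admissible G θ) {B : ℝ}
    (hB : ∀ w, ∑ u, (1 + θ)⁻¹ ^ G.dist w u ≤ B) {t : ℝ} (ht : 0 ≤ t) (x : V → Fin 2)
    {g : ℝ} (hg : 0 < g) (hge : g ≤ ∑ v, meanSpin G θ x t v ^ 2) :
    1 - 16 / θ ^ 2 * B ^ 2 / g
      ≤ tvDist (law (noisyVoterGenerator G 2 θ) x t) (noisyVoterStationary G 2 θ) := by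
  set z := meanSpin G θ x t
  set S := ∑ v, z v ^ 2
  have hS : 0 < S := hg.trans_le hge
  have h1 := (h.decoupled_law ht x).variance_linear_le h hB z
  have h2 := h.decoupled_stationary.variance_linear_le h hB z
  -- With the means as coefficients, the statistic has mean `S` at time t and 0 in equilibrium, and
  -- both variances are O(S).
  have key := one_sub_le_tvDist (g := S) (h.isRate.law_nonneg ht x) h.isStationary.nonneg
    (h.isRate.sum_law t x) h.isStationary.sum_eq_one (fun x => ∑ v, z v * spin (x v)) hS
    (a := ∑ v, z v * ∑ y, law (noisyVoterGenerator G 2 θ) x t y * spin (y v))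
    (b := ∑ v, z v * ∑ x, noisyVoterStationary G 2 θ x * spin (x v)) (by
      simp only [stationary_mean_spin h, mul_zero, Finset.sum_const_zero, sub_zero]
      refine le_trans (le_of_eq ?_) (le_abs_self _)
      refine Finset.sum_congr rfl fun v _ => ?_
      rw [sq]; rfl) h1 h2
  refine le_trans ?_ key
  have e : 4 * (2 / θ ^ 2 * B ^ 2 * S + 2 / θ ^ 2 * B ^ 2 * S) / S ^ 2
      = 16 / θ ^ 2 * B ^ 2 / S := by
    field_simp; ring
  rw [e]
  have := h.pos
  gcongr

theorem sum_sum_neighbor_symm (f : V → V → ℝ) :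
    ∑ v, ∑ w ∈ G.neighborFinset v, f v w = ∑ v, ∑ w ∈ G.neighborFinset v, f w v := by
  refine Finset.sum_comm' fun v w => ?_
  simp [G.adj_comm]

/-- Degree weights make the walk reversible, so the derivative of the energy is a quadratic form
over edges. Nonnegativity of (z_v + z_w)² bounds it below by -(2(1-θ) + 2) times the energy, with
equality for alternating z. The initial energy is the sum of the degrees. -/
theorem energy_lower_bound (h : Admissible G θ) {t : ℝ} (ht : 0 ≤ t) (x : V → Fin 2) :
    Real.exp (-(4 - 2 * θ) * t) * Fintype.card V
      ≤ ∑ v, G.degree v * meanSpin G θ x t v ^ 2 := by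
  have hd : ∀ t, HasDerivAt (fun t => ∑ v, G.degree v * meanSpin G θ x t v ^ 2)
      (∑ v, G.degree v * (2 * meanSpin G θ x t v *
        ((1 - θ) * nbrAvg G (meanSpin G θ x t) v - meanSpin G θ x t v))) t := by
    intro t
    refine HasDerivAt.fun_sum fun v _ => ?_
    have := ((hasDerivAt_meanSpin h x t v).pow 2).const_mul (G.degree v : ℝ)
    refine this.congr_deriv ?_
    push_cast; ring
  have hge := exp_le_of_le_deriv (c := 4 - 2 * θ) hd (fun t _ => by
    set z := meanSpin G θ x t
    have e1 : ∑ v, (G.degree v : ℝ) * (2 * z v * ((1 - θ) * nbrAvg G z v - z v))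
        = 2 * (1 - θ) * ∑ v, ∑ w ∈ G.neighborFinset v, z v * z w
          - 2 * ∑ v, G.degree v * z v ^ 2 := by
      rw [Finset.mul_sum, Finset.mul_sum, ← Finset.sum_sub_distrib]
      refine Finset.sum_congr rfl fun v _ => ?_
      rw [← Finset.mul_sum]
      unfold nbrAvg
      have := (h.degree_pos v).ne'
      field_simp
    have e2 : ∑ v, ∑ w ∈ G.neighborFinset v, z v ^ 2 = ∑ v, G.degree v * z v ^ 2 := by
      refine Finset.sum_congr rfl fun v _ => ?_
      rw [Finset.sum_const, SimpleGraph.card_neighborFinset_eq_degree, nsmul_eq_mul]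
    have e3 : ∑ v, ∑ w ∈ G.neighborFinset v, z w ^ 2 = ∑ v, G.degree v * z v ^ 2 := by
      rw [← e2]; exact sum_sum_neighbor_symm (fun v w => z w ^ 2)
    have e4 : -∑ v, G.degree v * z v ^ 2 ≤ ∑ v, ∑ w ∈ G.neighborFinset v, z v * z w := by
      have : 0 ≤ ∑ v, ∑ w ∈ G.neighborFinset v, (z v + z w) ^ 2 / 2 :=
        Finset.sum_nonneg fun v _ => Finset.sum_nonneg fun w _ => by positivity
      have e5 : ∑ v, ∑ w ∈ G.neighborFinset v, (z v + z w) ^ 2 / 2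
          = (∑ v, ∑ w ∈ G.neighborFinset v, z v ^ 2) / 2
            + (∑ v, ∑ w ∈ G.neighborFinset v, z w ^ 2) / 2
            + ∑ v, ∑ w ∈ G.neighborFinset v, z v * z w := by
        simp only [Finset.sum_div, ← Finset.sum_add_distrib]
        refine Finset.sum_congr rfl fun v _ => Finset.sum_congr rfl fun w _ => by ring
      rw [e5, e2, e3] at this
      linarith
    rw [e1]
    have := mul_le_mul_of_nonneg_left e4 (sub_nonneg.2 h.le_one)
    linarith) ht
  refine le_trans ?_ hge
  gcongr
  simp only [meanSpin_zero, sq, spin_mul_self, mul_one]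
  calc (Fintype.card V : ℝ) = ∑ v : V, (1 : ℝ) := by simp
    _ ≤ _ := Finset.sum_le_sum fun v _ => h.one_le_degree v

end Moments

/-! ### Reversible matrices -/

section Reversible

variable {ι : Type*} [Fintype ι] [DecidableEq ι]

theorem act_evolve (A : Matrix ι ι ℝ) (t : ℝ) (f : ι → ℝ) :
    act A (evolve A t f) = evolve A t (act A f) :=
  funext fun i => (hasDerivAt_evolve' A t f i).unique (hasDerivAt_evolve A t f i)

/-- As functions of the first index, `law A · t j` and its time-reversed counterpart solve the same
linear system with the same initial value. -/
theorem law_reversible {A : Matrix ι ι ℝ} {π : ι → ℝ} (hπ : ∀ i, 0 < π i)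
    (hA : ∀ i j, π i * A i j = π j * A j i) (t : ℝ) (i j : ι) :
    π i * law A i t j = π j * law A j t i := by
  have key := eq_evolve_of_deriv (A := A) (y := fun t p => π j / π p * law A j t p) (fun t p => by
    refine ((hasDerivAt_law A t j p).const_mul (π j / π p)).congr_deriv ?_
    rw [Finset.mul_sum]
    refine Finset.sum_congr rfl fun k _ => ?_
    have h1 := hA k p
    have hk := (hπ k).ne'
    have hp := (hπ p).ne'
    have : A p k = π k * A k p / π p := by field_simp; linarith
    rw [this]
    field_simp) t
  have h := congrFun key i
  have e : evolve A t (fun p => π j / π p * law A j 0 p) i = law A i t j := by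
    unfold evolve
    rw [Finset.sum_eq_single j]
    · beta_reduce
      rw [law_zero, if_pos rfl, div_self (hπ j).ne', mul_one, mul_one]
    · intro k _ hk
      beta_reduce
      rw [law_zero, if_neg hk.symm, mul_zero, mul_zero]
    · simp
  rw [e] at h
  rw [← h]
  have := (hπ i).ne'
  field_simp

theorem sum_mul_act_symm {A : Matrix ι ι ℝ} {π : ι → ℝ}
    (hA : ∀ i j, π i * A i j = π j * A j i) (f g : ι → ℝ) :
    ∑ i, π i * (f i * act A g i) = ∑ i, π i * (act A f i * g i) := by
  have e1 : ∑ i, π i * (f i * act A g i) = ∑ i, ∑ j, (π i * A i j) * (f i * g j) := by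
    refine Finset.sum_congr rfl fun i _ => ?_
    simp only [act, Finset.mul_sum]
    exact Finset.sum_congr rfl fun j _ => by ring
  have e2 : ∑ i, π i * (act A f i * g i) = ∑ i, ∑ j, (π i * A i j) * (f j * g i) := by
    refine Finset.sum_congr rfl fun i _ => ?_
    simp only [act, Finset.mul_sum, Finset.sum_mul]
    exact Finset.sum_congr rfl fun j _ => by ring
  rw [e1, e2, Finset.sum_comm]
  exact Finset.sum_congr rfl fun i _ => Finset.sum_congr rfl fun j _ => by rw [hA]

theorem sum_mul_evolve_symm {A : Matrix ι ι ℝ} {π : ι → ℝ} (hπ : ∀ i, 0 < π i)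
    (hA : ∀ i j, π i * A i j = π j * A j i) (t : ℝ) (f g : ι → ℝ) :
    ∑ i, π i * (f i * evolve A t g i) = ∑ i, π i * (evolve A t f i * g i) := by
  have := sum_mul_act_symm (A := fun i j => law A i t j) (law_reversible hπ hA t) f g
  exact this

/-- Lower bound for the quadratic form of `exp (t A)` by a Rayleigh quotient of `A`. -/
theorem rayleigh_lower_bound {A : Matrix ι ι ℝ} {π : ι → ℝ} (hπ : ∀ i, 0 < π i)
    (hA : ∀ i j, π i * A i j = π j * A j i) {ψ : ι → ℝ} {lam : ℝ}
    (hlam : -lam * ∑ i, π i * ψ i ^ 2 ≤ ∑ i, π i * (ψ i * act A ψ i)) {t : ℝ} (ht : 0 ≤ t) :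
    Real.exp (-lam * t) * ∑ i, π i * ψ i ^ 2 ≤ ∑ i, π i * (ψ i * evolve A t ψ i) := by
  set φ₀ : ℝ → ℝ := fun t => ∑ i, π i * (ψ i * evolve A t ψ i)
  set φ₁ : ℝ → ℝ := fun t => ∑ i, π i * (ψ i * evolve A t (act A ψ) i)
  set φ₂ : ℝ → ℝ := fun t => ∑ i, π i * (ψ i * evolve A t (act A (act A ψ)) i)
  have hd0 : ∀ t, HasDerivAt φ₀ (φ₁ t) t := fun t =>
    HasDerivAt.fun_sum fun i _ => ((hasDerivAt_evolve A t ψ i).const_mul _).const_mul _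
  have hd1 : ∀ t, HasDerivAt φ₁ (φ₂ t) t := fun t =>
    HasDerivAt.fun_sum fun i _ => ((hasDerivAt_evolve A t (act A ψ) i).const_mul _).const_mul _
  -- By symmetry this is the squared norm of (A + lam) exp(tA/2) ψ. It makes exp(lam t)(φ₁ + lam φ₀)
  -- nondecreasing; that quantity starts nonnegative by `hlam`, so φ₀' ≥ -lam φ₀. This replaces
  -- Jensen's inequality for the spectral measure.
  have hpos : ∀ t, 0 ≤ φ₂ t + 2 * lam * φ₁ t + lam ^ 2 * φ₀ t := by
    intro t
    set y := evolve A (t / 2) ψ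
    set w := evolve A (t / 2) (act A ψ)
    have hhalf : ∀ f, evolve A t f = evolve A (t / 2) (evolve A (t / 2) f) := fun f => by
      rw [← evolve_add, add_halves]
    have e0 : φ₀ t = ∑ i, π i * (y i * y i) := by
      simp only [φ₀, hhalf]
      rw [sum_mul_evolve_symm hπ hA]
    have e1 : φ₁ t = ∑ i, π i * (y i * w i) := by
      simp only [φ₁, hhalf]
      rw [sum_mul_evolve_symm hπ hA]
    have e2 : φ₂ t = ∑ i, π i * (w i * w i) := by
      simp only [φ₂, ← act_evolve A _ (act A ψ)]
      rw [sum_mul_act_symm hA]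
      simp only [hhalf]
      rw [sum_mul_evolve_symm hπ hA]
    rw [e0, e1, e2, Finset.mul_sum, Finset.mul_sum, ← Finset.sum_add_distrib,
      ← Finset.sum_add_distrib]
    refine Finset.sum_nonneg fun i _ => ?_
    have := mul_nonneg (hπ i).le (sq_nonneg (w i + lam * y i))
    linarith
  have hmono : ∀ t, 0 ≤ t → Real.exp (-lam * t) * (φ₁ 0 + lam * φ₀ 0) ≤ φ₁ t + lam * φ₀ t :=
    fun t ht => exp_le_of_le_deriv (g := fun t => φ₁ t + lam * φ₀ t) (c := lam)
      (fun t => (hd1 t).add ((hd0 t).const_mul lam)) (fun t _ => by linarith [hpos t]) ht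
  have h0 : 0 ≤ φ₁ 0 + lam * φ₀ 0 := by
    simp only [φ₁, φ₀, evolve_zero]
    have : ∑ i, π i * (ψ i * ψ i) = ∑ i, π i * ψ i ^ 2 := by simp only [sq]
    rw [this]; linarith
  have := exp_le_of_le_deriv (c := lam) hd0 (fun t ht => by
    have h1 := (mul_nonneg (Real.exp_pos (-lam * t)).le h0).trans (hmono t ht)
    linarith) ht
  refine le_trans (le_of_eq ?_) this
  simp only [φ₀, evolve_zero, sq]

end Reversible

/-! ### Two-point functions and the quadratic test function -/

section Quadratic

variable {V : Type*} [Fintype V] [DecidableEq V] {G : SimpleGraph V} [DecidableRel G.Adj] {θ : ℝ}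

theorem act_spin_mul_spin (h : Admissible G θ) {u v : V} (huv : u ≠ v) (x : V → Fin 2) :
    act (noisyVoterGenerator G 2 θ) (fun x => spin (x u) * spin (x v)) x
      = (1 - θ) * (nbrAvg G (fun w => spin (x w) * spin (x v)) u
          + nbrAvg G (fun w => spin (x u) * spin (x w)) v) - 2 * (spin (x u) * spin (x v)) := by
  rw [act_noisyVoter_affine h
    (a := fun k => if k = u then 0 else if k = v then 0 else spin (x u) * spin (x v))
    (b := fun k => if k = u then spin (x v) else if k = v then spin (x u) else 0)]
  · have hsub : ∑ k, ((if k = u then 0 else if k = v then 0 else spin (x u) * spin (x v))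
        + (if k = u then spin (x v) else if k = v then spin (x u) else 0)
          * ((1 - θ) * nbrAvg G (fun w => spin (x w)) k) - spin (x u) * spin (x v))
        = ∑ k ∈ {u, v}, ((if k = u then 0 else if k = v then 0 else spin (x u) * spin (x v))
        + (if k = u then spin (x v) else if k = v then spin (x u) else 0)
          * ((1 - θ) * nbrAvg G (fun w => spin (x w)) k) - spin (x u) * spin (x v)) := by
      refine (Finset.sum_subset (Finset.subset_univ _) fun k _ hk => ?_).symm
      simp only [Finset.mem_insert, Finset.mem_singleton, not_or] at hk
      simp [hk.1, hk.2]
    rw [hsub, Finset.sum_pair huv]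
    simp only [if_true, huv.symm, if_false]
    have e1 : nbrAvg G (fun w => spin (x w) * spin (x v)) u
        = spin (x v) * nbrAvg G (fun w => spin (x w)) u := by
      unfold nbrAvg; rw [← Finset.sum_mul]; ring
    have e2 : nbrAvg G (fun w => spin (x u) * spin (x w)) v
        = spin (x u) * nbrAvg G (fun w => spin (x w)) v := by
      unfold nbrAvg; rw [← Finset.mul_sum]; ring
    rw [e1, e2]; ring
  · intro k j
    by_cases hk : k = u
    · subst hk; simp [huv.symm, mul_comm]
    · by_cases hk' : k = v
      · subst hk'; simp [huv, hk]
      · simp [hk', hk, Ne.symm hk', Ne.symm hk]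

/-- Restriction of a function of two vertices to distinct pairs. -/
def offDiag (f : V → V → ℝ) (p : V × V) : ℝ := if p.1 = p.2 then 0 else f p.1 p.2

/-- Generator of two independent killed walks stopped when they meet. -/
def pairGenerator (G : SimpleGraph V) [DecidableRel G.Adj] (θ : ℝ) : Matrix (V × V) (V × V) ℝ :=
  fun p q => (if p = q then -2 else 0) + if p.1 ≠ p.2 ∧ q.1 ≠ q.2 then
    (1 - θ) * ((if q.2 = p.2 ∧ G.Adj p.1 q.1 then (G.degree p.1 : ℝ)⁻¹ else 0)
      + if q.1 = p.1 ∧ G.Adj p.2 q.2 then (G.degree p.2 : ℝ)⁻¹ else 0) else 0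

theorem isMetzler_pairGenerator (h : Admissible G θ) : IsMetzler (pairGenerator G θ) := by
  intro p q hpq
  have := sub_nonneg.2 h.le_one
  simp only [pairGenerator, hpq, if_false, zero_add]
  split_ifs <;> positivity

theorem act_pairGenerator_offDiag (f : V → V → ℝ) (p : V × V) :
    act (pairGenerator G θ) (offDiag f) p
      = if p.1 = p.2 then 0 else (1 - θ) * (nbrAvg G (fun w => offDiag f (w, p.2)) p.1
        + nbrAvg G (fun w => offDiag f (p.1, w)) p.2) - 2 * f p.1 p.2 := by
  obtain ⟨u, v⟩ := p
  simp only [act, pairGenerator, add_mul, Finset.sum_add_distrib, ite_mul, zero_mul,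
    Finset.sum_ite_eq, Finset.mem_univ, if_true]
  by_cases huv : u = v
  · simp [huv, offDiag]
  · simp only [huv, ne_eq, not_false_eq_true, true_and, if_false]
    have e0 : ∀ q : V × V, (if ¬ q.1 = q.2 then (1 - θ) *
        ((if q.2 = v ∧ G.Adj u q.1 then (G.degree u : ℝ)⁻¹ else 0)
          + if q.1 = u ∧ G.Adj v q.2 then (G.degree v : ℝ)⁻¹ else 0) * offDiag f q else 0)
        = (1 - θ) * ((if q.2 = v then if G.Adj u q.1 then (G.degree u : ℝ)⁻¹ * offDiag f q else 0
            else 0)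
          + if q.1 = u then if G.Adj v q.2 then (G.degree v : ℝ)⁻¹ * offDiag f q else 0
            else 0) := by
      intro q
      by_cases hq : q.1 = q.2
      · simp [offDiag, hq]
      · simp only [hq, not_false_eq_true, if_true, ite_and]
        split_ifs <;> ring
    simp only [e0, ← Finset.mul_sum, Finset.sum_add_distrib]
    have e1 : ∑ q : V × V, (if q.2 = v then if G.Adj u q.1 then
        (G.degree u : ℝ)⁻¹ * offDiag f q else 0 else 0)
        = nbrAvg G (fun w => offDiag f (w, v)) u := by
      rw [Fintype.sum_prod_type]
      simp only [Finset.sum_ite_eq', Finset.mem_univ, if_true, ← Finset.sum_filter]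
      rw [← SimpleGraph.neighborFinset_eq_filter, ← Finset.mul_sum, nbrAvg, div_eq_inv_mul]
    have e2 : ∑ q : V × V, (if q.1 = u then if G.Adj v q.2 then
        (G.degree v : ℝ)⁻¹ * offDiag f q else 0 else 0)
        = nbrAvg G (fun w => offDiag f (u, w)) v := by
      rw [Fintype.sum_prod_type_right]
      simp only [Finset.sum_ite_eq', Finset.mem_univ, if_true, ← Finset.sum_filter]
      rw [← SimpleGraph.neighborFinset_eq_filter, ← Finset.mul_sum, nbrAvg, div_eq_inv_mul]
    rw [e1, e2]
    simp only [offDiag, huv, if_false]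
    ring

/-- One walk is reversible for the degree, two independent ones for the product of degrees, and
stopping at the diagonal is a symmetric restriction. -/
theorem pairGenerator_reversible (h : Admissible G θ) (p q : V × V) :
    (G.degree p.1 * G.degree p.2 : ℝ) * pairGenerator G θ p q
      = (G.degree q.1 * G.degree q.2 : ℝ) * pairGenerator G θ q p := by
  obtain ⟨u, v⟩ := p
  obtain ⟨u', v'⟩ := q
  by_cases hpq : (u, v) = (u', v')
  · rw [hpq]
  have hd := fun u => (h.degree_pos u).ne'
  simp only [pairGenerator, hpq, Ne.symm hpq, if_false, zero_add]
  by_cases hc : u ≠ v ∧ u' ≠ v'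
  · rw [if_pos hc, if_pos hc.symm]
    have a1 : (G.degree u * G.degree v : ℝ)
        * (if v' = v ∧ G.Adj u u' then (G.degree u : ℝ)⁻¹ else 0)
        = (G.degree u' * G.degree v' : ℝ)
          * (if v = v' ∧ G.Adj u' u then (G.degree u' : ℝ)⁻¹ else 0) := by
      by_cases hv : v' = v
      · subst hv
        simp only [G.adj_comm u' u]
        split_ifs
        · have := hd u; have := hd u'; field_simp
        · simp
      · simp [hv, Ne.symm hv]
    have a2 : (G.degree u * G.degree v : ℝ)
        * (if u' = u ∧ G.Adj v v' then (G.degree v : ℝ)⁻¹ else 0)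
        = (G.degree u' * G.degree v' : ℝ)
          * (if u = u' ∧ G.Adj v' v then (G.degree v' : ℝ)⁻¹ else 0) := by
      by_cases hv : u' = u
      · subst hv
        simp only [G.adj_comm v' v]
        split_ifs
        · have := hd v; have := hd v'; field_simp
        · simp
      · simp [hv, Ne.symm hv]
    linear_combination (1 - θ) * a1 + (1 - θ) * a2
  · have hc' : ¬ (u' ≠ v' ∧ u ≠ v) := fun hh => hc hh.symm
    rw [if_neg hc, if_neg hc']
    simp

/-- Two-point function at time `t`. -/
def pairMean (G : SimpleGraph V) [DecidableRel G.Adj] (θ : ℝ) (x : V → Fin 2) (t : ℝ)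
    (u v : V) : ℝ :=
  evolve (noisyVoterGenerator G 2 θ) t (fun x => spin (x u) * spin (x v)) x

/-- Two-point function in equilibrium. -/
def pairStat (G : SimpleGraph V) [DecidableRel G.Adj] (θ : ℝ) (u v : V) : ℝ :=
  ∑ x, noisyVoterStationary G 2 θ x * (spin (x u) * spin (x v))

theorem hasDerivAt_pairMean (h : Admissible G θ) (x : V → Fin 2) (t : ℝ) {u v : V} (huv : u ≠ v) :
    HasDerivAt (fun s => pairMean G θ x s u v)
      ((1 - θ) * (nbrAvg G (fun w => pairMean G θ x t w v) u
        + nbrAvg G (fun w => pairMean G θ x t u w) v) - 2 * pairMean G θ x t u v) t := by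
  refine (hasDerivAt_evolve _ t _ x).congr_deriv ?_
  rw [funext fun x => act_spin_mul_spin h huv x]
  unfold pairMean evolve
  rw [← sum_mul_nbrAvg, ← sum_mul_nbrAvg, ← Finset.sum_add_distrib, Finset.mul_sum, Finset.mul_sum,
    ← Finset.sum_sub_distrib]
  exact Finset.sum_congr rfl fun y _ => by ring

theorem pairStat_eq (h : Admissible G θ) {u v : V} (huv : u ≠ v) :
    2 * pairStat G θ u v = (1 - θ) * (nbrAvg G (fun w => pairStat G θ w v) u
        + nbrAvg G (fun w => pairStat G θ u w) v) := by
  have h1 := h.isStationary.sum_mul_act (fun x => spin (x u) * spin (x v))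
  rw [funext fun x => act_spin_mul_spin h huv x] at h1
  unfold pairStat
  rw [← sum_mul_nbrAvg, ← sum_mul_nbrAvg, ← Finset.sum_add_distrib, Finset.mul_sum, Finset.mul_sum]
  rw [← sub_eq_zero, ← Finset.sum_sub_distrib, ← neg_eq_zero, ← Finset.sum_neg_distrib, ← h1]
  exact Finset.sum_congr rfl fun y _ => by ring

theorem pairMean_self (h : Admissible G θ) (x : V → Fin 2) (t : ℝ) (u : V) :
    pairMean G θ x t u u = 1 := by
  unfold pairMean
  simp only [spin_mul_self]
  rw [h.isRate.evolve_const]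

theorem pairStat_self (h : Admissible G θ) (u : V) : pairStat G θ u u = 1 := by
  unfold pairStat
  simp only [spin_mul_self, mul_one, h.isStationary.sum_eq_one]

/-- Exact evolution of the deviation of the two-point function from equilibrium. -/
theorem pairMean_sub_pairStat (h : Admissible G θ) (x : V → Fin 2) (t : ℝ) :
    offDiag (fun u v => pairMean G θ x t u v - pairStat G θ u v)
      = evolve (pairGenerator G θ) t
        (offDiag (fun u v => spin (x u) * spin (x v) - pairStat G θ u v)) := by
  have key := eq_evolve_of_deriv (A := pairGenerator G θ)
    (y := fun t => offDiag (fun u v => pairMean G θ x t u v - pairStat G θ u v)) (fun t p => by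
      obtain ⟨u, v⟩ := p
      rw [act_pairGenerator_offDiag]
      by_cases huv : u = v
      · simp only [offDiag, huv, if_true]; exact hasDerivAt_const _ _
      · simp only [huv, if_false]
        -- Both two-point functions are 1 on the diagonal, so their difference vanishes there: the
        -- inhomogeneous boundary value cancels and the system closes off the diagonal.
        have hoff : ∀ a b, offDiag (fun u v => pairMean G θ x t u v - pairStat G θ u v) (a, b)
            = pairMean G θ x t a b - pairStat G θ a b := by
          intro a b
          by_cases hab : a = b
          · subst hab; simp [offDiag, pairMean_self h, pairStat_self h]
          · simp [offDiag, hab]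
        simp only [hoff]
        have hfun : (fun r => offDiag (fun u v => pairMean G θ x r u v - pairStat G θ u v) (u, v))
            = fun r => pairMean G θ x r u v - pairStat G θ u v := by
          funext r; simp [offDiag, huv]
        rw [hfun]
        refine ((hasDerivAt_pairMean h x t huv).sub_const _).congr_deriv ?_
        have hs := pairStat_eq h huv
        have e : ∀ (f g : V → ℝ) (w : V), nbrAvg G (fun k => f k - g k) w
            = nbrAvg G f w - nbrAvg G g w := by
          intro f g w; simp [nbrAvg, Finset.sum_sub_distrib, sub_div]
        rw [e, e]
        linarith) t
  rw [key]
  congr 1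
  funext p
  simp only [offDiag, pairMean, evolve_zero]

/-- The product of two means solves the system without stopping at the diagonal. Stopping only drops
the terms z_a² ≥ 0, so the product is a supersolution of the stopped system with the same initial
value. -/
theorem evolve_pair_le (h : Admissible G θ) (x : V → Fin 2) {t : ℝ} (ht : 0 ≤ t) (p : V × V) :
    evolve (pairGenerator G θ) t (offDiag (fun u v => spin (x u) * spin (x v))) p
      ≤ offDiag (fun u v => meanSpin G θ x t u * meanSpin G θ x t v) p := by
  refine (isMetzler_pairGenerator h).le_of_deriv
    (Y := fun t => offDiag (fun u v => meanSpin G θ x t u * meanSpin G θ x t v))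
    (Y' := fun t => offDiag (fun u v =>
      ((1 - θ) * nbrAvg G (meanSpin G θ x t) u - meanSpin G θ x t u) * meanSpin G θ x t v
      + meanSpin G θ x t u * ((1 - θ) * nbrAvg G (meanSpin G θ x t) v - meanSpin G θ x t v)))
    (fun t p => hasDerivAt_evolve' _ t _ p) ?_ (fun t _ p => le_rfl) ?_ ?_ ht p
  · rintro t ⟨u, v⟩
    by_cases huv : u = v
    · simp only [offDiag, huv, if_true]; exact hasDerivAt_const _ _
    · simp only [offDiag, huv, if_false]
      exact (hasDerivAt_meanSpin h x t u).mul (hasDerivAt_meanSpin h x t v)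
  · rintro t - ⟨u, v⟩
    set z := meanSpin G θ x t
    rw [act_pairGenerator_offDiag]
    by_cases huv : u = v
    · simp [offDiag, huv]
    · simp only [offDiag, huv, if_false]
      have hle : ∀ a b, (if a = b then 0 else z a * z b) ≤ z a * z b := by
        intro a b; split_ifs with hab
        · subst hab; exact mul_self_nonneg _
        · exact le_rfl
      have m : ∀ (f g : V → ℝ) (w : V), (∀ k, f k ≤ g k) → nbrAvg G f w ≤ nbrAvg G g w := by
        intro f g w hfg
        unfold nbrAvg
        exact div_le_div_of_nonneg_right (Finset.sum_le_sum fun k _ => hfg k) (Nat.cast_nonneg _)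
      have h1 := m _ _ u (fun w => hle w v)
      have h2 := m _ _ v (fun w => hle u w)
      have e1 : nbrAvg G (fun w => z w * z v) u = nbrAvg G z u * z v := by
        unfold nbrAvg; rw [← Finset.sum_mul]; ring
      have e2 : nbrAvg G (fun w => z u * z w) v = z u * nbrAvg G z v := by
        unfold nbrAvg; rw [← Finset.mul_sum]; ring
      rw [e1] at h1
      rw [e2] at h2
      have := mul_le_mul_of_nonneg_left (add_le_add h1 h2) (sub_nonneg.2 h.le_one)
      linarith
  · intro p
    simp only [evolve_zero, meanSpin_zero, le_refl]

/-- Minimum principle: a minimum c at an off-diagonal pair satisfies 2c ≥ 2(1-θ)c, hence c ≥ 0; on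
the diagonal the value is 1. -/
theorem pairStat_nonneg (h : Admissible G θ) (u v : V) : 0 ≤ pairStat G θ u v := by
  have hmin : ∀ p : V × V, 0 ≤ pairStat G θ p.1 p.2 := by
    have : Nonempty V := h.connected.nonempty
    obtain ⟨p, -, hp⟩ := Finset.exists_min_image Finset.univ
      (fun p : V × V => pairStat G θ p.1 p.2) Finset.univ_nonempty
    have h0 : 0 ≤ pairStat G θ p.1 p.2 := by
      by_cases hpp : p.1 = p.2
      · rw [hpp, pairStat_self h]; norm_num
      · set c := pairStat G θ p.1 p.2
        have hs := pairStat_eq h hpp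
        have m : ∀ (f : V → ℝ) (w : V), (∀ k, c ≤ f k) → c ≤ nbrAvg G f w := by
          intro f w hf
          have := nbrAvg_le_of_le h (g := fun k => -f k) (c := -c) (u := w)
            (fun k _ => neg_le_neg (hf k))
          have e : nbrAvg G (fun k => -f k) w = -nbrAvg G f w := by simp [nbrAvg, neg_div]
          linarith
        have h1 := m (fun w => pairStat G θ w p.2) p.1 fun k => hp (k, p.2) (Finset.mem_univ _)
        have h2 := m (fun w => pairStat G θ p.1 w) p.2 fun k => hp (p.1, k) (Finset.mem_univ _)
        have h3 := mul_le_mul_of_nonneg_left (add_le_add h1 h2) (sub_nonneg.2 h.le_one)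
        have := h.pos
        nlinarith
    exact fun q => h0.trans (hp q (Finset.mem_univ q))
  exact hmin (u, v)

/-- Follow a geodesic from `u` to `v`: in the stationary two-point equation keep only the first
neighbour on it. Each step costs the factor (1-θ)/(2Δ) until the walks meet. -/
theorem le_pairStat (h : Admissible G θ) {Δ : ℝ} (hΔ : ∀ u, (G.degree u : ℝ) ≤ Δ) (u v : V) :
    ((1 - θ) / (2 * Δ)) ^ G.dist u v ≤ pairStat G θ u v := by
  have hΔ1 : 1 ≤ Δ := (h.one_le_degree u).trans (hΔ u)
  have hθ := sub_nonneg.2 h.le_one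
  induction hn : G.dist u v generalizing u with
  | zero =>
    have : u = v := ((h.connected u v).dist_eq_zero_iff).1 hn
    subst this
    simp [pairStat_self h]
  | succ k ih =>
    have huv : u ≠ v := by rintro rfl; simp at hn
    obtain ⟨w, hw, hwd⟩ : ∃ w, G.Adj u w ∧ G.dist w v = k := by
      obtain ⟨p, hp⟩ := (h.connected u v).exists_walk_length_eq_dist
      cases p with
      | nil => exact (huv rfl).elim
      | @cons _ w _ hadj q =>
        refine ⟨w, hadj, ?_⟩
        rw [SimpleGraph.Walk.length_cons] at hp
        have h1 := SimpleGraph.dist_le q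
        have h2 := h.connected.dist_triangle (u := u) (v := w) (w := v)
        rw [SimpleGraph.dist_eq_one_iff_adj.2 hadj] at h2
        omega
    have hs := pairStat_eq h huv
    have h1 : pairStat G θ w v / Δ ≤ nbrAvg G (fun w => pairStat G θ w v) u := by
      unfold nbrAvg
      have hmem : w ∈ G.neighborFinset u := (G.mem_neighborFinset u w).2 hw
      have := Finset.single_le_sum (f := fun w => pairStat G θ w v)
        (fun w _ => pairStat_nonneg h w v) hmem
      calc pairStat G θ w v / Δ ≤ pairStat G θ w v / G.degree u :=
            div_le_div_of_nonneg_left (pairStat_nonneg h w v) (h.degree_pos u) (hΔ u)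
        _ ≤ _ := div_le_div_of_nonneg_right this (h.degree_pos u).le
    have h2 : 0 ≤ nbrAvg G (fun w => pairStat G θ u w) v :=
      div_nonneg (Finset.sum_nonneg fun w _ => pairStat_nonneg h u w) (Nat.cast_nonneg _)
    have h3 : (1 - θ) / (2 * Δ) * pairStat G θ w v ≤ pairStat G θ u v := by
      have := mul_le_mul_of_nonneg_left h1 hθ
      have h4 := mul_nonneg hθ h2
      have e : (1 - θ) / (2 * Δ) * pairStat G θ w v
          = (1 - θ) * (pairStat G θ w v / Δ) / 2 := by field_simp
      rw [e]; linarith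
    refine le_trans ?_ h3
    rw [pow_succ']
    exact mul_le_mul_of_nonneg_left (ih w hwd) (by positivity)

end Quadratic

/-! ### The quadratic lower bound -/

section QuadraticTest

variable {V : Type*} [Fintype V] [DecidableEq V] {G : SimpleGraph V} [DecidableRel G.Adj] {θ : ℝ}

/-- Indicator of pairs at distance at most `j`. -/
def near (G : SimpleGraph V) (j : ℕ) (u v : V) : ℝ := if G.dist u v ≤ j then 1 else 0

/-- Sum of the cardinalities of all balls of radius `j`. -/
def ballSum (G : SimpleGraph V) (j : ℕ) : ℝ := ∑ u, ∑ v, near G j u v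

theorem near_comm (j : ℕ) (u v : V) : near G j u v = near G j v u := by
  unfold near; rw [G.dist_comm]

theorem near_nonneg (j : ℕ) (u v : V) : 0 ≤ near G j u v := by
  unfold near; split_ifs <;> norm_num

theorem near_self (j : ℕ) (u : V) : near G j u u = 1 := by simp [near]

theorem offDiag_near_nonneg (j : ℕ) (p : V × V) : 0 ≤ offDiag (near G j) p := by
  unfold offDiag
  split_ifs
  · exact le_rfl
  · exact near_nonneg _ _ _

theorem offDiag_near_le (j : ℕ) (u v : V) : offDiag (near G j) (u, v) ≤ near G j u v := by
  simp only [offDiag]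
  split_ifs
  · exact near_nonneg _ _ _
  · exact le_rfl

theorem offDiag_near_comm (j : ℕ) (u v : V) :
    offDiag (near G j) (u, v) = offDiag (near G j) (v, u) := by
  simp only [offDiag, near_comm j u v, eq_comm]

theorem offDiag_near_sq (j : ℕ) (p : V × V) :
    offDiag (near G j) p * offDiag (near G j) p = offDiag (near G j) p := by
  simp only [offDiag, near]
  split_ifs <;> norm_num

/-- Boundary edges of the punctured ball around `v` are counted by their outer endpoint, which is
either `v` itself or a vertex at distance exactly j+1; each endpoint has at most Δ edges. -/
theorem ball_boundary_le (h : Admissible G θ) {Δ : ℝ} (hΔ : ∀ u, (G.degree u : ℝ) ≤ Δ) (j : ℕ)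
    (v : V) :
    ∑ u, ∑ w ∈ G.neighborFinset u, offDiag (near G j) (u, v) * (1 - offDiag (near G j) (w, v))
      ≤ Δ * (1 + ∑ w, (near G (j + 1) v w - near G j v w)) := by
  rw [sum_sum_neighbor_symm
    (fun u w => offDiag (near G j) (u, v) * (1 - offDiag (near G j) (w, v)))]
  have hmono : ∀ w, 0 ≤ near G (j + 1) v w - near G j v w := by
    intro w
    unfold near
    split_ifs with h1 h2
    all_goals first | (exfalso; omega) | norm_num
  have hb : ∀ w u, u ∈ G.neighborFinset w →
      offDiag (near G j) (u, v) * (1 - offDiag (near G j) (w, v))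
        ≤ (if w = v then 1 else 0) + (near G (j + 1) v w - near G j v w) := by
    intro w u hu
    have hadj : G.Adj w u := (G.mem_neighborFinset w u).1 hu
    have ht := h.connected.dist_triangle (u := w) (v := u) (w := v)
    rw [SimpleGraph.dist_eq_one_iff_adj.2 hadj] at ht
    have hm := hmono w
    by_cases hw : w = v
    · subst hw
      simp only [if_true]
      have : offDiag (near G j) (u, w) ≤ 1 := by
        simp only [offDiag, near]; split_ifs <;> norm_num
      have h0 : offDiag (near G j) (w, w) = 0 := by simp [offDiag]
      rw [h0]; linarith
    · simp only [hw, if_false, zero_add]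
      rw [near_comm _ v w, near_comm _ v w] at *
      simp only [offDiag, near, hw, if_false]
      split_ifs with h1 h2 h3 h4 <;> first | (exfalso; omega) | norm_num
  calc _ ≤ ∑ w, ∑ u ∈ G.neighborFinset w,
        ((if w = v then 1 else 0) + (near G (j + 1) v w - near G j v w)) :=
        Finset.sum_le_sum fun w _ => Finset.sum_le_sum fun u hu => hb w u hu
    _ ≤ ∑ w, Δ * ((if w = v then 1 else 0) + (near G (j + 1) v w - near G j v w)) := by
        refine Finset.sum_le_sum fun w _ => ?_
        rw [Finset.sum_const, SimpleGraph.card_neighborFinset_eq_degree, nsmul_eq_mul]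
        refine mul_le_mul_of_nonneg_right (hΔ w) (add_nonneg ?_ (hmono w))
        split_ifs <;> norm_num
    _ = _ := by
        rw [← Finset.mul_sum, Finset.sum_add_distrib]
        simp

/-- For an indicator the Dirichlet form counts boundary edges. A pair whose jumps all stay in the
set contributes 2(1-θ) - 2 = -2θ; each of the two coordinates then loses at most Δ² times the total
boundary. -/
theorem rayleigh_near (h : Admissible G θ) {Δ : ℝ} (hΔ : ∀ u, (G.degree u : ℝ) ≤ Δ) (j : ℕ) :
    -(2 * θ) * ∑ p : V × V, (G.degree p.1 * G.degree p.2 : ℝ) * offDiag (near G j) p ^ 2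
        - 2 * (Δ ^ 2 * (Fintype.card V + (ballSum G (j + 1) - ballSum G j)))
      ≤ ∑ p : V × V, (G.degree p.1 * G.degree p.2 : ℝ) *
        (offDiag (near G j) p * act (pairGenerator G θ) (offDiag (near G j)) p) := by
  set ψ := offDiag (near G j)
  have hθ := sub_nonneg.2 h.le_one
  have : Nonempty V := h.connected.nonempty
  obtain ⟨v₀⟩ := this
  have hΔ0 : 0 ≤ Δ := (Nat.cast_nonneg _).trans (hΔ v₀)
  set C₁ : V × V → ℝ := fun p => ∑ w ∈ G.neighborFinset p.1, ψ p * (1 - ψ (w, p.2))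
  set C₂ : V × V → ℝ := fun p => ∑ w ∈ G.neighborFinset p.2, ψ p * (1 - ψ (p.1, w))
  have hp : ∀ p : V × V, (G.degree p.1 * G.degree p.2 : ℝ) * (ψ p * act (pairGenerator G θ) ψ p)
      = -(2 * θ) * ((G.degree p.1 * G.degree p.2 : ℝ) * ψ p ^ 2)
        - (1 - θ) * (G.degree p.2 * C₁ p + G.degree p.1 * C₂ p) := by
    rintro ⟨u, v⟩
    by_cases huv : u = v
    · have h0 : ψ (u, v) = 0 := by simp [ψ, offDiag, huv]
      simp [C₁, C₂, h0]
    · have hact := act_pairGenerator_offDiag (G := G) (θ := θ) (near G j) (u, v)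
      simp only [huv, if_false] at hact
      have hn : near G j u v = ψ (u, v) := by simp [ψ, offDiag, huv]
      rw [hn] at hact
      have e1 : (G.degree u : ℝ) * (ψ (u, v) * nbrAvg G (fun w => ψ (w, v)) u)
          = G.degree u * ψ (u, v) ^ 2 - C₁ (u, v) := by
        have hs : ψ (u, v) ^ 2 = ψ (u, v) := by rw [sq]; exact offDiag_near_sq j _
        rw [hs]
        simp only [C₁, mul_sub, mul_one, Finset.sum_sub_distrib, Finset.sum_const,
          SimpleGraph.card_neighborFinset_eq_degree, nsmul_eq_mul, ← Finset.mul_sum, nbrAvg]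
        have := (h.degree_pos u).ne'
        field_simp
        ring
      have e2 : (G.degree v : ℝ) * (ψ (u, v) * nbrAvg G (fun w => ψ (u, w)) v)
          = G.degree v * ψ (u, v) ^ 2 - C₂ (u, v) := by
        have hs : ψ (u, v) ^ 2 = ψ (u, v) := by rw [sq]; exact offDiag_near_sq j _
        rw [hs]
        simp only [C₂, mul_sub, mul_one, Finset.sum_sub_distrib, Finset.sum_const,
          SimpleGraph.card_neighborFinset_eq_degree, nsmul_eq_mul, ← Finset.mul_sum, nbrAvg]
        have := (h.degree_pos v).ne'
        field_simp
        ring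
      simp only
      rw [hact]
      linear_combination (1 - θ) * G.degree v * e1 + (1 - θ) * G.degree u * e2
  have hC1 : ∑ p, (G.degree p.2 : ℝ) * C₁ p
      ≤ Δ ^ 2 * (Fintype.card V + (ballSum G (j + 1) - ballSum G j)) := by
    rw [Fintype.sum_prod_type_right]
    calc _ = ∑ v, (G.degree v : ℝ) * ∑ u, C₁ (u, v) :=
          Finset.sum_congr rfl fun v _ => (Finset.mul_sum _ _ _).symm
      _ ≤ ∑ v, Δ * (Δ * (1 + ∑ w, (near G (j + 1) v w - near G j v w))) := by
          refine Finset.sum_le_sum fun v _ => mul_le_mul (hΔ v) (ball_boundary_le h hΔ j v) ?_ hΔ0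
          refine Finset.sum_nonneg fun u _ => Finset.sum_nonneg fun w _ =>
            mul_nonneg (offDiag_near_nonneg _ _) ?_
          have : ψ (w, v) ≤ 1 := by
            simp only [ψ, offDiag, near]; split_ifs <;> norm_num
          linarith
      _ = _ := by
          simp only [← Finset.mul_sum, Finset.sum_add_distrib, Finset.sum_sub_distrib, ballSum]
          rw [Finset.sum_const, nsmul_eq_mul, Finset.card_univ]
          ring
  have hC2 : ∑ p, (G.degree p.1 : ℝ) * C₂ p = ∑ p, (G.degree p.2 : ℝ) * C₁ p := by
    rw [Fintype.sum_prod_type, Fintype.sum_prod_type_right]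
    refine Finset.sum_congr rfl fun u _ => Finset.sum_congr rfl fun v _ => ?_
    simp only [C₁, C₂]
    congr 1
    refine Finset.sum_congr rfl fun w _ => ?_
    simp only [ψ, offDiag_near_comm j u v, offDiag_near_comm j u w]
  rw [Finset.sum_congr rfl fun p _ => hp p, Finset.sum_sub_distrib, ← Finset.mul_sum,
    ← Finset.mul_sum, Finset.sum_add_distrib, hC2]
  have hC0 : 0 ≤ ∑ p, (G.degree p.2 : ℝ) * C₁ p := by
    refine Finset.sum_nonneg fun p _ => mul_nonneg (Nat.cast_nonneg _)
      (Finset.sum_nonneg fun w _ => mul_nonneg (offDiag_near_nonneg _ _) ?_)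
    have : ψ (w, p.2) ≤ 1 := by
      simp only [ψ, offDiag, near]; split_ifs <;> norm_num
    linarith
  have := h.pos
  nlinarith

/-- A vertex is the first, or the second, coordinate of at most D near pairs. -/
theorem sum_offDiag_near_mul_le {j : ℕ} {D : ℝ} (hD : ∀ u, ∑ v, near G j u v ≤ D) {f : V → ℝ}
    (hf : ∀ v, 0 ≤ f v) :
    ∑ p : V × V, offDiag (near G j) p * (f p.1 + f p.2) ≤ 2 * D * ∑ v, f v := by
  have h1 : ∑ p : V × V, offDiag (near G j) p * f p.1 ≤ D * ∑ v, f v := by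
    rw [Fintype.sum_prod_type, Finset.mul_sum]
    refine Finset.sum_le_sum fun u _ => ?_
    simp only
    rw [← Finset.sum_mul]
    refine mul_le_mul_of_nonneg_right (le_trans ?_ (hD u)) (hf u)
    exact Finset.sum_le_sum fun v _ => offDiag_near_le j u v
  have h2 : ∑ p : V × V, offDiag (near G j) p * f p.2 ≤ D * ∑ v, f v := by
    refine le_trans (le_of_eq ?_) h1
    rw [Fintype.sum_prod_type, Fintype.sum_prod_type_right]
    refine Finset.sum_congr rfl fun u _ => Finset.sum_congr rfl fun v _ => ?_
    simp only [offDiag_near_comm j u v]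
  simp only [mul_add, Finset.sum_add_distrib]
  linarith

/-- The covariance of two pair products is at most four `overlap` terms. Summing over near pairs on
either side costs 2D each, and the remaining double sum of `overlap` is at most n · 2B²/θ²; with Δ⁴
from the weights this gives the factor 8. -/
theorem Decoupled.variance_quadratic_le {ν : (V → Fin 2) → ℝ} (hν : Decoupled G θ ν)
    (h : Admissible G θ) {B Δ D : ℝ} (hB : ∀ w, ∑ u, (1 + θ)⁻¹ ^ G.dist w u ≤ B)
    (hΔ : ∀ u, (G.degree u : ℝ) ≤ Δ) {j : ℕ} (hD : ∀ u, ∑ v, near G j u v ≤ D) :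
    ∑ x, ν x * (∑ p : V × V, (G.degree p.1 * G.degree p.2 * offDiag (near G j) p : ℝ)
        * (spin (x p.1) * spin (x p.2))
      - ∑ p : V × V, (G.degree p.1 * G.degree p.2 * offDiag (near G j) p : ℝ)
        * ∑ x, ν x * (spin (x p.1) * spin (x p.2))) ^ 2
      ≤ 8 * Δ ^ 4 * D ^ 2 * (Fintype.card V) * (B ^ 2 / θ ^ 2) := by
  have : Nonempty V := h.connected.nonempty
  obtain ⟨v₀⟩ := this
  have hΔ0 : 0 ≤ Δ := (Nat.cast_nonneg _).trans (hΔ v₀)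
  have hD0 : 0 ≤ D := (Finset.sum_nonneg fun v _ => near_nonneg _ _ _).trans (hD v₀)
  set ψ := offDiag (near G j)
  have hψ0 : ∀ p, 0 ≤ ψ p := offDiag_near_nonneg j
  refine (hν.variance_le (A := fun p : V × V => {p.1, p.2})
    (f := fun p x => spin (x p.1) * spin (x p.2)) ?_ ?_ _).trans ?_
  · intro p x y hxy
    have h1 : x p.1 = y p.1 := hxy p.1 (by simp)
    have h2 : x p.2 = y p.2 := hxy p.2 (by simp)
    simp only [h1, h2]
  · intro p x
    rw [abs_mul, abs_spin, abs_spin, one_mul]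
  have hpair : ∀ (u v : V) (f : V → ℝ), (∀ k, 0 ≤ f k) →
      ∑ a ∈ ({u, v} : Finset V), f a ≤ f u + f v := by
    intro u v f hf
    by_cases huv : u = v
    · subst huv; simp [hf u]
    · rw [Finset.sum_pair huv]
  have hc : ∀ p : V × V, |(G.degree p.1 * G.degree p.2 * ψ p : ℝ)| ≤ Δ ^ 2 * ψ p := by
    intro p
    rw [abs_of_nonneg (mul_nonneg (by positivity) (hψ0 p)), sq]
    exact mul_le_mul_of_nonneg_right (mul_le_mul (hΔ _) (hΔ _) (Nat.cast_nonneg _) hΔ0) (hψ0 p)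
  have hov := fun a b => overlap_nonneg h a b
  calc _ ≤ ∑ p : V × V, ∑ q : V × V, (Δ ^ 2 * ψ p) * (Δ ^ 2 * ψ q) *
        ((overlap G θ p.1 q.1 + overlap G θ p.1 q.2)
          + (overlap G θ p.2 q.1 + overlap G θ p.2 q.2)) := by
        refine Finset.sum_le_sum fun p _ => Finset.sum_le_sum fun q _ => ?_
        refine mul_le_mul (mul_le_mul (hc p) (hc q) (abs_nonneg _)
          (mul_nonneg (by positivity) (hψ0 p))) ?_ ?_ ?_
        · refine (hpair _ _ _ fun a => Finset.sum_nonneg fun b _ => hov a b).trans ?_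
          exact add_le_add (hpair _ _ _ fun b => hov _ b) (hpair _ _ _ fun b => hov _ b)
        · exact Finset.sum_nonneg fun a _ => Finset.sum_nonneg fun b _ => hov a b
        · exact mul_nonneg (mul_nonneg (by positivity) (hψ0 p))
            (mul_nonneg (by positivity) (hψ0 q))
    _ = Δ ^ 4 * ∑ q : V × V, ψ q * (∑ p : V × V, ψ p *
        ((overlap G θ p.1 q.1 + overlap G θ p.1 q.2)
          + (overlap G θ p.2 q.1 + overlap G θ p.2 q.2))) := by
        rw [Finset.sum_comm, Finset.mul_sum]
        refine Finset.sum_congr rfl fun q _ => ?_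
        rw [Finset.mul_sum, Finset.mul_sum]
        exact Finset.sum_congr rfl fun p _ => by ring
    _ ≤ Δ ^ 4 * ∑ q : V × V, ψ q * (2 * D * ∑ a, (overlap G θ a q.1 + overlap G θ a q.2)) := by
        refine mul_le_mul_of_nonneg_left (Finset.sum_le_sum fun q _ =>
          mul_le_mul_of_nonneg_left ?_ (hψ0 q)) (by positivity)
        exact sum_offDiag_near_mul_le hD (f := fun a => overlap G θ a q.1 + overlap G θ a q.2)
          (fun a => add_nonneg (hov _ _) (hov _ _))
    _ = Δ ^ 4 * (2 * D) * ∑ q : V × V, ψ q * (∑ a, overlap G θ a q.1 + ∑ a, overlap G θ a q.2) := by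
        rw [mul_assoc, Finset.mul_sum (a := 2 * D)]
        congr 1
        refine Finset.sum_congr rfl fun q _ => ?_
        rw [Finset.sum_add_distrib]; ring
    _ ≤ Δ ^ 4 * (2 * D) * (2 * D * ∑ b, ∑ a, overlap G θ a b) := by
        refine mul_le_mul_of_nonneg_left ?_ (by positivity)
        exact sum_offDiag_near_mul_le hD (f := fun b => ∑ a, overlap G θ a b)
          (fun b => Finset.sum_nonneg fun a _ => hov a b)
    _ ≤ Δ ^ 4 * (2 * D) * (2 * D * ∑ b : V, (2 / θ ^ 2 * B ^ 2)) := by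
        refine mul_le_mul_of_nonneg_left (mul_le_mul_of_nonneg_left
          (Finset.sum_le_sum fun b _ => ?_) (by positivity)) (by positivity)
        simp only [overlap_comm _ b]
        exact sum_overlap_le h hB b
    _ = _ := by
        rw [Finset.sum_const, nsmul_eq_mul, Finset.card_univ]
        ring

theorem ballSum_sub_card_le (h : Admissible G θ) (j : ℕ) :
    ballSum G j - Fintype.card V
      ≤ ∑ p : V × V, (G.degree p.1 * G.degree p.2 : ℝ) * offDiag (near G j) p ^ 2 := by
  set ψ := offDiag (near G j)
  have e1 : ballSum G j - Fintype.card V = ∑ p : V × V, ψ p := by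
    have : ∀ u : V, ∑ v, near G j u v = 1 + ∑ v, ψ (u, v) := by
      intro u
      have : ∀ v, near G j u v = (if u = v then 1 else 0) + ψ (u, v) := by
        intro v
        by_cases huv : u = v
        · subst huv; simp [ψ, offDiag, near_self]
        · simp [ψ, offDiag, huv]
      simp [this, Finset.sum_add_distrib]
    rw [ballSum, Fintype.sum_prod_type, Finset.sum_congr rfl fun u _ => this u,
      Finset.sum_add_distrib]
    simp
  rw [e1]
  refine Finset.sum_le_sum fun p _ => ?_
  have hs : ψ p ^ 2 = ψ p := by rw [sq]; exact offDiag_near_sq j p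
  rw [hs]
  have : (1 : ℝ) ≤ G.degree p.1 * G.degree p.2 :=
    one_le_mul_of_one_le_of_one_le (h.one_le_degree _) (h.one_le_degree _)
  have h0 : 0 ≤ ψ p := offDiag_near_nonneg j p
  nlinarith

/-- Lower bound from the quadratic test function, when the mean is small. -/
theorem quadratic_lower_bound (h : Admissible G θ) {B Δ D : ℝ}
    (hB : ∀ w, ∑ u, (1 + θ)⁻¹ ^ G.dist w u ≤ B) (hΔ : ∀ u, (G.degree u : ℝ) ≤ Δ) {j : ℕ}
    (hD : ∀ u, ∑ v, near G j u v ≤ D) {lam m E : ℝ}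
    (hlam : -lam * ∑ p : V × V, (G.degree p.1 * G.degree p.2 : ℝ) * offDiag (near G j) p ^ 2
      ≤ ∑ p : V × V, (G.degree p.1 * G.degree p.2 : ℝ) *
        (offDiag (near G j) p * act (pairGenerator G θ) (offDiag (near G j)) p))
    (hn : (Fintype.card V : ℝ) ≤ ballSum G j - Fintype.card V)
    (hm0 : 0 ≤ m) (hm : ∀ u v, G.dist u v ≤ j → m ≤ pairStat G θ u v)
    {t : ℝ} (ht : 0 ≤ t) (x : V → Fin 2) (hE0 : 0 < E) (hE : E ≤ m * Real.exp (-lam * t))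
    (hz : Δ ^ 2 * D * ∑ v, meanSpin G θ x t v ^ 2 ≤ Fintype.card V * E / 2) :
    1 - 256 * Δ ^ 4 * D ^ 2 * (B ^ 2 / θ ^ 2) / (Fintype.card V * E ^ 2)
      ≤ tvDist (law (noisyVoterGenerator G 2 θ) x t) (noisyVoterStationary G 2 θ) := by
  have : Nonempty V := h.connected.nonempty
  obtain ⟨v₀⟩ := this
  have hcard : (0 : ℝ) < Fintype.card V := by
    exact_mod_cast Fintype.card_pos_iff.2 ⟨v₀⟩
  have hΔ0 : 0 ≤ Δ := (Nat.cast_nonneg _).trans (hΔ v₀)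
  set ψ := offDiag (near G j)
  have hψ0 : ∀ p, 0 ≤ ψ p := offDiag_near_nonneg j
  set π : V × V → ℝ := fun p => G.degree p.1 * G.degree p.2
  have hπ : ∀ p, 0 < π p := fun p => mul_pos (h.degree_pos _) (h.degree_pos _)
  set z := meanSpin G θ x t
  set N := ∑ p, π p * ψ p ^ 2
  have hN : (Fintype.card V : ℝ) ≤ N := hn.trans (ballSum_sub_card_le h j)
  have hray := rayleigh_lower_bound hπ (pairGenerator_reversible h) hlam ht
  have hM := isMetzler_pairGenerator h
  -- Equilibrium correlations are at least m on near pairs and nonnegative elsewhere, and the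
  -- stopped pair semigroup preserves order.
  have hstat : ∀ p, m * evolve (pairGenerator G θ) t ψ p
      ≤ evolve (pairGenerator G θ) t (offDiag (pairStat G θ)) p := by
    intro p
    unfold evolve
    rw [Finset.mul_sum]
    refine Finset.sum_le_sum fun q _ => ?_
    have hl := hM.law_nonneg ht p q
    have : m * ψ q ≤ offDiag (pairStat G θ) q := by
      simp only [ψ, offDiag, near]
      split_ifs with h1 h2
      · simp
      · rw [mul_one]; exact hm _ _ h2
      · rw [mul_zero]; exact pairStat_nonneg h _ _
    calc m * (law (pairGenerator G θ) p t q * ψ q)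
        = law (pairGenerator G θ) p t q * (m * ψ q) := by ring
      _ ≤ _ := mul_le_mul_of_nonneg_left this hl
  -- Deviation = evolution of x_u x_v minus evolution of the equilibrium correlations. The former is
  -- dominated by the product of means, the latter bounded below by `hstat`.
  have hD' : ∀ p, ψ p * (pairMean G θ x t p.1 p.2 - pairStat G θ p.1 p.2)
      ≤ ψ p * (|z p.1| * |z p.2|) - m * (ψ p * evolve (pairGenerator G θ) t ψ p) := by
    intro p
    by_cases hp : p.1 = p.2
    · have h0 : ψ p = 0 := by simp [ψ, offDiag, hp]
      simp [h0]
    · have e1 := congrFun (pairMean_sub_pairStat h x t) p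
      have e2 : offDiag (fun u v => pairMean G θ x t u v - pairStat G θ u v) p
          = pairMean G θ x t p.1 p.2 - pairStat G θ p.1 p.2 := by simp [offDiag, hp]
      have e3 : offDiag (fun u v => spin (x u) * spin (x v) - pairStat G θ u v)
          = fun q => offDiag (fun u v => spin (x u) * spin (x v)) q
            - offDiag (pairStat G θ) q := by
        funext q; simp only [offDiag]; split_ifs <;> simp
      have e4 : evolve (pairGenerator G θ) t
          (offDiag (fun u v => spin (x u) * spin (x v) - pairStat G θ u v)) p
          = evolve (pairGenerator G θ) t (offDiag (fun u v => spin (x u) * spin (x v))) p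
            - evolve (pairGenerator G θ) t (offDiag (pairStat G θ)) p := by
        rw [e3]; simp [evolve, mul_sub, Finset.sum_sub_distrib]
      have e5 := evolve_pair_le h x ht p
      have e6 : offDiag (fun u v => z u * z v) p ≤ |z p.1| * |z p.2| := by
        simp only [offDiag, hp, if_false]
        rw [← abs_mul]; exact le_abs_self _
      have e7 : pairMean G θ x t p.1 p.2 - pairStat G θ p.1 p.2
          ≤ |z p.1| * |z p.2| - m * evolve (pairGenerator G θ) t ψ p := by
        rw [← e2, e1, e4]
        linarith [hstat p]
      have := mul_le_mul_of_nonneg_left e7 (hψ0 p)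
      linarith
  have hfree : ∑ p, π p * (ψ p * (|z p.1| * |z p.2|)) ≤ Δ ^ 2 * D * ∑ v, z v ^ 2 := by
    have hb : ∀ p, π p * (ψ p * (|z p.1| * |z p.2|))
        ≤ Δ ^ 2 / 2 * (ψ p * (z p.1 ^ 2 + z p.2 ^ 2)) := by
      intro p
      have h1 : |z p.1| * |z p.2| ≤ (z p.1 ^ 2 + z p.2 ^ 2) / 2 := by
        have := two_mul_le_add_sq |z p.1| |z p.2|
        rw [sq_abs, sq_abs] at this
        linarith
      have h2 : π p ≤ Δ ^ 2 := by
        rw [sq]; exact mul_le_mul (hΔ _) (hΔ _) (Nat.cast_nonneg _) hΔ0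
      calc _ ≤ Δ ^ 2 * (ψ p * ((z p.1 ^ 2 + z p.2 ^ 2) / 2)) :=
            mul_le_mul h2 (mul_le_mul_of_nonneg_left h1 (hψ0 p))
              (mul_nonneg (hψ0 p) (by positivity)) (by positivity)
        _ = _ := by ring
    refine (Finset.sum_le_sum fun p _ => hb p).trans ?_
    rw [← Finset.mul_sum]
    have := mul_le_mul_of_nonneg_left (sum_offDiag_near_mul_le hD (f := fun v => z v ^ 2)
      (fun v => sq_nonneg _)) (by positivity : 0 ≤ Δ ^ 2 / 2)
    refine this.trans (le_of_eq (by ring))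
  -- The equilibrium part pushes the expectation down by at least nE through the Rayleigh bound; by
  -- `hz` the means restore at most half of it.
  have hgap : ∑ p, (π p * ψ p) * ∑ y, law (noisyVoterGenerator G 2 θ) x t y
        * (spin (y p.1) * spin (y p.2))
      - ∑ p, (π p * ψ p) * ∑ y, noisyVoterStationary G 2 θ y * (spin (y p.1) * spin (y p.2))
      ≤ -(Fintype.card V * E / 2) := by
    rw [← Finset.sum_sub_distrib]
    have e1 : ∀ p, π p * ψ p * ∑ y, law (noisyVoterGenerator G 2 θ) x t y
        * (spin (y p.1) * spin (y p.2)) - π p * ψ p *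
          ∑ y, noisyVoterStationary G 2 θ y * (spin (y p.1) * spin (y p.2))
        ≤ π p * (ψ p * (|z p.1| * |z p.2|))
          - m * (π p * (ψ p * evolve (pairGenerator G θ) t ψ p)) := by
      intro p
      have := mul_le_mul_of_nonneg_left (hD' p) (hπ p).le
      change π p * ψ p * pairMean G θ x t p.1 p.2 - π p * ψ p * pairStat G θ p.1 p.2 ≤ _
      linarith
    refine (Finset.sum_le_sum fun p _ => e1 p).trans ?_
    rw [Finset.sum_sub_distrib, ← Finset.mul_sum]
    have h1 : Fintype.card V * E ≤ m * ∑ p, π p * (ψ p * evolve (pairGenerator G θ) t ψ p) := by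
      calc Fintype.card V * E ≤ N * (m * Real.exp (-lam * t)) :=
            mul_le_mul hN hE hE0.le (hcard.le.trans hN)
        _ = m * (Real.exp (-lam * t) * N) := by ring
        _ ≤ _ := mul_le_mul_of_nonneg_left hray hm0
    linarith [hfree.trans hz]
  have hg : 0 < Fintype.card V * E / 2 := by positivity
  have v1 := (h.decoupled_law ht x).variance_quadratic_le h hB hΔ hD
  have v2 := h.decoupled_stationary.variance_quadratic_le h hB hΔ hD
  have key := one_sub_le_tvDist (h.isRate.law_nonneg ht x) h.isStationary.nonneg
    (h.isRate.sum_law t x) h.isStationary.sum_eq_one _ hg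
    (by
      have := neg_le_abs (∑ p, (π p * ψ p) * ∑ y, law (noisyVoterGenerator G 2 θ) x t y
        * (spin (y p.1) * spin (y p.2))
        - ∑ p, (π p * ψ p) * ∑ y, noisyVoterStationary G 2 θ y * (spin (y p.1) * spin (y p.2)))
      refine le_trans ?_ this
      linarith) v1 v2
  refine le_trans (le_of_eq ?_) key
  have hθ := h.pos
  field_simp
  ring

end QuadraticTest

/-! ### Lower bound for the mixing time from an arbitrary state -/

section LowerBound

variable {V : Type*} [Fintype V] [DecidableEq V] {G : SimpleGraph V} [DecidableRel G.Adj] {θ : ℝ}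

theorem sum_near_eq_card (j : ℕ) (v : V) :
    ∑ w, near G j v w = ((Finset.univ.filter fun w => G.dist v w ≤ j).card : ℝ) := by
  unfold near
  rw [Finset.sum_boole]

theorem sum_near_le {α c₀ : ℝ} (hg : SubexpGrowth G c₀ α) {j : ℕ} (hj : 1 ≤ j) (v : V) :
    ∑ w, near G j v w ≤ c₀ * Real.exp ((j : ℝ) ^ (1 - α)) := by
  rw [sum_near_eq_card]
  exact hg.card_le hj fun w hw => (Finset.mem_filter.1 hw).2

theorem exists_dist_eq (h : G.Connected) (v : V) {k : ℕ} {w : V} (hw : k ≤ G.dist v w) :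
    ∃ w', G.dist v w' = k := by
  induction hn : G.dist v w generalizing w with
  | zero => exact ⟨w, by omega⟩
  | succ d ih =>
    rcases eq_or_lt_of_le hw with he | hlt
    · exact ⟨w, he.symm⟩
    · obtain ⟨p, hp⟩ := (h w v).exists_walk_length_eq_dist
      cases p with
      | nil => simp at hn
      | @cons _ w' _ hadj q =>
        rw [SimpleGraph.Walk.length_cons, G.dist_comm] at hp
        have h1 := SimpleGraph.dist_le q
        have h2 := h.dist_triangle (u := v) (v := w') (w := w)
        rw [SimpleGraph.dist_eq_one_iff_adj.2 hadj.symm] at h2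
        rw [G.dist_comm] at h1
        exact ih (w := w') (by omega) (by omega)

/-- A ball of radius `j` that does not exhaust a connected graph has more than `j` vertices. -/
theorem succ_le_sum_near (h : G.Connected) {j : ℕ} (v : V)
    (hj : ∑ w, near G j v w < Fintype.card V) : (j + 1 : ℝ) ≤ ∑ w, near G j v w := by
  rw [sum_near_eq_card] at hj ⊢
  have hlt : (Finset.univ.filter fun w => G.dist v w ≤ j).card < Fintype.card V := by
    exact_mod_cast hj
  obtain ⟨w, hw⟩ : ∃ w, j < G.dist v w := by
    by_contra hcon
    push Not at hcon
    rw [Finset.filter_true_of_mem fun w _ => hcon w, Finset.card_univ] at hlt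
    exact lt_irrefl _ hlt
  have hex : ∀ k : Fin (j + 1), ∃ w', G.dist v w' = k := fun k =>
    exists_dist_eq h v (w := w) (by omega)
  choose f hf using hex
  have hinj : Function.Injective f := fun a b hab => by
    have := hf a
    rw [hab, hf b] at this
    exact Fin.ext this.symm
  have : (Finset.univ.image f).card ≤ (Finset.univ.filter fun w => G.dist v w ≤ j).card := by
    refine Finset.card_le_card fun w' hw' => ?_
    obtain ⟨k, -, rfl⟩ := Finset.mem_image.1 hw'
    simp only [Finset.mem_filter, Finset.mem_univ, true_and, hf]
    omega
  rw [Finset.card_image_of_injective _ hinj, Finset.card_univ, Fintype.card_fin] at this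
  exact_mod_cast this

/-- Subexponential growth yields a radius at which the balls grow slowly on average. -/
theorem exists_slow_radius {α c₀ : ℝ} [Nonempty V] (hα0 : 0 < α) (hα : α < 1) (hc : 0 < c₀)
    (hg : SubexpGrowth G c₀ α)
    {J : ℕ} (hJ : 1 ≤ J) (hη : 2 * (3 + |Real.log c₀|) * (J : ℝ) ^ (-α) ≤ 1) :
    ∃ j, J ≤ j ∧ j ≤ 2 * J ∧ ballSum G (j + 1) - ballSum G j
      ≤ 2 * (3 + |Real.log c₀|) * (J : ℝ) ^ (-α) * ballSum G j := by
  set η := 2 * (3 + |Real.log c₀|) * (J : ℝ) ^ (-α) with hηdef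
  have hJ0 : (0 : ℝ) < J := by exact_mod_cast hJ
  have hJ1 : (1 : ℝ) ≤ J := by exact_mod_cast hJ
  have hη0 : 0 ≤ η := by positivity
  by_contra hcon
  push Not at hcon
  have hcard : (0 : ℝ) < Fintype.card V := by exact_mod_cast Fintype.card_pos
  have hge : ∀ j, (Fintype.card V : ℝ) ≤ ballSum G j := by
    intro j
    calc (Fintype.card V : ℝ) = ∑ v : V, (1 : ℝ) := by simp
      _ ≤ _ := Finset.sum_le_sum fun v _ => by
        have := Finset.single_le_sum (f := fun w => near G j v w)
          (fun w _ => near_nonneg j v w) (Finset.mem_univ v)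
        rwa [near_self] at this
  -- If every radius from J to 2J grew by a factor above 1 + η, the ball sum at 2J would exceed n
  -- e^{ηJ/2}. Here ηJ/2 = (3 + |log c₀|) J^{1-α}, more than the growth condition permits, since
  -- (2J)^{1-α} ≤ 2 J^{1-α}.
  have hiter : ∀ k, k ≤ J → (1 + η) ^ k * Fintype.card V ≤ ballSum G (J + k) := by
    intro k hk
    induction k with
    | zero => simpa using hge J
    | succ k ih =>
      have h1 := ih (by omega)
      have h2 := hcon (J + k) (by omega) (by omega)
      rw [pow_succ]
      calc (1 + η) ^ k * (1 + η) * Fintype.card V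
          = (1 + η) * ((1 + η) ^ k * Fintype.card V) := by ring
        _ ≤ (1 + η) * ballSum G (J + k) := by gcongr
        _ ≤ ballSum G (J + (k + 1)) := by rw [← add_assoc]; linarith
  have hupper : ballSum G (J + J)
      ≤ Fintype.card V * (c₀ * Real.exp (((J + J : ℕ) : ℝ) ^ (1 - α))) := by
    unfold ballSum
    refine (Finset.sum_le_sum fun v _ => sum_near_le hg (by omega) v).trans ?_
    rw [Finset.sum_const, nsmul_eq_mul, Finset.card_univ]
  have hlow : Real.exp (η / 2) ≤ 1 + η := by
    have h1 := Real.add_one_le_exp (-(η / 2))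
    rw [Real.exp_neg] at h1
    have h2 : 0 < Real.exp (η / 2) := Real.exp_pos _
    have h3 : (1 - η / 2) * Real.exp (η / 2) ≤ 1 := by
      have := mul_le_mul_of_nonneg_right h1 h2.le
      rw [inv_mul_cancel₀ h2.ne'] at this
      linarith
    have h4 : 1 ≤ (1 + η) * (1 - η / 2) := by nlinarith
    have h5 : 0 < 1 - η / 2 := by linarith
    by_contra hlt
    push Not at hlt
    nlinarith
  have h1 : Real.exp (η / 2) ^ J ≤ c₀ * Real.exp (((J + J : ℕ) : ℝ) ^ (1 - α)) := by
    have h2 := (hiter J le_rfl).trans hupper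
    have h3 : (1 + η) ^ J ≤ c₀ * Real.exp (((J + J : ℕ) : ℝ) ^ (1 - α)) := by
      have h4 : (1 + η) ^ J * Fintype.card V
          ≤ (c₀ * Real.exp (((J + J : ℕ) : ℝ) ^ (1 - α))) * Fintype.card V := by linarith
      exact le_of_mul_le_mul_right h4 hcard
    exact (pow_le_pow_left₀ (Real.exp_pos _).le hlow J).trans h3
  have h2 : ((J + J : ℕ) : ℝ) ^ (1 - α) ≤ 2 * (J : ℝ) ^ (1 - α) := by
    have : ((J + J : ℕ) : ℝ) = 2 * J := by push_cast; ring
    rw [this, Real.mul_rpow (by norm_num) hJ0.le]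
    gcongr
    calc (2 : ℝ) ^ (1 - α) ≤ 2 ^ (1 : ℝ) :=
          Real.rpow_le_rpow_of_exponent_le (by norm_num) (by linarith)
      _ = 2 := Real.rpow_one 2
  have h3 : (J : ℝ) * (η / 2) = (3 + |Real.log c₀|) * (J : ℝ) ^ (1 - α) := by
    rw [hηdef, sub_eq_add_neg, Real.rpow_add hJ0, Real.rpow_one]; ring
  have h4 : (1 : ℝ) ≤ (J : ℝ) ^ (1 - α) := Real.one_le_rpow hJ1 (by linarith)
  rw [← Real.exp_nat_mul, h3] at h1
  have h5 : c₀ * Real.exp (((J + J : ℕ) : ℝ) ^ (1 - α))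
      ≤ Real.exp (|Real.log c₀| + 2 * (J : ℝ) ^ (1 - α)) := by
    rw [Real.exp_add]
    refine mul_le_mul ?_ (Real.exp_le_exp.2 h2) (Real.exp_pos _).le (Real.exp_pos _).le
    calc c₀ = Real.exp (Real.log c₀) := (Real.exp_log hc).symm
      _ ≤ _ := Real.exp_le_exp.2 (le_abs_self _)
  have h6 := Real.exp_le_exp.1 (h1.trans h5)
  nlinarith [abs_nonneg (Real.log c₀)]

/-- Lower bound at the exponential rate of the mean. -/
theorem lower_bound_linear {α c₀ : ℝ} (h : Admissible G θ) (hα : 0 < α) (hc : 0 < c₀)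
    (hg : SubexpGrowth G c₀ α) {t r : ℝ} (ht : 0 ≤ t) (x : V → Fin 2)
    (htr : (4 - 2 * θ) * t ≤ Real.log (Fintype.card V) - r) :
    1 - 16 / θ ^ 2 * growthConst θ α c₀ ^ 2 * (c₀ * Real.exp 1) * Real.exp (-r)
      ≤ tvDist (law (noisyVoterGenerator G 2 θ) x t) (noisyVoterStationary G 2 θ) := by
  have hcard : (0 : ℝ) < Fintype.card V := by
    have := h.connected.nonempty
    exact_mod_cast Fintype.card_pos
  set Δ := c₀ * Real.exp 1
  have hΔ0 : 0 < Δ := by positivity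
  have hΔ := fun u => degree_le hg u
  have he := energy_lower_bound h ht x
  have h1 : Real.exp r ≤ Real.exp (-(4 - 2 * θ) * t) * Fintype.card V := by
    rw [← Real.exp_log hcard, ← Real.exp_add, Real.exp_le_exp]
    linarith
  have h2 : Real.exp r / Δ ≤ ∑ v, meanSpin G θ x t v ^ 2 := by
    rw [div_le_iff₀ hΔ0, mul_comm, Finset.mul_sum]
    refine (h1.trans he).trans (Finset.sum_le_sum fun v _ => ?_)
    exact mul_le_mul_of_nonneg_right (hΔ v) (sq_nonneg _)
  have := linear_lower_bound h (sum_pow_dist_le h hα hc hg) ht x (by positivity) h2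
  refine le_trans (le_of_eq ?_) this
  rw [Real.exp_neg]
  have := h.pos
  field_simp

end LowerBound

/-! ### Lower bound from pair correlations with a cutoff radius -/

section QuadraticLowerBound

variable {V : Type*} [Fintype V] [DecidableEq V] {G : SimpleGraph V} [DecidableRel G.Adj] {θ : ℝ}

/-- Lower bound at the exponential rate of the two-point correlations, in terms of a cutoff
radius `J`. -/
theorem lower_bound_radius {α c₀ : ℝ} (h : Admissible G θ) (hθ1 : θ < 1) (hα0 : 0 < α)
    (hα : α < 1) (hc : 0 < c₀) (hg : SubexpGrowth G c₀ α) {J : ℕ} (hJ : 1 ≤ J)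
    {η Δ D γ E : ℝ} (hηdef : η = 2 * (3 + |Real.log c₀|) * (J : ℝ) ^ (-α)) (hη : η ≤ 1)
    (hΔdef : Δ = c₀ * Real.exp 1)
    (hDdef : D = c₀ * Real.exp (((2 * J : ℕ) : ℝ) ^ (1 - α))) (hDn : D < Fintype.card V)
    (hγ : γ = (1 - θ) / (2 * Δ)) {t : ℝ} (ht : 0 ≤ t) (x : V → Fin 2)
    (hE : E = γ ^ (2 * J) * Real.exp (-(2 * θ + 2 * Δ ^ 2 * (1 / J + 2 * η)) * t)) :
    1 - 256 * Δ ^ 4 * D ^ 2 * (growthConst θ α c₀ ^ 2 / θ ^ 2) / (Fintype.card V * E ^ 2)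
      ≤ tvDist (law (noisyVoterGenerator G 2 θ) x t) (noisyVoterStationary G 2 θ) := by
  have hne : Nonempty V := h.connected.nonempty
  obtain ⟨v₀⟩ := id hne
  have hcard : (0 : ℝ) < Fintype.card V := by exact_mod_cast Fintype.card_pos
  have hΔ : ∀ u, (G.degree u : ℝ) ≤ Δ := fun u => hΔdef ▸ degree_le hg u
  have hΔ1 : 1 ≤ Δ := (h.one_le_degree v₀).trans (hΔ v₀)
  have hθ := h.pos
  have hJ0 : (0 : ℝ) < J := by exact_mod_cast hJ
  have hη0 : 0 ≤ η := by rw [hηdef]; positivity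
  obtain ⟨j, hj1, hj2, hslow⟩ := exists_slow_radius hα0 hα hc hg hJ (hηdef ▸ hη)
  rw [← hηdef] at hslow
  have hj0 : (J : ℝ) ≤ j := by exact_mod_cast hj1
  have hDj : ∀ u, ∑ v, near G j u v ≤ D := by
    intro u
    refine (sum_near_le hg (hJ.trans hj1) u).trans ?_
    rw [hDdef]
    have : (j : ℝ) ≤ ((2 * J : ℕ) : ℝ) := by exact_mod_cast hj2
    gcongr
  have hD1 : 1 ≤ D := by
    refine le_trans ?_ (hDj v₀)
    have := Finset.single_le_sum (f := fun w => near G j v₀ w)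
      (fun w _ => near_nonneg j v₀ w) (Finset.mem_univ v₀)
    rwa [near_self] at this
  -- Each ball has at least j+1 vertices, so near pairs outnumber vertices by a factor j ≥ J. This
  -- makes the diagonal part of the boundary a 1/J fraction, while the slow radius controls the
  -- outer part by 2η.
  have hb : (Fintype.card V : ℝ) * j ≤ ballSum G j - Fintype.card V := by
    have : (Fintype.card V : ℝ) * (j + 1) ≤ ballSum G j := by
      calc (Fintype.card V : ℝ) * (j + 1) = ∑ v : V, ((j : ℝ) + 1) := by simp [mul_add]
        _ ≤ _ := Finset.sum_le_sum fun v _ =>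
          succ_le_sum_near h.connected v ((hDj v).trans_lt hDn)
    linarith
  have hbJ : (Fintype.card V : ℝ) * J ≤ ballSum G j - Fintype.card V :=
    le_trans (by gcongr) hb
  have hJ1 : (1 : ℝ) ≤ J := by exact_mod_cast hJ
  have hn : (Fintype.card V : ℝ) ≤ ballSum G j - Fintype.card V :=
    le_trans (le_mul_of_one_le_right hcard.le hJ1) hbJ
  have hn' : (Fintype.card V : ℝ) ≤ 1 / J * (ballSum G j - Fintype.card V) := by
    rw [one_div, inv_mul_eq_div, le_div_iff₀ hJ0]; exact hbJ
  set lam := 2 * θ + 2 * Δ ^ 2 * (1 / J + 2 * η) with hlamdef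
  have hlam0 : 0 ≤ lam := by positivity
  have hlam : -lam * ∑ p : V × V, (G.degree p.1 * G.degree p.2 : ℝ) * offDiag (near G j) p ^ 2
      ≤ ∑ p : V × V, (G.degree p.1 * G.degree p.2 : ℝ) *
        (offDiag (near G j) p * act (pairGenerator G θ) (offDiag (near G j)) p) := by
    refine le_trans ?_ (rayleigh_near h hΔ j)
    have hN := ballSum_sub_card_le h (G := G) j
    set N := ∑ p : V × V, (G.degree p.1 * G.degree p.2 : ℝ) * offDiag (near G j) p ^ 2
    have h1 : Fintype.card V + (ballSum G (j + 1) - ballSum G j) ≤ (1 / J + 2 * η) * N := by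
      have h2 : η * ballSum G j ≤ η * (2 * (ballSum G j - Fintype.card V)) := by
        gcongr; linarith
      have h3 : (1 / J + 2 * η) * (ballSum G j - Fintype.card V) ≤ (1 / J + 2 * η) * N := by
        gcongr
      linarith
    have h4 := mul_le_mul_of_nonneg_left h1 (by positivity : 0 ≤ 2 * Δ ^ 2)
    rw [hlamdef]
    linarith
  have hγ0 : 0 < γ := by rw [hγ]; exact div_pos (by linarith) (by linarith)
  have hγ1 : γ ≤ 1 := by
    rw [hγ, div_le_one (by linarith)]; linarith
  have hm : ∀ u v, G.dist u v ≤ j → γ ^ (2 * J) ≤ pairStat G θ u v := by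
    intro u v huv
    refine le_trans ?_ (le_pairStat h hΔ u v)
    rw [← hγ]
    exact pow_le_pow_of_le_one hγ0.le hγ1 (huv.trans hj2)
  have hE0 : 0 < E := by rw [hE]; positivity
  have hE1 : E ≤ 1 := by
    rw [hE]
    have h1 : Real.exp (-lam * t) ≤ 1 := by
      rw [Real.exp_le_one_iff, neg_mul]
      have := mul_nonneg hlam0 ht
      linarith
    exact mul_le_one₀ (pow_le_one₀ hγ0.le hγ1) (Real.exp_pos _).le h1
  -- If the means are too large for the quadratic statistic, then ∑ z² exceeds `g` below and the
  -- linear statistic separates instead; its error is the smaller one because Δ²D/E ≥ 1.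
  by_cases hz : Δ ^ 2 * D * ∑ v, meanSpin G θ x t v ^ 2 ≤ Fintype.card V * E / 2
  · exact quadratic_lower_bound h (sum_pow_dist_le h hα0 hc hg) hΔ hDj hlam hn
      (by positivity) hm ht x hE0 hE.le hz
  · push Not at hz
    set g := Fintype.card V * E / (2 * (Δ ^ 2 * D)) with hgdef
    have hg0 : 0 < g := by positivity
    have hgz : g ≤ ∑ v, meanSpin G θ x t v ^ 2 := by
      rw [hgdef, div_le_iff₀ (by positivity)]
      linarith
    refine le_trans ?_ (linear_lower_bound h (sum_pow_dist_le h hα0 hc hg) ht x hg0 hgz)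
    have e1 : 16 / θ ^ 2 * growthConst θ α c₀ ^ 2 / g
        = growthConst θ α c₀ ^ 2 / θ ^ 2 / Fintype.card V * (32 * (Δ ^ 2 * D / E)) := by
      rw [hgdef]; field_simp; ring
    have e2 : 256 * Δ ^ 4 * D ^ 2 * (growthConst θ α c₀ ^ 2 / θ ^ 2) / (Fintype.card V * E ^ 2)
        = growthConst θ α c₀ ^ 2 / θ ^ 2 / Fintype.card V * (256 * (Δ ^ 2 * D / E) ^ 2) := by
      field_simp
    rw [e1, e2]
    have h1 : 1 ≤ Δ ^ 2 * D / E := by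
      rw [le_div_iff₀ hE0, one_mul]
      exact hE1.trans (one_le_mul_of_one_le_of_one_le (one_le_pow₀ hΔ1) hD1)
    have h2 : 32 * (Δ ^ 2 * D / E) ≤ 256 * (Δ ^ 2 * D / E) ^ 2 := by nlinarith
    have := mul_le_mul_of_nonneg_left h2
      (by positivity : 0 ≤ growthConst θ α c₀ ^ 2 / θ ^ 2 / Fintype.card V)
    linarith

end QuadraticLowerBound

/-! ### Asymptotics in the logarithm of the volume and the uniform lower bound -/

theorem eventually_const_mul_exp_neg_rpow_le (K : ℝ) {p δ : ℝ} (hp : 0 < p) (hδ : 0 < δ) :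
    ∀ᶠ L : ℝ in Filter.atTop, K * Real.exp (-(L ^ p)) ≤ δ := by
  have h1 : Filter.Tendsto (fun L : ℝ => K * Real.exp (-(L ^ p))) Filter.atTop (nhds (K * 0)) :=
    ((Real.tendsto_exp_neg_atTop_nhds_zero.comp (tendsto_rpow_atTop hp))).const_mul K
  rw [mul_zero] at h1
  exact (h1.eventually (gt_mem_nhds hδ)).mono fun _ h => h.le

theorem eventually_const_mul_rpow_neg_le (K : ℝ) {p δ : ℝ} (hp : 0 < p) (hδ : 0 < δ) :
    ∀ᶠ L : ℝ in Filter.atTop, K * L ^ (-p) ≤ δ := by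
  have h1 : Filter.Tendsto (fun L : ℝ => K * L ^ (-p)) Filter.atTop (nhds (K * 0)) :=
    (tendsto_rpow_neg_atTop hp).const_mul K
  rw [mul_zero] at h1
  exact (h1.eventually (gt_mem_nhds hδ)).mono fun _ h => h.le

/-- Lower bound for the distance to stationarity, uniform in the initial state. -/
theorem exists_lower_bound {θ α c₀ ε : ℝ} (hθ0 : 0 < θ) (hα0 : 0 < α) (hα1 : α < 1)
    (hc : 0 < c₀) (hε : ε < 1) :
    ∃ C L₀ : ℝ, ∀ (V : Type u) [Fintype V] [DecidableEq V] (G : SimpleGraph V) [DecidableRel G.Adj]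
      (x : V → Fin 2) (t : ℝ), Admissible G θ → SubexpGrowth G c₀ α →
      L₀ ≤ Real.log (Fintype.card V) → 0 ≤ t →
      min (4 - 2 * θ) (4 * θ) * t
        ≤ Real.log (Fintype.card V) - C * Real.log (Fintype.card V) ^ (1 - α / 2) →
      ε ≤ tvDist (law (noisyVoterGenerator G 2 θ) x t) (noisyVoterStationary G 2 θ) := by
  have hp : 0 < 1 - α / 2 := by linarith
  set B := growthConst θ α c₀
  set Δ := c₀ * Real.exp 1 with hΔdef
  have hΔ0 : 0 < Δ := by positivity
  -- The linear statistic gives the smaller rate when θ ≥ 2/3. Otherwise θ ≤ 2/3 < 1, as the pair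
  -- argument requires.
  rcases le_total (4 - 2 * θ) (4 * θ) with hcase | hcase
  · obtain ⟨L₀, hL₀⟩ := Filter.eventually_atTop.1
      (eventually_const_mul_exp_neg_rpow_le (16 / θ ^ 2 * B ^ 2 * Δ) hp (sub_pos.2 hε))
    refine ⟨1, L₀, fun V _ _ G _ x t h hg hL ht hle => ?_⟩
    rw [min_eq_left hcase, one_mul] at hle
    have h1 := lower_bound_linear h hα0 hc hg ht x hle
    have h2 := hL₀ _ hL
    linarith
  · set γ := (1 - θ) / (2 * Δ) with hγdef
    have hγ0 : 0 < γ := div_pos (by linarith) (by linarith)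
    set a := 3 + |Real.log c₀|
    have ha : 0 < a := by positivity
    set κ := 2 * Δ ^ 2 * (1 + 2 * (2 * a))
    have hκ0 : 0 ≤ κ := by positivity
    -- With l = L^{1-α/2}: 8l pays for D², 8|log γ| l for the factor γ^{4J}, κ/(2θ) l for the excess
    -- of the rate over 2θ, and one more l leaves the final e^{-l}.
    set C := 9 + 8 * |Real.log γ| + κ / (2 * θ) with hC
    have hC0 : 0 ≤ C := by positivity
    have hev1 : ∀ᶠ L : ℝ in Filter.atTop, c₀ * Real.exp (4 * L ^ (1 / 2 : ℝ)) < Real.exp L := by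
      have h1 : ∀ᶠ L : ℝ in Filter.atTop, 5 * L ^ (-(1 / 2 : ℝ)) ≤ 1 :=
        eventually_const_mul_rpow_neg_le 5 (by norm_num) one_pos
      have h2 : ∀ᶠ L : ℝ in Filter.atTop, c₀ * Real.exp (-(L ^ (1 / 2 : ℝ))) ≤ 1 / 2 :=
        eventually_const_mul_exp_neg_rpow_le c₀ (by norm_num) (by norm_num)
      filter_upwards [h1, h2, Filter.eventually_gt_atTop 0] with L h1 h2 h3
      have h4 : 5 * L ^ (1 / 2 : ℝ) ≤ L := by
        have h5 := mul_le_mul_of_nonneg_right h1 h3.le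
        have e : L ^ (-(1 / 2 : ℝ)) * L = L ^ (1 / 2 : ℝ) := by
          nth_rewrite 2 [← Real.rpow_one L]
          rw [← Real.rpow_add h3]; norm_num
        rw [mul_assoc, e] at h5
        linarith
      calc c₀ * Real.exp (4 * L ^ (1 / 2 : ℝ))
          = (c₀ * Real.exp (-(L ^ (1 / 2 : ℝ)))) * Real.exp (5 * L ^ (1 / 2 : ℝ)) := by
            rw [mul_assoc, ← Real.exp_add]; congr 2; ring
        _ ≤ 1 / 2 * Real.exp L := by gcongr
        _ < Real.exp L := by linarith [Real.exp_pos L]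
    obtain ⟨L₀, hL₀⟩ := Filter.eventually_atTop.1
      ((eventually_const_mul_exp_neg_rpow_le (256 * Δ ^ 4 * (B ^ 2 / θ ^ 2) * c₀ ^ 2) hp
        (sub_pos.2 hε)).and ((eventually_const_mul_rpow_neg_le (2 * a) (half_pos hα0) one_pos).and
        (hev1.and (Filter.eventually_ge_atTop 1))))
    refine ⟨C, L₀, fun V _ _ G _ x t h hg hL ht hle => ?_⟩
    have : Nonempty V := h.connected.nonempty
    have hcard : (0 : ℝ) < Fintype.card V := by exact_mod_cast Fintype.card_pos
    obtain ⟨h1, h2, h3, hL1⟩ := hL₀ _ hL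
    set L := Real.log (Fintype.card V) with hLdef
    have hLn : Real.exp L = Fintype.card V := Real.exp_log hcard
    have hL0 : 0 < L := by linarith
    set l := L ^ (1 - α / 2)
    have hl0 : 0 ≤ l := by positivity
    rw [min_eq_right hcase] at hle
    set q := L ^ (1 / 2 : ℝ) with hq
    have hq1 : 1 ≤ q := Real.one_le_rpow hL1 (by norm_num)
    have hql : q ≤ l := Real.rpow_le_rpow_of_exponent_le hL1 (by linarith)
    -- J of order √L makes the rate error J^{-α} ≤ L^{-α/2}, while the costs D and γ^{2J} are only
    -- e^{O(√L)}, and √L ≤ L^{1-α/2}.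
    set J := ⌈q⌉₊
    have hqJ : q ≤ J := Nat.le_ceil q
    have hJq : (J : ℝ) ≤ 2 * q := by
      have := (Nat.ceil_lt_add_one (by linarith : 0 ≤ q)).le
      linarith
    have hJ1 : (1 : ℝ) ≤ J := hq1.trans hqJ
    have hJα : (J : ℝ) ^ (-α) ≤ L ^ (-(α / 2)) := by
      calc (J : ℝ) ^ (-α) ≤ q ^ (-α) :=
            Real.rpow_le_rpow_of_nonpos (by linarith) hqJ (by linarith)
        _ = L ^ (-(α / 2)) := by
            rw [hq, ← Real.rpow_mul hL0.le]; congr 1; ring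
    have hη : 2 * a * (J : ℝ) ^ (-α) ≤ 1 := le_trans (by gcongr) h2
    have hpow : ((2 * J : ℕ) : ℝ) ^ (1 - α) ≤ 4 * q := by
      have h5 : (1 : ℝ) ≤ ((2 * J : ℕ) : ℝ) := by push_cast; linarith
      calc ((2 * J : ℕ) : ℝ) ^ (1 - α) ≤ ((2 * J : ℕ) : ℝ) ^ (1 : ℝ) :=
            Real.rpow_le_rpow_of_exponent_le h5 (by linarith)
        _ ≤ 4 * q := by rw [Real.rpow_one]; push_cast; linarith
    set D := c₀ * Real.exp (((2 * J : ℕ) : ℝ) ^ (1 - α)) with hDdef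
    have hDn : D < Fintype.card V := by
      refine lt_of_le_of_lt ?_ (hLn ▸ h3)
      rw [hDdef]; gcongr
    have main := lower_bound_radius h (by linarith) hα0 hα1 hc hg (J := J) (by exact_mod_cast hJ1)
      rfl hη hΔdef hDdef hDn hγdef ht x rfl
    refine le_trans ?_ main
    set lam := 2 * θ + 2 * Δ ^ 2 * (1 / J + 2 * (2 * a * (J : ℝ) ^ (-α))) with hlam
    have hJinv : 1 / (J : ℝ) ≤ L ^ (-(α / 2)) := by
      refine le_trans ?_ hJα
      rw [one_div, ← Real.rpow_neg_one]
      exact Real.rpow_le_rpow_of_exponent_le hJ1 (by linarith)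
    have hlamle : lam ≤ 2 * θ + κ * L ^ (-(α / 2)) := by
      have : 1 / J + 2 * (2 * a * (J : ℝ) ^ (-α)) ≤ (1 + 2 * (2 * a)) * L ^ (-(α / 2)) := by
        have := mul_le_mul_of_nonneg_left hJα (by positivity : 0 ≤ 2 * (2 * a))
        linarith
      have := mul_le_mul_of_nonneg_left this (by positivity : 0 ≤ 2 * Δ ^ 2)
      rw [hlam]
      linarith
    have hLl : L ^ (-(α / 2)) * L = l := by
      nth_rewrite 2 [← Real.rpow_one L]
      rw [← Real.rpow_add hL0]; congr 1; ring
    have htL : t ≤ L / (4 * θ) := by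
      rw [le_div_iff₀ (by linarith)]
      have := mul_nonneg hC0 hl0
      linarith
    have hlamt : 2 * (lam * t) ≤ L - C * l + κ / (2 * θ) * l := by
      have h5 : lam * t ≤ (2 * θ + κ * L ^ (-(α / 2))) * t := by gcongr
      have h6 : κ * L ^ (-(α / 2)) * t ≤ κ * L ^ (-(α / 2)) * (L / (4 * θ)) := by gcongr
      have h7 : κ * L ^ (-(α / 2)) * (L / (4 * θ)) = κ / (4 * θ) * l := by
        rw [← hLl]; ring
      have h8 : κ / (2 * θ) * l = 2 * (κ / (4 * θ) * l) := by field_simp; ring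
      linarith
    have hDle : D ^ 2 ≤ c₀ ^ 2 * Real.exp (8 * l) := by
      rw [hDdef, mul_pow, ← Real.exp_nat_mul]
      refine mul_le_mul_of_nonneg_left (Real.exp_le_exp.2 ?_) (by positivity)
      rw [Nat.cast_ofNat]
      linarith
    have hγpow : γ ^ (2 * J) = Real.exp ((2 * J : ℕ) * Real.log γ) := by
      rw [Real.exp_nat_mul, Real.exp_log hγ0]
    have hfrac : D ^ 2 / (Fintype.card V * (γ ^ (2 * J) * Real.exp (-lam * t)) ^ 2)
        ≤ c₀ ^ 2 * Real.exp (-l) := by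
      rw [hγpow, ← Real.exp_add, ← Real.exp_nat_mul, ← hLn, ← Real.exp_add,
        div_le_iff₀ (Real.exp_pos _)]
      refine hDle.trans ?_
      rw [mul_assoc, ← Real.exp_add]
      gcongr
      push_cast
      have h9 : -(4 * (J : ℝ) * Real.log γ) ≤ 8 * |Real.log γ| * l := by
        have h10 : -Real.log γ ≤ |Real.log γ| := neg_le_abs _
        have h11 : 4 * (J : ℝ) ≤ 8 * l := by linarith
        calc -(4 * (J : ℝ) * Real.log γ) = 4 * (J : ℝ) * (-Real.log γ) := by ring
          _ ≤ 4 * (J : ℝ) * |Real.log γ| := by gcongr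
          _ ≤ 8 * l * |Real.log γ| := by gcongr
          _ = _ := by ring
      have h12 : C * l = 9 * l + 8 * |Real.log γ| * l + κ / (2 * θ) * l := by rw [hC]; ring
      linarith
    have := mul_le_mul_of_nonneg_left hfrac
      (by positivity : 0 ≤ 256 * Δ ^ 4 * (B ^ 2 / θ ^ 2))
    calc ε ≤ 1 - 256 * Δ ^ 4 * (B ^ 2 / θ ^ 2) * c₀ ^ 2 * Real.exp (-l) := by linarith
      _ ≤ 1 - 256 * Δ ^ 4 * (B ^ 2 / θ ^ 2)
          * (D ^ 2 / (Fintype.card V * (γ ^ (2 * J) * Real.exp (-lam * t)) ^ 2)) := by linarith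
      _ = _ := by ring

/-! ### Comparison with weighted jump systems -/

section JumpMatrix

variable {ι κ : Type*} [Fintype ι] [DecidableEq ι] [Fintype κ]

/-- The matrix of a jump system with damping `d`, weights `c` and transitions `τ`. -/
def jumpMatrix (d : ι → ℝ) (c : ι → κ → ℝ) (τ : ι → κ → ι) : Matrix ι ι ℝ :=
  fun i j => (if i = j then -d i else 0) + ∑ k, if τ i k = j then c i k else 0

theorem act_jumpMatrix (d : ι → ℝ) (c : ι → κ → ℝ) (τ : ι → κ → ι) (f : ι → ℝ) (i : ι) :
    act (jumpMatrix d c τ) f i = ∑ k, c i k * f (τ i k) - d i * f i := by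
  simp only [act, jumpMatrix, add_mul, Finset.sum_add_distrib, ite_mul, zero_mul,
    Finset.sum_ite_eq, Finset.mem_univ, if_true, Finset.sum_mul]
  rw [Finset.sum_comm]
  simp only [Finset.sum_ite_eq, Finset.mem_univ, if_true]
  ring

theorem isMetzler_jumpMatrix {d : ι → ℝ} {c : ι → κ → ℝ} {τ : ι → κ → ι} (hc : ∀ i k, 0 ≤ c i k) :
    IsMetzler (jumpMatrix d c τ) := by
  intro i j hij
  simp only [jumpMatrix, hij, if_false, zero_add]
  refine Finset.sum_nonneg fun k _ => ?_
  split_ifs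
  · exact hc i k
  · exact le_rfl

end JumpMatrix

section Correlations

variable {V : Type*} [Fintype V] [DecidableEq V] {G : SimpleGraph V} [DecidableRel G.Adj] {θ : ℝ}

theorem sum_copyRate_inl_mul (u : V) (q : V → ℝ) :
    ∑ w, copyRate G θ u (Sum.inl w) * q w = (1 - θ) * nbrAvg G q u := by
  have := sum_copyRate_mul (G := G) (θ := θ) u (Sum.elim q fun _ => 0)
  simpa using this

/-! ### The set of vertices hit by the dual process -/

section Range

/-- Indicator of the event that every vertex of `A` is the current position of some dual walk. -/
def occupied (A : Finset V) (ξ : V → V ⊕ Fin 2) : ℝ :=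
  if ∀ a ∈ A, ∃ w, ξ w = Sum.inl a then 1 else 0

theorem occupied_nonneg (A : Finset V) (ξ : V → V ⊕ Fin 2) : 0 ≤ occupied A ξ := by
  unfold occupied; split_ifs <;> norm_num

theorem redirect_eq_inl {u a : V} {d e : V ⊕ Fin 2} (h : redirect u d e = Sum.inl a) :
    (e = Sum.inl u ∧ d = Sum.inl a) ∨ (e = Sum.inl a ∧ a ≠ u) := by
  unfold redirect at h
  by_cases he : e = Sum.inl u
  · subst he; left; simpa using h
  · rw [Function.update_of_ne he] at h
    right
    refine ⟨h, ?_⟩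
    rintro rfl
    exact he h

theorem occupied_redirect_of_mem {A : Finset V} {u : V} (hu : u ∈ A) {d : V ⊕ Fin 2}
    (hd : d ≠ Sum.inl u) (ξ : V → V ⊕ Fin 2) : occupied A (redirect u d ∘ ξ) = 0 := by
  refine if_neg fun hall => ?_
  obtain ⟨w, hw⟩ := hall u hu
  rcases redirect_eq_inl hw with h | h
  · exact hd h.2
  · exact h.2 rfl

/-- If moving the walks at u ∉ A makes `A` full for the first time, they moved onto the only vacant
vertex a of `A`; so `u` and the rest of `A` were occupied before. -/
theorem occupied_redirect_le {A : Finset V} {u : V} (hu : u ∉ A) (d : V ⊕ Fin 2)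
    (ξ : V → V ⊕ Fin 2) :
    occupied A (redirect u d ∘ ξ) ≤ occupied A ξ
      + ∑ a ∈ A, (if d = Sum.inl a then 1 else 0) * occupied (insert u (A.erase a)) ξ := by
  have hnn : ∀ a ∈ A, 0 ≤ (if d = Sum.inl a then (1 : ℝ) else 0)
      * occupied (insert u (A.erase a)) ξ := fun a _ =>
    mul_nonneg (by split_ifs <;> norm_num) (occupied_nonneg _ _)
  by_cases hall : ∀ a ∈ A, ∃ w, (redirect u d ∘ ξ) w = Sum.inl a
  · by_cases hall' : ∀ a ∈ A, ∃ w, ξ w = Sum.inl a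
    · have e1 : occupied A (redirect u d ∘ ξ) = 1 := if_pos hall
      have e2 : occupied A ξ = 1 := if_pos hall'
      have := Finset.sum_nonneg hnn
      linarith
    · push Not at hall'
      obtain ⟨a, ha, hna⟩ := hall'
      obtain ⟨w, hw⟩ := hall a ha
      rcases redirect_eq_inl hw with h | h
      · have e1 : occupied A (redirect u d ∘ ξ) = 1 := if_pos hall
        have e3 : occupied (insert u (A.erase a)) ξ = 1 := by
          refine if_pos fun b hb => ?_
          rcases Finset.mem_insert.1 hb with rfl | hb
          · exact ⟨w, h.1⟩
          · obtain ⟨w', hw'⟩ := hall b (Finset.mem_of_mem_erase hb)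
            rcases redirect_eq_inl hw' with h' | h'
            · exact absurd (Sum.inl_injective (h'.2.symm.trans h.2)) (Finset.ne_of_mem_erase hb)
            · exact ⟨w', h'.1⟩
        have := Finset.single_le_sum hnn ha
        rw [h.2, if_pos rfl, e3] at this
        have h0 := occupied_nonneg A ξ
        rw [e1, h.2]
        linarith
      · exact absurd h.1 (hna w)
  · have e1 : occupied A (redirect u d ∘ ξ) = 0 := if_neg hall
    rw [e1]
    exact add_nonneg (occupied_nonneg _ _) (Finset.sum_nonneg hnn)

/-- The jump system dominating the hitting probabilities of sets of vertices. -/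
def rangeMatrix (G : SimpleGraph V) [DecidableRel G.Adj] (θ : ℝ) :
    Matrix (Finset V) (Finset V) ℝ :=
  jumpMatrix (κ := V × V) (fun A => A.card)
    (fun A p => if p.1 ∈ A ∧ p.2 ∉ A then copyRate G θ p.2 (Sum.inl p.1) else 0)
    (fun A p => insert p.2 (A.erase p.1))

theorem act_rangeMatrix (f : Finset V → ℝ) (A : Finset V) :
    act (rangeMatrix G θ) f A = ∑ a ∈ A, ∑ u ∈ Aᶜ,
      copyRate G θ u (Sum.inl a) * f (insert u (A.erase a)) - A.card * f A := by
  rw [rangeMatrix, act_jumpMatrix, Fintype.sum_prod_type]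
  congr 1
  rw [← Finset.sum_subset (Finset.subset_univ A)]
  · refine Finset.sum_congr rfl fun a ha => ?_
    rw [← Finset.sum_subset (Finset.subset_univ Aᶜ)]
    · refine Finset.sum_congr rfl fun u hu => ?_
      rw [if_pos ⟨ha, Finset.mem_compl.1 hu⟩]
    · intro u _ hu
      rw [Finset.mem_compl, not_not] at hu
      simp [hu]
  · intro a _ ha
    simp [ha]

/-- A ring at a vertex of `A` vacates it, since there are no self-loops, and gives the damping |A|.
A ring outside `A` can only fill a vacancy. The inequality closes on the family of all sets `A`, so
the comparison principle applies. -/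
theorem act_occupied_le (h : Admissible G θ) (A : Finset V) (ξ : V → V ⊕ Fin 2) :
    act (dualGenerator G θ) (occupied A) ξ
      ≤ act (rangeMatrix G θ) (fun B => occupied B ξ) A := by
  rw [act_dualGenerator, act_rangeMatrix, Finset.sum_comm]
  have h1 : ∀ u ∈ A, ∑ d, copyRate G θ u d * occupied A (redirect u d ∘ ξ) - occupied A ξ
      = -occupied A ξ := by
    intro u hu
    rw [Finset.sum_eq_zero, zero_sub]
    intro d _
    by_cases hd : d = Sum.inl u
    · subst hd; simp [copyRate]
    · rw [occupied_redirect_of_mem hu hd, mul_zero]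
  have h2 : ∀ u ∈ Aᶜ, ∑ d, copyRate G θ u d * occupied A (redirect u d ∘ ξ) - occupied A ξ
      ≤ ∑ a ∈ A, copyRate G θ u (Sum.inl a) * occupied (insert u (A.erase a)) ξ := by
    intro u hu
    have hu' := Finset.mem_compl.1 hu
    have h3 : ∑ d, copyRate G θ u d * occupied A (redirect u d ∘ ξ)
        ≤ ∑ d, copyRate G θ u d * (occupied A ξ + ∑ a ∈ A, (if d = Sum.inl a then 1 else 0)
          * occupied (insert u (A.erase a)) ξ) :=
      Finset.sum_le_sum fun d _ => mul_le_mul_of_nonneg_left (occupied_redirect_le hu' d ξ)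
        (h.copyRate_nonneg u d)
    have h4 : ∑ d, copyRate G θ u d * (occupied A ξ + ∑ a ∈ A, (if d = Sum.inl a then 1 else 0)
          * occupied (insert u (A.erase a)) ξ)
        = occupied A ξ
          + ∑ a ∈ A, copyRate G θ u (Sum.inl a) * occupied (insert u (A.erase a)) ξ := by
      simp only [mul_add, Finset.sum_add_distrib, ← Finset.sum_mul, h.sum_copyRate, one_mul]
      congr 1
      simp only [Finset.mul_sum]
      rw [Finset.sum_comm]
      refine Finset.sum_congr rfl fun a _ => ?_
      simp
    linarith
  rw [← Finset.sum_add_sum_compl A, Finset.sum_congr rfl h1, Finset.sum_const, nsmul_eq_mul]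
  have := Finset.sum_le_sum h2
  linarith

/-- Decay of the probability that all vertices of a given set are hit by the dual process. -/
theorem dualEv_occupied_le (h : Admissible G θ) {Δ : ℝ} (hΔ : ∀ u, (G.degree u : ℝ) ≤ Δ) {t : ℝ}
    (ht : 0 ≤ t) (A : Finset V) :
    dualEv G θ t (occupied A) ≤ (Δ * Real.exp (-θ * t)) ^ A.card := by
  have hM : IsMetzler (rangeMatrix G θ) := isMetzler_jumpMatrix fun A p => by
    split_ifs
    · exact h.copyRate_nonneg _ _
    · exact le_rfl
  have hθ := sub_nonneg.2 h.le_one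
  -- The product of degrees is the reversible weight of independent walks: replacing a by a
  -- neighbour u at rate (1-θ)/deg u and summing over u gives at most (1-θ) W(A). Hence W(A)
  -- e^{-θ|A|t} is a supersolution.
  set W : Finset V → ℝ := fun A => ∏ a ∈ A, (G.degree a : ℝ)
  have hW0 : ∀ A, 0 < W A := fun A => Finset.prod_pos fun a _ => h.degree_pos a
  have key : dualEv G θ t (occupied A) ≤ W A * Real.exp (-θ * A.card * t) := by
    refine hM.le_of_deriv (y := fun t A => dualEv G θ t (occupied A))
      (y' := fun t A => dualEv G θ t (act (dualGenerator G θ) (occupied A)))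
      (Y := fun t A => W A * Real.exp (-θ * A.card * t))
      (Y' := fun t A => W A * (-θ * A.card * Real.exp (-θ * A.card * t)))
      (fun t A => hasDerivAt_dualEv t _) ?_ ?_ ?_ ?_ ht A
    · intro t A
      have := (((hasDerivAt_id t).const_mul (-θ * A.card)).exp).const_mul (W A)
      refine HasDerivAt.congr_deriv this (Eq.symm ?_)
      simp only [id, mul_one]; ring
    · intro t ht A
      refine (dualEv_mono h ht (act_occupied_le h A)).trans (le_of_eq ?_)
      simp only [act_rangeMatrix]
      rw [dualEv_sub, dualEv_const_mul, dualEv_sum]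
      congr 1
      refine Finset.sum_congr rfl fun a _ => ?_
      rw [dualEv_sum]
      refine Finset.sum_congr rfl fun u _ => ?_
      rw [dualEv_const_mul]
    · intro t ht A
      rw [act_rangeMatrix]
      have hsum : ∀ a ∈ A, ∑ u ∈ Aᶜ, copyRate G θ u (Sum.inl a)
          * (W (insert u (A.erase a)) * Real.exp (-θ * (insert u (A.erase a)).card * t))
          ≤ (1 - θ) * (W A * Real.exp (-θ * A.card * t)) := by
        intro a ha
        have hterm : ∀ u ∈ Aᶜ, copyRate G θ u (Sum.inl a)
            * (W (insert u (A.erase a)) * Real.exp (-θ * (insert u (A.erase a)).card * t))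
            = (if G.Adj a u then 1 else 0) * ((1 - θ) * (W (A.erase a)
              * Real.exp (-θ * A.card * t))) := by
          intro u hu
          have hu' : u ∉ A.erase a := fun hh => Finset.mem_compl.1 hu (Finset.mem_of_mem_erase hh)
          have hcard : (insert u (A.erase a)).card = A.card := by
            rw [Finset.card_insert_of_notMem hu', Finset.card_erase_add_one ha]
          have hWi : W (insert u (A.erase a)) = G.degree u * W (A.erase a) :=
            Finset.prod_insert hu'
          rw [hcard, hWi]
          simp only [copyRate, G.adj_comm u a]
          split_ifs
          · have := (h.degree_pos u).ne'
            field_simp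
          · simp
        rw [Finset.sum_congr rfl hterm, ← Finset.sum_mul]
        have hdeg : ∑ u ∈ Aᶜ, (if G.Adj a u then (1 : ℝ) else 0) ≤ G.degree a := by
          calc ∑ u ∈ Aᶜ, (if G.Adj a u then (1 : ℝ) else 0)
              ≤ ∑ u, (if G.Adj a u then (1 : ℝ) else 0) :=
                Finset.sum_le_sum_of_subset_of_nonneg (Finset.subset_univ _) fun u _ _ => by
                  split_ifs <;> norm_num
            _ = G.degree a := by
                rw [Finset.sum_boole, ← SimpleGraph.card_neighborFinset_eq_degree,
                  SimpleGraph.neighborFinset_eq_filter]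
        have hWA : W A = G.degree a * W (A.erase a) := (Finset.mul_prod_erase A _ ha).symm
        have hWe := hW0 (A.erase a)
        have hpos : 0 ≤ (1 - θ) * (W (A.erase a) * Real.exp (-θ * A.card * t)) :=
          mul_nonneg hθ (mul_nonneg hWe.le (Real.exp_pos _).le)
        refine (mul_le_mul_of_nonneg_right hdeg hpos).trans (le_of_eq ?_)
        rw [hWA]; ring
      have := Finset.sum_le_sum hsum
      rw [Finset.sum_const, nsmul_eq_mul] at this
      linarith
    · intro A
      simp only [dualEv_zero, mul_zero, Real.exp_zero, mul_one]
      have e1 : occupied A (Sum.inl : V → V ⊕ Fin 2) = 1 := if_pos fun a _ => ⟨a, rfl⟩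
      rw [e1]
      calc (1 : ℝ) = ∏ _a ∈ A, 1 := by simp
        _ ≤ _ := Finset.prod_le_prod (fun _ _ => zero_le_one) fun a _ => h.one_le_degree a
  refine key.trans ?_
  rw [mul_pow, ← Real.exp_nat_mul]
  have e : -θ * A.card * t = A.card * (-θ * t) := by ring
  rw [e]
  refine mul_le_mul_of_nonneg_right ?_ (Real.exp_pos _).le
  calc W A ≤ ∏ _a ∈ A, Δ := Finset.prod_le_prod (fun a _ => (h.degree_pos a).le) fun a _ => hΔ a
    _ = Δ ^ A.card := Finset.prod_const Δ

end Range

/-! ### Decay of the correlations from the alternating state -/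

section Monomials

/-- The product of the spins in `A`. -/
def spinProd (A : Finset V) (x : V → Fin 2) : ℝ := ∏ v ∈ A, spin (x v)

theorem abs_spinProd (A : Finset V) (x : V → Fin 2) : |spinProd A x| = 1 := by
  rw [spinProd, Finset.abs_prod]
  exact Finset.prod_eq_one fun v _ => abs_spin _

theorem spinProd_mul_spin (A : Finset V) (w : V) (x : V → Fin 2) :
    spinProd A x * spin (x w) = spinProd (symmDiff A {w}) x := by
  by_cases hw : w ∈ A
  · have e : symmDiff A {w} = A.erase w := by
      ext v
      simp only [Finset.mem_symmDiff, Finset.mem_singleton, Finset.mem_erase]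
      by_cases hv : v = w
      · subst hv; simp [hw]
      · simp [hv]
    rw [e, spinProd, ← Finset.prod_erase_mul A _ hw, mul_assoc, spin_mul_self, mul_one, spinProd]
  · have e : symmDiff A {w} = insert w A := by
      ext v
      simp only [Finset.mem_symmDiff, Finset.mem_singleton, Finset.mem_insert]
      by_cases hv : v = w
      · subst hv; simp [hw]
      · simp [hv]
    rw [e, spinProd, spinProd, Finset.prod_insert hw, mul_comm]

/-- At a ring the spin at u ∈ A is replaced by that of a neighbour, or by a mean-zero fresh spin,
which drops out. The symmetric difference encodes coalescence in pairs, as a squared spin is 1. -/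
theorem act_spinProd (h : Admissible G θ) (A : Finset V) (x : V → Fin 2) :
    act (noisyVoterGenerator G 2 θ) (spinProd A) x
      = ∑ u ∈ A, ∑ w, copyRate G θ u (Sum.inl w) * spinProd (symmDiff (A.erase u) {w}) x
        - A.card * spinProd A x := by
  have hf : ∀ u j, spinProd A (Function.update x u j)
      = (if u ∈ A then 0 else spinProd A x)
        + (if u ∈ A then spinProd (A.erase u) x else 0) * spin j := by
    intro u j
    by_cases hu : u ∈ A
    · simp only [hu, if_true, zero_add, spinProd]
      rw [← Finset.prod_erase_mul A _ hu, Function.update_self]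
      congr 1
      refine Finset.prod_congr rfl fun v hv => ?_
      rw [Function.update_of_ne (Finset.ne_of_mem_erase hv)]
    · simp only [hu, if_false, zero_mul, add_zero, spinProd]
      refine Finset.prod_congr rfl fun v hv => ?_
      rw [Function.update_of_ne (ne_of_mem_of_not_mem hv hu)]
  rw [act_noisyVoter_affine h hf, ← Finset.sum_subset (Finset.subset_univ A)]
  · have : ∀ u ∈ A, (if u ∈ A then 0 else spinProd A x)
        + (if u ∈ A then spinProd (A.erase u) x else 0)
          * ((1 - θ) * nbrAvg G (fun w => spin (x w)) u) - spinProd A x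
        = ∑ w, copyRate G θ u (Sum.inl w) * spinProd (symmDiff (A.erase u) {w}) x
          - spinProd A x := by
      intro u hu
      rw [if_pos hu, if_pos hu, zero_add, ← sum_copyRate_inl_mul, Finset.mul_sum]
      congr 1
      refine Finset.sum_congr rfl fun w _ => ?_
      rw [← spinProd_mul_spin]; ring
    rw [Finset.sum_congr rfl this, Finset.sum_sub_distrib, Finset.sum_const, nsmul_eq_mul]
  · intro u _ hu
    simp [hu]

/-- Difference between the correlations at time `t` and in equilibrium. -/
def corrGap (G : SimpleGraph V) [DecidableRel G.Adj] (θ : ℝ) (x : V → Fin 2) (t : ℝ)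
    (A : Finset V) : ℝ :=
  evolve (noisyVoterGenerator G 2 θ) t (spinProd A) x
    - ∑ y, noisyVoterStationary G 2 θ y * spinProd A y

theorem evolve_sum {ι κ : Type*} [Fintype ι] [DecidableEq ι] (Q : Matrix ι ι ℝ) (t : ℝ)
    (s : Finset κ) (f : κ → ι → ℝ) (i : ι) :
    evolve Q t (fun j => ∑ k ∈ s, f k j) i = ∑ k ∈ s, evolve Q t (f k) i := by
  simp only [evolve, Finset.mul_sum]
  rw [Finset.sum_comm]

theorem evolve_const_mul {ι : Type*} [Fintype ι] [DecidableEq ι] (Q : Matrix ι ι ℝ) (t c : ℝ)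
    (f : ι → ℝ) (i : ι) : evolve Q t (fun j => c * f j) i = c * evolve Q t f i := by
  simp only [evolve, Finset.mul_sum]
  exact Finset.sum_congr rfl fun j _ => by ring

theorem evolve_sub {ι : Type*} [Fintype ι] [DecidableEq ι] (Q : Matrix ι ι ℝ) (t : ℝ)
    (f g : ι → ℝ) (i : ι) :
    evolve Q t (fun j => f j - g j) i = evolve Q t f i - evolve Q t g i := by
  simp only [evolve, mul_sub, Finset.sum_sub_distrib]

/-- Equilibrium correlations satisfy the same linear equations with zero left side, so their
difference obeys a homogeneous system. -/
theorem hasDerivAt_corrGap (h : Admissible G θ) (x : V → Fin 2) (t : ℝ) (A : Finset V) :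
    HasDerivAt (fun s => corrGap G θ x s A)
      (∑ u ∈ A, ∑ w, copyRate G θ u (Sum.inl w) * corrGap G θ x t (symmDiff (A.erase u) {w})
        - A.card * corrGap G θ x t A) t := by
  have h1 := (hasDerivAt_evolve (noisyVoterGenerator G 2 θ) t (spinProd A) x).sub_const
    (∑ y, noisyVoterStationary G 2 θ y * spinProd A y)
  refine HasDerivAt.congr_deriv h1 (Eq.symm ?_)
  have e1 : act (noisyVoterGenerator G 2 θ) (spinProd A) = fun x =>
      ∑ u ∈ A, ∑ w, copyRate G θ u (Sum.inl w) * spinProd (symmDiff (A.erase u) {w}) x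
        - A.card * spinProd A x := funext (act_spinProd h A)
  have e2 : ∀ B : Finset V, evolve (noisyVoterGenerator G 2 θ) t (spinProd B) x
      = corrGap G θ x t B + ∑ y, noisyVoterStationary G 2 θ y * spinProd B y := fun B => by
    simp [corrGap]
  have e3 := h.isStationary.sum_mul_act (spinProd A)
  rw [e1] at e3 ⊢
  have e4 : ∑ y, noisyVoterStationary G 2 θ y * (∑ u ∈ A, ∑ w, copyRate G θ u (Sum.inl w)
      * spinProd (symmDiff (A.erase u) {w}) y - A.card * spinProd A y)
      = ∑ u ∈ A, ∑ w, copyRate G θ u (Sum.inl w)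
        * (∑ y, noisyVoterStationary G 2 θ y * spinProd (symmDiff (A.erase u) {w}) y)
        - A.card * ∑ y, noisyVoterStationary G 2 θ y * spinProd A y := by
    simp only [mul_sub, Finset.sum_sub_distrib, Finset.mul_sum]
    congr 1
    · rw [Finset.sum_comm]
      refine Finset.sum_congr rfl fun u _ => ?_
      rw [Finset.sum_comm]
      exact Finset.sum_congr rfl fun w _ => Finset.sum_congr rfl fun y _ => by ring
    · exact Finset.sum_congr rfl fun y _ => by ring
  rw [e4] at e3
  rw [evolve_sub, evolve_const_mul, evolve_sum]
  simp only [evolve_sum, evolve_const_mul, e2, mul_add, Finset.sum_add_distrib]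
  linarith

/-- On a bipartite graph the alternating function is an eigenfunction of the neighbour average with
eigenvalue -1, so the mean decays at rate 1 + (1-θ). -/
theorem meanSpin_alternating (h : Admissible G θ) {V₁ : Set V} (hb : G.IsBipartiteWith V₁ V₁ᶜ)
    (t : ℝ) (v : V) :
    meanSpin G θ (alternating V₁) t v = Real.exp (-(2 - θ) * t) * spin (alternating V₁ v) := by
  have hflip : ∀ u w, G.Adj u w → spin (alternating V₁ w) = -spin (alternating V₁ u) := by
    intro u w huw
    rcases hb.mem_of_adj huw with ⟨h1, h2⟩ | ⟨h1, h2⟩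
    · have h3 : w ∉ V₁ := h2
      simp [alternating, h1, h3, spin_one, spin_zero]
    · have h3 : u ∉ V₁ := h1
      simp [alternating, h2, h3, spin_one, spin_zero]
  have key : ∀ s v, HasDerivAt
      (fun r => evolve (noisyVoterGenerator G 2 θ) r (fun x => spin (x v)) (alternating V₁)
        - Real.exp (-(2 - θ) * r) * spin (alternating V₁ v))
      (act (jumpMatrix (κ := V) (fun _ => 1) (fun u w => copyRate G θ u (Sum.inl w)) (fun _ w => w))
        (fun v => meanSpin G θ (alternating V₁) s v
          - Real.exp (-(2 - θ) * s) * spin (alternating V₁ v)) v) s := by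
    intro s v
    rw [act_jumpMatrix]
    have h1 := hasDerivAt_meanSpin h (alternating V₁) s v
    have h2 := (((hasDerivAt_id s).const_mul (-(2 - θ))).exp).mul_const (spin (alternating V₁ v))
    have h3 := h1.sub h2
    refine HasDerivAt.congr_deriv h3 (Eq.symm ?_)
    rw [sum_copyRate_inl_mul]
    have e : nbrAvg G (fun w => meanSpin G θ (alternating V₁) s w
        - Real.exp (-(2 - θ) * s) * spin (alternating V₁ w)) v
        = nbrAvg G (meanSpin G θ (alternating V₁) s) v
          + Real.exp (-(2 - θ) * s) * spin (alternating V₁ v) := by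
      have hd := (h.degree_pos v).ne'
      unfold nbrAvg
      rw [Finset.sum_sub_distrib, Finset.sum_congr rfl
        (fun w hw => by rw [hflip v w ((G.mem_neighborFinset v w).1 hw)] :
          ∀ w ∈ G.neighborFinset v, Real.exp (-(2 - θ) * s) * spin (alternating V₁ w)
            = Real.exp (-(2 - θ) * s) * -spin (alternating V₁ v)), Finset.sum_const,
        SimpleGraph.card_neighborFinset_eq_degree, nsmul_eq_mul]
      field_simp
      ring
    rw [e]
    simp only [id, mul_one]
    ring
  have h4 := eq_evolve_of_deriv key t
  have h5 : (fun v => evolve (noisyVoterGenerator G 2 θ) 0 (fun x => spin (x v)) (alternating V₁)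
      - Real.exp (-(2 - θ) * 0) * spin (alternating V₁ v)) = fun _ => 0 := by
    funext v
    simp [evolve_zero]
  rw [h5] at h4
  have h6 := congrFun h4 v
  have h7 : evolve (jumpMatrix (κ := V) (fun _ => (1 : ℝ)) (fun u w => copyRate G θ u (Sum.inl w))
      (fun _ w => w)) t (fun _ => 0) v = 0 := by simp [evolve]
  rw [h7] at h6
  exact sub_eq_zero.1 h6

/-- From the alternating state all correlations converge at least at the rate
`min (2 - θ) (2 θ)`. -/
theorem abs_corrGap_le (h : Admissible G θ) {V₁ : Set V} (hb : G.IsBipartiteWith V₁ V₁ᶜ)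
    {t : ℝ} (ht : 0 ≤ t) (A : Finset V) :
    |corrGap G θ (alternating V₁) t A| ≤ 2 * Real.exp (-(min (2 - θ) (2 * θ)) * t) := by
  set m := min (2 - θ) (2 * θ)
  set x := alternating V₁
  have hθ := sub_nonneg.2 h.le_one
  -- The true system would relax singletons only at rate θ. From the alternating state the singleton
  -- gaps are known exactly, so their equations may be replaced by pure damping at rate 2-θ, and the
  -- gap of ∅ is 0. Only sets of at least two vertices keep the true equations.
  set M : Matrix (Finset V) (Finset V) ℝ := jumpMatrix (κ := V × V)
    (fun A => if 2 ≤ A.card then (A.card : ℝ) else 2 - θ)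
    (fun A p => if 2 ≤ A.card ∧ p.1 ∈ A then copyRate G θ p.1 (Sum.inl p.2) else 0)
    (fun A p => symmDiff (A.erase p.1) {p.2}) with hMdef
  have hM : IsMetzler M := isMetzler_jumpMatrix fun A p => by
    split_ifs
    · exact h.copyRate_nonneg _ _
    · exact le_rfl
  have hact : ∀ (f : Finset V → ℝ) (A : Finset V), act M f A = if 2 ≤ A.card then
      ∑ u ∈ A, ∑ w, copyRate G θ u (Sum.inl w) * f (symmDiff (A.erase u) {w}) - A.card * f A
      else -(2 - θ) * f A := by
    intro f A
    rw [hMdef, act_jumpMatrix, Fintype.sum_prod_type]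
    by_cases hA : 2 ≤ A.card
    · simp only [hA, true_and, if_true]
      congr 1
      rw [← Finset.sum_subset (Finset.subset_univ A)]
      · refine Finset.sum_congr rfl fun u hu => ?_
        simp only [hu, if_true]
      · intro u _ hu
        simp [hu]
    · simp [hA]; ring
  have hempty : ∀ t, corrGap G θ x t ∅ = 0 := by
    intro t
    have e1 : spinProd (∅ : Finset V) = fun _ => 1 := by funext y; simp [spinProd]
    rw [corrGap, e1, h.isRate.evolve_const]
    simp [h.isStationary.sum_eq_one]
  have hsingle : ∀ t v, corrGap G θ x t {v} = Real.exp (-(2 - θ) * t) * spin (x v) := by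
    intro t v
    have e1 : spinProd ({v} : Finset V) = fun y => spin (y v) := by funext y; simp [spinProd]
    rw [corrGap, e1, stationary_mean_spin h, sub_zero, ← meanSpin_alternating h hb]
    rfl
  have hder : ∀ t A, HasDerivAt (fun s => corrGap G θ x s A) (act M (corrGap G θ x t) A) t := by
    intro t A
    rw [hact]
    by_cases hA : 2 ≤ A.card
    · rw [if_pos hA]; exact hasDerivAt_corrGap h x t A
    · rw [if_neg hA]
      rcases Nat.lt_or_ge A.card 1 with h0 | h1
      · have : A = ∅ := Finset.card_eq_zero.1 (by omega)
        subst this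
        simp only [hempty, mul_zero]
        exact hasDerivAt_const _ _
      · obtain ⟨v, rfl⟩ := Finset.card_eq_one.1 (by omega : A.card = 1)
        simp only [hsingle]
        have h2 := (((hasDerivAt_id t).const_mul (-(2 - θ))).exp).mul_const (spin (x v))
        refine HasDerivAt.congr_deriv h2 (Eq.symm ?_)
        simp only [id, mul_one]; ring
  have hm1 : m ≤ 2 - θ := min_le_left _ _
  have hm2 : m ≤ 2 * θ := min_le_right _ _
  -- A supersolution of both signs: sets of size at least 2 are damped at net rate |A|θ ≥ 2θ,
  -- singletons at 2-θ, and gaps are at most 2 initially. Its value 0 at ∅ matches the vanishing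
  -- gap.
  set Y : ℝ → Finset V → ℝ := fun t A => if A = ∅ then 0 else 2 * Real.exp (-m * t) with hY
  have hYder : ∀ t A, HasDerivAt (fun s => Y s A) (-m * Y t A) t := by
    intro t A
    simp only [hY]
    split_ifs
    · simpa using hasDerivAt_const t (0 : ℝ)
    · have h2 := (((hasDerivAt_id t).const_mul (-m)).exp).const_mul 2
      refine HasDerivAt.congr_deriv h2 (Eq.symm ?_)
      simp only [id, mul_one]; ring
  have hYle : ∀ t A, Y t A ≤ 2 * Real.exp (-m * t) := by
    intro t A
    simp only [hY]; split_ifs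
    · positivity
    · exact le_rfl
  have hY0 : ∀ t A, 0 ≤ Y t A := by
    intro t A
    simp only [hY]; split_ifs
    · exact le_rfl
    · positivity
  have hsuper : ∀ t, 0 ≤ t → ∀ A, act M (Y t) A ≤ -m * Y t A := by
    intro t _ A
    rw [hact]
    split_ifs with hA
    · have hne : A ≠ ∅ := by rintro rfl; simp at hA
      have hYA : Y t A = 2 * Real.exp (-m * t) := if_neg hne
      have h1 : ∀ u ∈ A, ∑ w, copyRate G θ u (Sum.inl w) * Y t (symmDiff (A.erase u) {w})
          ≤ (1 - θ) * Y t A := by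
        intro u _
        rw [sum_copyRate_inl_mul]
        refine mul_le_mul_of_nonneg_left (nbrAvg_le_of_le h fun w _ => ?_) hθ
        rw [hYA]; exact hYle _ _
      have h2 := Finset.sum_le_sum h1
      rw [Finset.sum_const, nsmul_eq_mul] at h2
      have h3 : (2 : ℝ) ≤ A.card := by exact_mod_cast hA
      have h4 : m * Y t A ≤ A.card * θ * Y t A := by
        refine mul_le_mul_of_nonneg_right ?_ (hY0 _ _)
        have := mul_le_mul_of_nonneg_right h3 h.pos.le
        linarith
      linarith
    · have := mul_le_mul_of_nonneg_right hm1 (hY0 t A)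
      linarith
  have hinit : ∀ A, |corrGap G θ x 0 A| ≤ Y 0 A := by
    intro A
    by_cases hA : A = ∅
    · subst hA; rw [hempty]; simp [hY]
    · have e1 : Y 0 A = 2 := by simp [hY, hA]
      rw [e1, corrGap]
      have h1 := h.isRate.abs_evolve_le le_rfl (fun y => (abs_spinProd A y).le) x
      have h2 : |∑ y, noisyVoterStationary G 2 θ y * spinProd A y| ≤ 1 := by
        refine (Finset.abs_sum_le_sum_abs _ _).trans (le_of_eq ?_)
        simp only [abs_mul, abs_spinProd, mul_one]
        rw [← h.isStationary.sum_eq_one]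
        exact Finset.sum_congr rfl fun y _ => abs_of_nonneg (h.isStationary.nonneg y)
      have h3 := abs_sub (evolve (noisyVoterGenerator G 2 θ) 0 (spinProd A) x)
        (∑ y, noisyVoterStationary G 2 θ y * spinProd A y)
      linarith
  have hneg : ∀ (f : Finset V → ℝ) A, act M (fun B => -f B) A = -act M f A := by
    intro f A
    simp [act]
  refine (abs_le.2 ⟨?_, ?_⟩ : |corrGap G θ x t A| ≤ Y t A).trans (hYle t A)
  · have := hM.le_of_deriv (y := fun t A => -corrGap G θ x t A) (fun t A => (hder t A).neg) hYder
      (fun t _ A => (hneg _ A).ge) hsuper (fun A => (neg_le_abs _).trans (hinit A)) ht A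
    linarith
  · exact hM.le_of_deriv hder hYder (fun _ _ _ => le_rfl) hsuper
      (fun A => (le_abs_self _).trans (hinit A)) ht A

end Monomials

end Correlations

/-! ### Marginals on small sets -/

section Marginals

variable {V : Type*} [Fintype V] [DecidableEq V] {G : SimpleGraph V} [DecidableRel G.Adj] {θ : ℝ}

/-- Indicator of the event that `x` agrees with `y` on `C`. -/
def agree (C : Finset V) (y x : V → Fin 2) : ℝ := if ∀ v ∈ C, x v = y v then 1 else 0

theorem agree_nonneg (C : Finset V) (y x : V → Fin 2) : 0 ≤ agree C y x := by
  unfold agree; split_ifs <;> norm_num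

theorem agree_comm (C : Finset V) (y x : V → Fin 2) : agree C y x = agree C x y := by
  simp only [agree, eq_comm]

theorem agree_eq_prod (C : Finset V) (y x : V → Fin 2) :
    agree C y x = ∏ v ∈ C, if x v = y v then 1 else 0 := by
  rw [Finset.prod_ite_zero, Finset.prod_const_one, agree]
  congr

theorem one_add_spin_mul_spin (i j : Fin 2) :
    (1 + spin i * spin j) = 2 * if j = i then 1 else 0 := by
  fin_cases i <;> fin_cases j <;> norm_num [spin]

/-- Walsh expansion: each factor of the indicator is (1 + spin(y v) spin(x v))/2. -/
theorem agree_eq_sum (C : Finset V) (y x : V → Fin 2) :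
    agree C y x = (1 / 2) ^ C.card * ∑ A ∈ C.powerset, spinProd A y * spinProd A x := by
  have h1 : ∑ A ∈ C.powerset, spinProd A y * spinProd A x
      = ∏ v ∈ C, (1 + spin (y v) * spin (x v)) := by
    rw [Finset.prod_one_add]
    refine Finset.sum_congr rfl fun A _ => ?_
    rw [Finset.prod_mul_distrib]; rfl
  rw [h1]
  simp only [one_add_spin_mul_spin]
  rw [Finset.prod_mul_distrib, Finset.prod_const, ← mul_assoc, ← mul_pow, ← agree_eq_prod]
  norm_num

/-- The probability under `ν` of agreeing with `y` on `C`. -/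
def marginal (ν : (V → Fin 2) → ℝ) (C : Finset V) (y : V → Fin 2) : ℝ := ∑ x, ν x * agree C y x

theorem marginal_congr (ν : (V → Fin 2) → ℝ) {C : Finset V} {y y' : V → Fin 2}
    (h : ∀ v ∈ C, y v = y' v) : marginal ν C y = marginal ν C y' := by
  refine Finset.sum_congr rfl fun x _ => ?_
  have : agree C y x = agree C y' x := by
    unfold agree
    refine if_congr ⟨fun h' v hv => (h' v hv).trans (h v hv),
      fun h' v hv => (h' v hv).trans (h v hv).symm⟩ rfl rfl
  rw [this]

/-- Noise at any u ∈ C sets the prescribed value with probability θ/2 whatever the neighbours do.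
Stationarity of the indicator then bounds the marginal below, after averaging over u ∈ C, by θ/2
times the marginals with one vertex removed. -/
theorem le_marginal_stationary (h : Admissible G θ) (C : Finset V) (y : V → Fin 2) :
    (θ / 2) ^ C.card ≤ marginal (noisyVoterStationary G 2 θ) C y := by
  set μ := noisyVoterStationary G 2 θ
  have hθ := h.pos
  induction hn : C.card generalizing C with
  | zero =>
    have : C = ∅ := Finset.card_eq_zero.1 hn
    subst this
    simp [marginal, agree, μ, h.isStationary.sum_eq_one]
  | succ n ih =>
    have hpt : ∀ x, ∑ u ∈ C, (θ / 2 * agree (C.erase u) y x - agree C y x)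
        ≤ act (noisyVoterGenerator G 2 θ) (agree C y) x := by
      intro x
      rw [act_noisyVoter, ← Finset.sum_subset (Finset.subset_univ C)]
      · refine Finset.sum_le_sum fun u hu => sub_le_sub_right ?_ _
        have h1 := Finset.single_le_sum
          (f := fun d => copyRate G θ u d * agree C y (Function.update x u (readOff x d)))
          (fun d _ => mul_nonneg (h.copyRate_nonneg u d) (agree_nonneg _ _ _))
          (Finset.mem_univ (Sum.inr (y u)))
        refine le_trans (le_of_eq ?_) h1
        simp only [copyRate, readOff, Sum.elim_inr, id]
        congr 1
        unfold agree
        refine if_congr ⟨fun h' v hv => ?_, fun h' v hv => ?_⟩ rfl rfl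
        · by_cases hvu : v = u
          · subst hvu; rw [Function.update_self]
          · rw [Function.update_of_ne hvu]; exact h' v (Finset.mem_erase.2 ⟨hvu, hv⟩)
        · have := h' v (Finset.mem_of_mem_erase hv)
          rwa [Function.update_of_ne (Finset.ne_of_mem_erase hv)] at this
      · intro u _ hu
        have : ∀ j, agree C y (Function.update x u j) = agree C y x := by
          intro j
          unfold agree
          refine if_congr (forall₂_congr fun v hv => ?_) rfl rfl
          rw [Function.update_of_ne (ne_of_mem_of_not_mem hv hu)]
        simp only [this, ← Finset.sum_mul, h.sum_copyRate, one_mul, sub_self]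
    have h0 := h.isStationary.sum_mul_act (agree C y)
    have h1 : ∑ x, μ x * ∑ u ∈ C, (θ / 2 * agree (C.erase u) y x - agree C y x) ≤ 0 := by
      rw [← h0]
      exact Finset.sum_le_sum fun x _ =>
        mul_le_mul_of_nonneg_left (hpt x) (h.isStationary.nonneg x)
    have h2 : ∑ x, μ x * ∑ u ∈ C, (θ / 2 * agree (C.erase u) y x - agree C y x)
        = ∑ u ∈ C, (θ / 2 * marginal μ (C.erase u) y - marginal μ C y) := by
      simp only [marginal, Finset.mul_sum, ← Finset.sum_sub_distrib]
      rw [Finset.sum_comm]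
      exact Finset.sum_congr rfl fun u _ => Finset.sum_congr rfl fun x _ => by ring
    rw [h2] at h1
    have h3 : ∑ u ∈ C, ((θ / 2) ^ (n + 1) - marginal μ C y)
        ≤ ∑ u ∈ C, (θ / 2 * marginal μ (C.erase u) y - marginal μ C y) := by
      refine Finset.sum_le_sum fun u hu => sub_le_sub_right ?_ _
      rw [pow_succ, mul_comm]
      refine mul_le_mul_of_nonneg_left (ih _ ?_) (by positivity)
      rw [Finset.card_erase_of_mem hu, hn]; rfl
    rw [Finset.sum_const, nsmul_eq_mul, hn] at h3
    have h4 : ((n + 1 : ℕ) : ℝ) * ((θ / 2) ^ (n + 1) - marginal μ C y) ≤ 0 := h3.trans h1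
    have h5 : (0 : ℝ) < ((n + 1 : ℕ) : ℝ) := by positivity
    by_contra hlt
    push Not at hlt
    have := mul_pos h5 (sub_pos.2 hlt)
    linarith

/-- The normalization 2^{-|C|} of the Walsh expansion cancels the number 2^{|C|} of coefficients, so
the bound is uniform in `C`. -/
theorem abs_marginal_sub_le (h : Admissible G θ) {V₁ : Set V} (hb : G.IsBipartiteWith V₁ V₁ᶜ)
    {t : ℝ} (ht : 0 ≤ t) (C : Finset V) (y : V → Fin 2) :
    |marginal (law (noisyVoterGenerator G 2 θ) (alternating V₁) t) C y
      - marginal (noisyVoterStationary G 2 θ) C y|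
      ≤ 2 * Real.exp (-(min (2 - θ) (2 * θ)) * t) := by
  have h1 : ∀ ν : (V → Fin 2) → ℝ, marginal ν C y
      = (1 / 2) ^ C.card * ∑ A ∈ C.powerset, spinProd A y * ∑ x, ν x * spinProd A x := by
    intro ν
    simp only [marginal, agree_eq_sum, Finset.mul_sum]
    rw [Finset.sum_comm]
    exact Finset.sum_congr rfl fun A _ => Finset.sum_congr rfl fun x _ => by ring
  rw [h1, h1, ← mul_sub, ← Finset.sum_sub_distrib]
  simp only [← mul_sub, sum_law_mul]
  rw [abs_mul, abs_of_pos (by positivity)]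
  have h2 : |∑ A ∈ C.powerset, spinProd A y * (evolve (noisyVoterGenerator G 2 θ) t (spinProd A)
      (alternating V₁) - ∑ x, noisyVoterStationary G 2 θ x * spinProd A x)|
      ≤ ∑ A ∈ C.powerset, 2 * Real.exp (-(min (2 - θ) (2 * θ)) * t) := by
    refine (Finset.abs_sum_le_sum_abs _ _).trans (Finset.sum_le_sum fun A _ => ?_)
    rw [abs_mul, abs_spinProd, one_mul]
    exact abs_corrGap_le h hb ht A
  rw [Finset.sum_const, Finset.card_powerset, nsmul_eq_mul] at h2
  refine (mul_le_mul_of_nonneg_left h2 (by positivity)).trans (le_of_eq ?_)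
  rw [← mul_assoc]
  push_cast
  rw [← mul_pow]
  norm_num

/-- `r` is a likelihood ratio of `ν` with respect to `μ` for observables on `C`. -/
def IsRatioOn (ν μ : (V → Fin 2) → ℝ) (C : Finset V) (r : (V → Fin 2) → ℝ) : Prop :=
  ∀ H : (V → Fin 2) → ℝ, DependsOn H (C : Set V) → ∑ x, ν x * H x = ∑ x, μ x * (r x * H x)

/-- The quotient of the marginals on `C` is a likelihood ratio with |r - 1| ≤ a/b pointwise; as r
has mean 1, its second moment is 1 + E(r-1)². -/
theorem exists_isRatioOn {ν μ : (V → Fin 2) → ℝ} (hν1 : ∑ x, ν x = 1) (hμ0 : ∀ x, 0 ≤ μ x)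
    (hμ1 : ∑ x, μ x = 1) (C : Finset V) {a b : ℝ} (hb : 0 < b) (hlow : ∀ y, b ≤ marginal μ C y)
    (hdiff : ∀ y, |marginal ν C y - marginal μ C y| ≤ a) :
    ∃ r, IsRatioOn ν μ C r ∧ ∑ x, μ x * r x ^ 2 ≤ 1 + (a / b) ^ 2 := by
  have hpos : ∀ y, 0 < marginal μ C y := fun y => hb.trans_le (hlow y)
  set r : (V → Fin 2) → ℝ := fun x => marginal ν C x / marginal μ C x with hr
  have hratio : IsRatioOn ν μ C r := by
    intro H hH
    have h1 : ∀ x, μ x * (r x * H x)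
        = ∑ x', ν x' * (μ x * agree C x' x * (H x' / marginal μ C x')) := by
      intro x
      have : r x = ∑ x', ν x' * agree C x x' / marginal μ C x := by
        rw [hr]; simp only [marginal, Finset.sum_div]
      rw [this, Finset.sum_mul, Finset.mul_sum]
      refine Finset.sum_congr rfl fun x' _ => ?_
      rw [agree_comm C x' x]
      by_cases hag : ∀ v ∈ C, x' v = x v
      · rw [hH (fun v hv => hag v hv), marginal_congr μ hag]; ring
      · rw [show agree C x x' = 0 from if_neg hag]; ring
    simp only [h1]
    rw [Finset.sum_comm]
    refine Finset.sum_congr rfl fun x' _ => ?_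
    rw [← Finset.mul_sum, ← Finset.sum_mul]
    change _ = ν x' * (marginal μ C x' * (H x' / marginal μ C x'))
    rw [mul_div_cancel₀ _ (hpos x').ne']
  refine ⟨r, hratio, ?_⟩
  have h1 : ∑ x, μ x * r x = 1 := by
    have := hratio (fun _ => 1) (fun _ _ _ => rfl)
    simpa [hν1] using this.symm
  have h2 : ∑ x, μ x * (r x - 1) ^ 2 ≤ (a / b) ^ 2 := by
    calc ∑ x, μ x * (r x - 1) ^ 2 ≤ ∑ x, μ x * (a / b) ^ 2 := by
          refine Finset.sum_le_sum fun x _ => mul_le_mul_of_nonneg_left ?_ (hμ0 x)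
          have e : r x - 1 = (marginal ν C x - marginal μ C x) / marginal μ C x := by
            rw [hr]; field_simp [(hpos x).ne']
          rw [← sq_abs, e, abs_div, abs_of_pos (hpos x)]
          exact pow_le_pow_left₀ (div_nonneg (abs_nonneg _) (hpos x).le)
            (div_le_div₀ ((abs_nonneg _).trans (hdiff x)) (hdiff x) hb (hlow x)) 2
      _ = (a / b) ^ 2 := by rw [← Finset.sum_mul, hμ1, one_mul]
  have h3 : ∑ x, μ x * (r x - 1) ^ 2 = ∑ x, μ x * r x ^ 2 - 2 * ∑ x, μ x * r x + ∑ x, μ x := by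
    rw [Finset.mul_sum, ← Finset.sum_sub_distrib, ← Finset.sum_add_distrib]
    exact Finset.sum_congr rfl fun x _ => by ring
  rw [h1, hμ1] at h3
  linarith

end Marginals

/-! ### Approximation by products over clusters -/

section Product

variable {V : Type u} [Fintype V] [DecidableEq V] {G : SimpleGraph V} [DecidableRel G.Adj] {θ : ℝ}

/-- On observables of `W`, up to the error `e` per vertex, `μ` is the image of a probability vector
`p` and `ν` is the image of `p r`, with a bound on the second moment of `r`. -/
def HasProductApprox (ν μ : (V → Fin 2) → ℝ) (W : Finset V) (e χ : ℝ) : Prop :=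
  ∃ (Ω : Type u) (_ : Fintype Ω) (φ : Ω → V → Fin 2) (p r : Ω → ℝ), (∀ ω, 0 ≤ p ω) ∧
    ∑ ω, p ω = 1 ∧ ∑ ω, p ω * r ω = 1 ∧ ∑ ω, p ω * r ω ^ 2 ≤ (1 + χ) ^ W.card ∧
    ∀ H : (V → Fin 2) → ℝ, DependsOn H (W : Set V) → (∀ x, |H x| ≤ 1) →
      |∑ x, ν x * H x - ∑ ω, p ω * (r ω * H (φ ω))| ≤ W.card * e ∧
      |∑ x, μ x * H x - ∑ ω, p ω * H (φ ω)| ≤ W.card * e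

theorem hasProductApprox_empty {ν μ : (V → Fin 2) → ℝ} (hν1 : ∑ x, ν x = 1) (hμ1 : ∑ x, μ x = 1)
    (e χ : ℝ) : HasProductApprox ν μ ∅ e χ := by
  refine ⟨PUnit, inferInstance, fun _ _ => 0, fun _ => 1, fun _ => 1, by simp, by simp, by simp,
    by simp, fun H hH _ => ?_⟩
  have h1 : ∀ x, H x = H fun _ => 0 := fun x => hH (fun v hv => by simp at hv)
  have h2 : ∀ ν : (V → Fin 2) → ℝ, ∑ x, ν x = 1 → ∑ x, ν x * H x = H fun _ => 0 := by
    intro ν hν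
    rw [Finset.sum_congr rfl fun x _ => by rw [h1 x], ← Finset.sum_mul, hν, one_mul]
  rw [h2 ν hν1, h2 μ hμ1]
  simp

/-- Splitting off a cluster from a measure with decaying correlations. -/
theorem Decoupled.split {ν : (V → Fin 2) → ℝ} (hν : Decoupled G θ ν) {C W : Finset V}
    {e c : ℝ} (hov : ∑ a ∈ C, ∑ b ∈ W, overlap G θ a b ≤ e)
    {Ω : Type u} [Fintype Ω] {φ : Ω → V → Fin 2} {q : Ω → ℝ}
    (hq : ∀ H : (V → Fin 2) → ℝ, DependsOn H (W : Set V) → (∀ x, |H x| ≤ 1) →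
      |∑ x, ν x * H x - ∑ ω, q ω * H (φ ω)| ≤ c)
    {H : (V → Fin 2) → ℝ} (hH : DependsOn H ((C ∪ W : Finset V) : Set V)) (hH1 : ∀ x, |H x| ≤ 1) :
    |∑ x, ν x * H x - ∑ x, ν x * ∑ ω, q ω * H (C.piecewise x (φ ω))| ≤ c + e := by
  -- View `H` as a function of two configurations, one read on `C`, the other off `C`; on the
  -- diagonal `piecewise_same` gives back `H`.
  have h1 := hν.decouple C W (fun x x' => H (C.piecewise x x'))
    (fun x' x y hxy => hH fun v _ => by
      by_cases hv : v ∈ C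
      · simp only [Finset.piecewise_eq_of_mem _ _ _ hv]; exact hxy v hv
      · simp only [Finset.piecewise_eq_of_notMem _ _ _ hv])
    (fun x x' y hxy => hH fun v hvW => by
      by_cases hv : v ∈ C
      · simp only [Finset.piecewise_eq_of_mem _ _ _ hv]
      · simp only [Finset.piecewise_eq_of_notMem _ _ _ hv]
        refine hxy v ?_
        rcases Finset.mem_union.1 (Finset.mem_coe.1 hvW) with h | h
        · exact absurd h hv
        · exact h)
    (fun x x' => hH1 _)
  simp only [Finset.piecewise_same] at h1
  have h2 : |∑ x, ∑ x', ν x * (ν x' * H (C.piecewise x x'))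
      - ∑ x, ν x * ∑ ω, q ω * H (C.piecewise x (φ ω))| ≤ c := by
    simp only [← Finset.mul_sum]
    rw [← Finset.sum_sub_distrib]
    simp only [← mul_sub]
    refine (Finset.abs_sum_le_sum_abs _ _).trans ?_
    calc _ ≤ ∑ x, ν x * c := by
          refine Finset.sum_le_sum fun x _ => ?_
          rw [abs_mul, abs_of_nonneg (hν.nonneg x)]
          refine mul_le_mul_of_nonneg_left ?_ (hν.nonneg x)
          refine hq (fun x' => H (C.piecewise x x')) (fun x' y hxy => hH fun v hvW => ?_)
            (fun _ => hH1 _)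
          by_cases hv : v ∈ C
          · simp only [Finset.piecewise_eq_of_mem _ _ _ hv]
          · simp only [Finset.piecewise_eq_of_notMem _ _ _ hv]
            refine hxy v ?_
            rcases Finset.mem_union.1 (Finset.mem_coe.1 hvW) with h | h
            · exact absurd h hv
            · exact h
      _ = c := by rw [← Finset.sum_mul, hν.sum_eq_one, one_mul]
  have h3 := abs_sub_le (∑ x, ν x * H x) (∑ x, ∑ x', ν x * (ν x' * H (C.piecewise x x')))
    (∑ x, ν x * ∑ ω, q ω * H (C.piecewise x (φ ω)))
  linarith

/-- The cluster is adjoined as an independent factor: likelihood ratios multiply, so second moments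
do too, and both the decoupling error and the factor 1 + χ are charged to one of the vertices of the
nonempty `C`. An auxiliary product space is used because configurations themselves are only
approximately independent. -/
theorem HasProductApprox.union {ν μ : (V → Fin 2) → ℝ} (hν : Decoupled G θ ν)
    (hμ : Decoupled G θ μ) {C W : Finset V} (hdisj : Disjoint C W) (hC : C.Nonempty) {e χ : ℝ}
    (hov : ∑ a ∈ C, ∑ b ∈ W, overlap G θ a b ≤ e) (he : 0 ≤ e) (hχ : 0 ≤ χ)
    {r : (V → Fin 2) → ℝ} (hr : IsRatioOn ν μ C r) (hr2 : ∑ x, μ x * r x ^ 2 ≤ 1 + χ)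
    (hW : HasProductApprox ν μ W e χ) : HasProductApprox ν μ (C ∪ W) e χ := by
  obtain ⟨Ω, _, φ, p, s, hp0, hp1, hps, hps2, hH⟩ := hW
  have hr1 : ∑ x, μ x * r x = 1 := by
    have := hr (fun _ => 1) (fun _ _ _ => rfl)
    simpa [hν.sum_eq_one] using this.symm
  have hcard : W.card + 1 ≤ (C ∪ W).card := by
    rw [Finset.card_union_of_disjoint hdisj]
    have := hC.card_pos
    omega
  have hcard' : (W.card : ℝ) * e + e ≤ (C ∪ W).card * e := by
    have : ((W.card : ℝ) + 1) ≤ (C ∪ W).card := by exact_mod_cast hcard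
    nlinarith
  have hprod : ∀ (f : (V → Fin 2) → ℝ) (g : Ω → ℝ),
      ∑ ω : (V → Fin 2) × Ω, μ ω.1 * p ω.2 * (f ω.1 * g ω.2)
        = (∑ x, μ x * f x) * ∑ ω, p ω * g ω := by
    intro f g
    rw [Fintype.sum_prod_type, Finset.sum_mul]
    refine Finset.sum_congr rfl fun x _ => ?_
    rw [Finset.mul_sum]
    exact Finset.sum_congr rfl fun ω _ => by ring
  refine ⟨(V → Fin 2) × Ω, inferInstance, fun ω => C.piecewise ω.1 (φ ω.2),
    fun ω => μ ω.1 * p ω.2, fun ω => r ω.1 * s ω.2,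
    fun ω => mul_nonneg (hμ.nonneg _) (hp0 _), ?_, ?_, ?_, ?_⟩
  · have := hprod (fun _ => 1) (fun _ => 1)
    simpa [hμ.sum_eq_one, hp1] using this
  · rw [hprod, hr1, hps, one_mul]
  · simp only [mul_pow]
    rw [hprod (fun x => r x ^ 2) fun ω => s ω ^ 2]
    calc _ ≤ (1 + χ) * (1 + χ) ^ W.card :=
          mul_le_mul hr2 hps2 (Finset.sum_nonneg fun ω _ => mul_nonneg (hp0 ω) (sq_nonneg _))
            (by linarith)
      _ = (1 + χ) ^ (W.card + 1) := by ring
      _ ≤ _ := pow_le_pow_right₀ (by linarith) hcard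
  · intro H hHd hH1
    constructor
    · have h1 := hν.split hov (q := fun ω => p ω * s ω)
        (fun H hd h1 => by simpa only [mul_assoc] using (hH H hd h1).1) hHd hH1
      have h2 : ∑ x, ν x * ∑ ω, p ω * s ω * H (C.piecewise x (φ ω))
          = ∑ ω : (V → Fin 2) × Ω, μ ω.1 * p ω.2 * (r ω.1 * s ω.2
            * H (C.piecewise ω.1 (φ ω.2))) := by
        rw [hr (fun x => ∑ ω, p ω * s ω * H (C.piecewise x (φ ω))) (fun x y hxy => by
          refine Finset.sum_congr rfl fun ω _ => ?_
          congr 2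
          funext v
          by_cases hv : v ∈ C
          · simp only [Finset.piecewise_eq_of_mem _ _ _ hv]; exact hxy v hv
          · simp only [Finset.piecewise_eq_of_notMem _ _ _ hv]), Fintype.sum_prod_type]
        refine Finset.sum_congr rfl fun x _ => ?_
        rw [Finset.mul_sum, Finset.mul_sum]
        exact Finset.sum_congr rfl fun ω _ => by ring
      rw [h2] at h1
      exact h1.trans hcard'
    · have h1 := hμ.split hov (q := p) (fun H hd h1 => (hH H hd h1).2) hHd hH1
      have h2 : ∑ x, μ x * ∑ ω, p ω * H (C.piecewise x (φ ω))
          = ∑ ω : (V → Fin 2) × Ω, μ ω.1 * p ω.2 * H (C.piecewise ω.1 (φ ω.2)) := by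
        rw [Fintype.sum_prod_type]
        refine Finset.sum_congr rfl fun x _ => ?_
        rw [Finset.mul_sum]
        exact Finset.sum_congr rfl fun ω _ => by ring
      rw [h2] at h1
      exact h1.trans hcard'

/-- Uses |r - 1| ≤ η + (r-1)²/η, and that E(r-1)² = E r² - 1 since E r = 1. -/
theorem HasProductApprox.abs_sum_sub_sum_le {ν μ : (V → Fin 2) → ℝ} {W : Finset V} {e χ η : ℝ}
    (hW : HasProductApprox ν μ W e χ) (hη : 0 < η) {H : (V → Fin 2) → ℝ}
    (hH : DependsOn H (W : Set V)) (hH1 : ∀ x, |H x| ≤ 1) :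
    |∑ x, ν x * H x - ∑ x, μ x * H x| ≤ 2 * (W.card * e) + (η + ((1 + χ) ^ W.card - 1) / η) := by
  obtain ⟨Ω, _, φ, p, r, hp0, hp1, hpr, hpr2, happ⟩ := hW
  obtain ⟨h1, h2⟩ := happ H hH hH1
  have h3 : |∑ ω, p ω * (r ω * H (φ ω)) - ∑ ω, p ω * H (φ ω)|
      ≤ η + ((1 + χ) ^ W.card - 1) / η := by
    rw [← Finset.sum_sub_distrib]
    have hsq : ∑ ω, p ω * (r ω - 1) ^ 2 ≤ (1 + χ) ^ W.card - 1 := by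
      have : ∑ ω, p ω * (r ω - 1) ^ 2
          = ∑ ω, p ω * r ω ^ 2 - 2 * ∑ ω, p ω * r ω + ∑ ω, p ω := by
        rw [Finset.mul_sum, ← Finset.sum_sub_distrib, ← Finset.sum_add_distrib]
        exact Finset.sum_congr rfl fun x _ => by ring
      rw [this, hpr, hp1]
      linarith
    calc |∑ ω, (p ω * (r ω * H (φ ω)) - p ω * H (φ ω))|
        ≤ ∑ ω, p ω * (η + (r ω - 1) ^ 2 / η) := by
          refine (Finset.abs_sum_le_sum_abs _ _).trans (Finset.sum_le_sum fun ω _ => ?_)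
          have e1 : p ω * (r ω * H (φ ω)) - p ω * H (φ ω) = p ω * ((r ω - 1) * H (φ ω)) := by ring
          rw [e1, abs_mul, abs_of_nonneg (hp0 ω)]
          refine mul_le_mul_of_nonneg_left ?_ (hp0 ω)
          rw [abs_mul]
          refine (mul_le_of_le_one_right (abs_nonneg _) (hH1 _)).trans ?_
          have e2 : η + (r ω - 1) ^ 2 / η = (η ^ 2 + |r ω - 1| ^ 2) / η := by
            rw [sq_abs]; field_simp
          rw [e2, le_div_iff₀ hη]
          nlinarith [sq_nonneg (η - |r ω - 1|), abs_nonneg (r ω - 1)]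
      _ = η + (∑ ω, p ω * (r ω - 1) ^ 2) / η := by
          simp only [mul_add, Finset.sum_add_distrib, ← Finset.sum_mul, hp1, one_mul,
            mul_div_assoc', Finset.sum_div]
      _ ≤ _ := by gcongr
  have h4 := abs_sub_le (∑ x, ν x * H x) (∑ ω, p ω * (r ω * H (φ ω))) (∑ x, μ x * H x)
  have h5 := abs_sub_le (∑ ω, p ω * (r ω * H (φ ω))) (∑ ω, p ω * H (φ ω)) (∑ x, μ x * H x)
  rw [abs_sub_comm (∑ ω, p ω * H (φ ω))] at h5
  linarith

/-- Sets of `k + 1` vertices obtained by successively adding vertices at distance at most `R` from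
an earlier one. -/
def chains (G : SimpleGraph V) (R : ℕ) : ℕ → Finset (Finset V)
  | 0 => Finset.univ.image singleton
  | k + 1 => (chains G R k).biUnion fun A =>
      (Finset.univ.filter fun u => u ∉ A ∧ ∃ a ∈ A, G.dist a u ≤ R).image fun u => insert u A

theorem card_of_mem_chains {R k : ℕ} {A : Finset V} (hA : A ∈ chains G R k) : A.card = k + 1 := by
  induction k generalizing A with
  | zero =>
    obtain ⟨v, -, rfl⟩ := Finset.mem_image.1 hA
    simp
  | succ k ih =>
    obtain ⟨B, hB, hA⟩ := Finset.mem_biUnion.1 hA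
    obtain ⟨u, hu, rfl⟩ := Finset.mem_image.1 hA
    rw [Finset.card_insert_of_notMem (Finset.mem_filter.1 hu).2.1, ih hB]

/-- A chain of k+1 vertices has at most (k+1)D extensions, and k+1 ≤ K at every step. -/
theorem card_chains_le {R : ℕ} {D : ℝ}
    (hD : ∀ v : V, ((Finset.univ.filter fun u => G.dist v u ≤ R).card : ℝ) ≤ D) (hD0 : 0 ≤ D)
    (K : ℕ) {k : ℕ} (hk : k ≤ K) :
    ((chains G R k).card : ℝ) ≤ Fintype.card V * (K * D) ^ k := by
  induction k with
  | zero =>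
    simp only [pow_zero, mul_one]
    exact_mod_cast Finset.card_image_le
  | succ k ih =>
    have h1 := ih (by omega)
    have h2 : ∀ A ∈ chains G R k, (((Finset.univ.filter fun u =>
        u ∉ A ∧ ∃ a ∈ A, G.dist a u ≤ R).image fun u => insert u A).card : ℝ) ≤ K * D := by
      intro A hA
      have h3 : (Finset.univ.filter fun u => u ∉ A ∧ ∃ a ∈ A, G.dist a u ≤ R)
          ⊆ A.biUnion fun a => Finset.univ.filter fun u => G.dist a u ≤ R := by
        intro u hu
        obtain ⟨-, -, a, ha, hau⟩ := Finset.mem_filter.1 hu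
        exact Finset.mem_biUnion.2 ⟨a, ha, Finset.mem_filter.2 ⟨Finset.mem_univ _, hau⟩⟩
      have h4 : ((Finset.univ.filter fun u =>
          u ∉ A ∧ ∃ a ∈ A, G.dist a u ≤ R).image fun u => insert u A).card
          ≤ ∑ a ∈ A, (Finset.univ.filter fun u => G.dist a u ≤ R).card :=
        Finset.card_image_le.trans ((Finset.card_le_card h3).trans Finset.card_biUnion_le)
      calc _ ≤ ((∑ a ∈ A, (Finset.univ.filter fun u => G.dist a u ≤ R).card : ℕ) : ℝ) := by
            exact_mod_cast h4
        _ ≤ ∑ _a ∈ A, D := by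
            push_cast
            exact Finset.sum_le_sum fun a _ => hD a
        _ = (k + 1 : ℕ) * D := by
            rw [Finset.sum_const, nsmul_eq_mul, card_of_mem_chains hA]
        _ ≤ K * D := by gcongr
    calc ((chains G R (k + 1)).card : ℝ)
        ≤ ∑ A ∈ chains G R k, (((Finset.univ.filter fun u =>
          u ∉ A ∧ ∃ a ∈ A, G.dist a u ≤ R).image fun u => insert u A).card : ℝ) := by
          exact_mod_cast Finset.card_biUnion_le
      _ ≤ ∑ _A ∈ chains G R k, K * D := Finset.sum_le_sum h2
      _ = (chains G R k).card * (K * D) := by rw [Finset.sum_const, nsmul_eq_mul]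
      _ ≤ Fintype.card V * (K * D) ^ k * (K * D) := by gcongr
      _ = _ := by ring

/-- A set without long chains is split into small, mutually distant clusters. -/
theorem hasProductApprox_of_chains {ν μ : (V → Fin 2) → ℝ} (hν : Decoupled G θ ν)
    (hμ : Decoupled G θ μ) {R K : ℕ} {e χ : ℝ} (he : 0 ≤ e) (hχ : 0 ≤ χ)
    (hfar : ∀ C W : Finset V, (∀ a ∈ C, ∀ b ∈ W, R < G.dist a b) →
      ∑ a ∈ C, ∑ b ∈ W, overlap G θ a b ≤ e)
    (hratio : ∀ C : Finset V, C.card ≤ K →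
      ∃ r, IsRatioOn ν μ C r ∧ ∑ x, μ x * r x ^ 2 ≤ 1 + χ)
    (W : Finset V) (hW : ∀ A ∈ chains G R K, ¬ A ⊆ W) : HasProductApprox ν μ W e χ := by
  induction W using Finset.strongInductionOn with
  | _ W ih =>
    rcases W.eq_empty_or_nonempty with rfl | ⟨v, hv⟩
    · exact hasProductApprox_empty hν.sum_eq_one hμ.sum_eq_one e χ
    -- Grow a chain inside `W` from `v` until nothing else of `W` lies within distance R. It must
    -- stop with at most K vertices, since a chain of K+1 vertices inside `W` is excluded; it is the
    -- cluster to split off before induction on the rest.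
    obtain ⟨k, hk, C, hC, hCW, hmax⟩ : ∃ k < K, ∃ C ∈ chains G R k, C ⊆ W ∧
        ∀ a ∈ C, ∀ b ∈ W \ C, R < G.dist a b := by
      by_contra hcon
      have hall : ∀ k ≤ K, ∃ C ∈ chains G R k, C ⊆ W := by
        intro k hk
        induction k with
        | zero => exact ⟨{v}, Finset.mem_image.2 ⟨v, Finset.mem_univ v, rfl⟩, by simpa using hv⟩
        | succ k ihk =>
          obtain ⟨C, hC, hCW⟩ := ihk (by omega)
          have : ¬ ∀ a ∈ C, ∀ b ∈ W \ C, R < G.dist a b := fun hfar' =>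
            hcon ⟨k, by omega, C, hC, hCW, hfar'⟩
          push Not at this
          obtain ⟨a, ha, b, hb, hab⟩ := this
          rw [Finset.mem_sdiff] at hb
          refine ⟨insert b C, Finset.mem_biUnion.2 ⟨C, hC, Finset.mem_image.2 ⟨b, ?_, rfl⟩⟩,
            Finset.insert_subset hb.1 hCW⟩
          exact Finset.mem_filter.2 ⟨Finset.mem_univ _, hb.2, a, ha, hab⟩
      obtain ⟨A, hA, hAW⟩ := hall K le_rfl
      exact hW A hA hAW
    have hCcard := card_of_mem_chains hC
    have hCne : C.Nonempty := Finset.card_pos.1 (by omega)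
    obtain ⟨r, hr, hr2⟩ := hratio C (by omega)
    have hlt : W \ C ⊂ W := Finset.sdiff_ssubset hCW hCne
    have := (ih (W \ C) hlt fun A hA hAW => hW A hA (hAW.trans Finset.sdiff_subset)).union hν hμ
      Finset.disjoint_sdiff hCne (hfar C (W \ C) hmax) he hχ hr hr2
    rwa [Finset.union_sdiff_of_subset hCW] at this

end Product

/-! ### Upper bound for the mixing time from the alternating state -/

section UpperBound

variable {V : Type u} [Fintype V] [DecidableEq V] {G : SimpleGraph V} [DecidableRel G.Adj] {θ : ℝ}

/-- Running the dynamics for an additional time `s` reduces the comparison to observables on the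
random set of vertices hit by the dual process. -/
theorem two_mul_tvDist_law_add_le (h : Admissible G θ) {t s : ℝ} (ht : 0 ≤ t) (hs : 0 ≤ s)
    (x : V → Fin 2) (𝒜 : Finset (Finset V)) {g : ℝ} (hg0 : 0 ≤ g)
    (hg : ∀ W : Finset V, (∀ A ∈ 𝒜, ¬ A ⊆ W) → ∀ H : (V → Fin 2) → ℝ, DependsOn H (W : Set V) →
      (∀ x, |H x| ≤ 1) → |∑ y, law (noisyVoterGenerator G 2 θ) x t y * H y
        - ∑ y, noisyVoterStationary G 2 θ y * H y| ≤ g) :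
    2 * tvDist (law (noisyVoterGenerator G 2 θ) x (t + s)) (noisyVoterStationary G 2 θ)
      ≤ g + 2 * ∑ A ∈ 𝒜, dualEv G θ s (occupied A) := by
  set Q := noisyVoterGenerator G 2 θ
  set μ := noisyVoterStationary G 2 θ
  set ν := law Q x t
  obtain ⟨F, hF1, hF⟩ := exists_sum_mul_eq_tvDist (law Q x (t + s)) μ
  rw [hF]
  -- The last stretch of time `s` is turned into a dual expectation that is common to both starting
  -- measures; for a fixed dual path it only remains to compare them on one observable.
  have hswap : ∀ ρ : (V → Fin 2) → ℝ, ∑ y, ρ y * evolve Q s F y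
      = dualEv G θ s (fun ξ => ∑ y, ρ y * F (readOff y ∘ ξ)) := by
    intro ρ
    rw [dualEv_sum]
    refine Finset.sum_congr rfl fun y _ => ?_
    rw [dualEv_const_mul, evolve_eq_dualEv]
  have e1 : ∑ y, law Q x (t + s) y * F y
      = dualEv G θ s (fun ξ => ∑ y, ν y * F (readOff y ∘ ξ)) := by
    rw [sum_law_mul, evolve_add, ← hswap, sum_law_mul]
  have e2 : ∑ y, μ y * F y = dualEv G θ s (fun ξ => ∑ y, μ y * F (readOff y ∘ ξ)) := by
    rw [← hswap, h.isStationary.sum_mul_evolve]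
  simp only [sub_mul, Finset.sum_sub_distrib]
  rw [e1, e2, ← dualEv_sub]
  have e3 : g + 2 * ∑ A ∈ 𝒜, dualEv G θ s (occupied A)
      = dualEv G θ s (fun ξ => g + 2 * ∑ A ∈ 𝒜, occupied A ξ) := by
    rw [dualEv_add, dualEv_const h, dualEv_const_mul, dualEv_sum]
  rw [e3]
  refine dualEv_mono h hs fun ξ => ?_
  set W : Finset V := Finset.univ.filter fun v => ∃ w, ξ w = Sum.inl v with hW
  have hocc0 : ∀ A ∈ 𝒜, 0 ≤ occupied A ξ := fun A _ => occupied_nonneg A ξ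
  -- If no set of the family lies in the surviving range, `hg` applies to an observable of `W`.
  -- Otherwise the trivial bound 2 is charged to an occupied set.
  by_cases hgood : ∀ A ∈ 𝒜, ¬ A ⊆ W
  · have h1 := hg W hgood (fun y => F (readOff y ∘ ξ)) (fun y y' hyy => by
      change F _ = F _
      congr 1
      funext w
      simp only [Function.comp]
      cases hw : ξ w with
      | inl v => exact hyy v (Finset.mem_coe.2 (Finset.mem_filter.2 ⟨Finset.mem_univ _, w, hw⟩))
      | inr j => rfl) (fun y => hF1 _)
    have h2 := Finset.sum_nonneg hocc0
    have h3 := le_abs_self (∑ y, ν y * F (readOff y ∘ ξ) - ∑ y, μ y * F (readOff y ∘ ξ))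
    linarith
  · push Not at hgood
    obtain ⟨A, hA, hAW⟩ := hgood
    have h1 : occupied A ξ = 1 := if_pos fun a ha => (Finset.mem_filter.1 (hAW ha)).2
    have h2 := Finset.single_le_sum hocc0 hA
    rw [h1] at h2
    have h3 : ∀ ρ : (V → Fin 2) → ℝ, (∀ y, 0 ≤ ρ y) → ∑ y, ρ y = 1 →
        |∑ y, ρ y * F (readOff y ∘ ξ)| ≤ 1 := by
      intro ρ h0 h1
      refine (Finset.abs_sum_le_sum_abs _ _).trans ?_
      rw [← h1]
      refine Finset.sum_le_sum fun y _ => ?_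
      rw [abs_mul, abs_of_nonneg (h0 y)]
      exact mul_le_of_le_one_right (h0 y) (hF1 _)
    have h4 := (abs_le.1 (h3 ν (h.isRate.law_nonneg ht x) (h.isRate.sum_law t x))).2
    have h5 := (abs_le.1 (h3 μ h.isStationary.nonneg h.isStationary.sum_eq_one)).1
    linarith

/-- Each term carries (1+θ)^{-(dist a u + dist b u)}, and by the triangle inequality the exponent
exceeds R in size. -/
theorem sum_overlap_le_of_far (h : Admissible G θ) {R : ℕ} {C W : Finset V}
    (hfar : ∀ a ∈ C, ∀ b ∈ W, R < G.dist a b) :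
    ∑ a ∈ C, ∑ b ∈ W, overlap G θ a b
      ≤ 2 / θ ^ 2 * (Fintype.card V : ℝ) ^ 3 * (1 + θ)⁻¹ ^ R := by
  have hθ := h.pos
  have hβ0 : 0 ≤ (1 + θ)⁻¹ := by positivity
  have hβ1 : (1 + θ)⁻¹ ≤ 1 := inv_le_one_of_one_le₀ (by linarith)
  have h1 : ∀ a ∈ C, ∀ b ∈ W,
      overlap G θ a b ≤ 2 / θ ^ 2 * (Fintype.card V * (1 + θ)⁻¹ ^ R) := by
    intro a ha b hb
    unfold overlap
    refine mul_le_mul_of_nonneg_left ?_ (by positivity)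
    calc ∑ u, (1 + θ)⁻¹ ^ G.dist a u * (1 + θ)⁻¹ ^ G.dist b u ≤ ∑ _u : V, (1 + θ)⁻¹ ^ R := by
          refine Finset.sum_le_sum fun u _ => ?_
          rw [← pow_add]
          refine pow_le_pow_of_le_one hβ0 hβ1 ?_
          have := h.connected.dist_triangle (u := a) (v := u) (w := b)
          rw [G.dist_comm (u := u) (v := b)] at this
          exact (hfar a ha b hb).le.trans this
      _ = _ := by rw [Finset.sum_const, nsmul_eq_mul, Finset.card_univ]
  set c := 2 / θ ^ 2 * (Fintype.card V * (1 + θ)⁻¹ ^ R)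
  have hc : 0 ≤ c := by positivity
  calc ∑ a ∈ C, ∑ b ∈ W, overlap G θ a b ≤ ∑ _a ∈ C, ∑ _b ∈ W, c :=
        Finset.sum_le_sum fun a ha => Finset.sum_le_sum fun b hb => h1 a ha b hb
    _ = C.card * (W.card * c) := by simp only [Finset.sum_const, nsmul_eq_mul]
    _ ≤ Fintype.card V * (Fintype.card V * c) := by gcongr <;> exact Finset.card_le_univ _
    _ = _ := by ring

/-- The three terms are the decoupling error between clusters at distance above R, the χ² error of
the product over clusters of at most K vertices, and the probability that the dual range after time
`s` contains a chain of K+1 vertices. -/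
theorem tvDist_alternating_le {α c₀ : ℝ} (h : Admissible G θ) {V₁ : Set V}
    (hb : G.IsBipartiteWith V₁ V₁ᶜ) (hc : 0 < c₀) (hg : SubexpGrowth G c₀ α) {K R : ℕ}
    (hR : 1 ≤ R) {t s η χ D Δ : ℝ} (ht : 0 ≤ t) (hs : 0 ≤ s) (hη : 0 < η)
    (hχ : χ = (2 * Real.exp (-(min (2 - θ) (2 * θ)) * t) / (θ / 2) ^ K) ^ 2)
    (hD : D = c₀ * Real.exp ((R : ℝ) ^ (1 - α))) (hΔ : Δ = c₀ * Real.exp 1) :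
    2 * tvDist (law (noisyVoterGenerator G 2 θ) (alternating V₁) (t + s))
        (noisyVoterStationary G 2 θ)
      ≤ 4 / θ ^ 2 * (Fintype.card V : ℝ) ^ 4 * (1 + θ)⁻¹ ^ R
        + (η + ((1 + χ) ^ Fintype.card V - 1) / η)
        + 2 * (Fintype.card V * (K * D) ^ K * (Δ * Real.exp (-θ * s)) ^ (K + 1)) := by
  have hθ := h.pos
  have hχ0 : 0 ≤ χ := by rw [hχ]; positivity
  have hD0 : 0 ≤ D := by rw [hD]; positivity
  set e := 2 / θ ^ 2 * (Fintype.card V : ℝ) ^ 3 * (1 + θ)⁻¹ ^ R with he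
  have he0 : 0 ≤ e := by positivity
  have happ : ∀ W : Finset V, (∀ A ∈ chains G R K, ¬ A ⊆ W) →
      HasProductApprox (law (noisyVoterGenerator G 2 θ) (alternating V₁) t)
        (noisyVoterStationary G 2 θ) W e χ := by
    refine hasProductApprox_of_chains (h.decoupled_law ht _) h.decoupled_stationary he0 hχ0
      (fun C W hfar => sum_overlap_le_of_far h hfar) (fun C hC => ?_)
    rw [hχ]
    refine exists_isRatioOn (h.isRate.sum_law t _) h.isStationary.nonneg
      h.isStationary.sum_eq_one C (by positivity) (fun y => ?_) (abs_marginal_sub_le h hb ht C)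
    refine le_trans ?_ (le_marginal_stationary h C y)
    exact pow_le_pow_of_le_one (by positivity) (by linarith [h.le_one]) hC
  have hpow : ∀ W : Finset V, (1 + χ) ^ W.card ≤ (1 + χ) ^ Fintype.card V := fun W =>
    pow_le_pow_right₀ (by linarith) (Finset.card_le_univ W)
  have hpow1 : 1 ≤ (1 + χ) ^ Fintype.card V := one_le_pow₀ (by linarith)
  have hgood := two_mul_tvDist_law_add_le h ht hs (alternating V₁) (chains G R K)
    (g := 2 * (Fintype.card V * e) + (η + ((1 + χ) ^ Fintype.card V - 1) / η))
    (by
      have : 0 ≤ ((1 + χ) ^ Fintype.card V - 1) / η := div_nonneg (by linarith) hη.le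
      positivity)
    (fun W hW H hH hH1 => by
      refine ((happ W hW).abs_sum_sub_sum_le hη hH hH1).trans ?_
      gcongr
      · exact Finset.card_le_univ W
      · linarith
      · exact Finset.card_le_univ W)
  have hbad : ∑ A ∈ chains G R K, dualEv G θ s (occupied A)
      ≤ Fintype.card V * (K * D) ^ K * (Δ * Real.exp (-θ * s)) ^ (K + 1) := by
    calc ∑ A ∈ chains G R K, dualEv G θ s (occupied A)
        ≤ ∑ _A ∈ chains G R K, (Δ * Real.exp (-θ * s)) ^ (K + 1) := by
          refine Finset.sum_le_sum fun A hA => ?_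
          have := dualEv_occupied_le h (fun u => hΔ ▸ degree_le hg u) hs A
          rwa [card_of_mem_chains hA] at this
      _ = (chains G R K).card * (Δ * Real.exp (-θ * s)) ^ (K + 1) := by
          rw [Finset.sum_const, nsmul_eq_mul]
      _ ≤ _ := by
          have hΔ0 : 0 ≤ Δ := by rw [hΔ]; positivity
          refine mul_le_mul_of_nonneg_right (card_chains_le (fun v => ?_) hD0 K le_rfl)
            (by positivity)
          rw [hD]
          exact hg.card_le hR fun w hw => (Finset.mem_filter.1 hw).2
  have e1 : 2 * (Fintype.card V * e)
      = 4 / θ ^ 2 * (Fintype.card V : ℝ) ^ 4 * (1 + θ)⁻¹ ^ R := by rw [he]; ring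
  linarith

end UpperBound

theorem one_add_pow_sub_one_le {χ : ℝ} (hχ : 0 ≤ χ) (n : ℕ) (hn : n * χ ≤ 1) :
    (1 + χ) ^ n - 1 ≤ 2 * (n * χ) := by
  have h1 : (1 + χ) ^ n ≤ Real.exp (n * χ) := by
    rw [Real.exp_nat_mul]
    exact pow_le_pow_left₀ (by linarith) (by linarith [Real.add_one_le_exp χ]) n
  have h0 : 0 ≤ n * χ := by positivity
  have h2 := Real.abs_exp_sub_one_le (x := n * χ) (by rwa [abs_of_nonneg h0])
  rw [abs_of_nonneg h0] at h2
  linarith [(abs_le.1 h2).2]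

/-- Upper bound for the distance to stationarity from the alternating state. -/
theorem exists_upper_bound {θ α c₀ ε : ℝ} (hθ0 : 0 < θ) (hθ1 : θ ≤ 1) (hα0 : 0 < α) (hα1 : α < 1)
    (hc : 0 < c₀) (hε : 0 < ε) :
    ∃ C L₀ : ℝ, 0 ≤ C ∧ ∀ (V : Type u) [Fintype V] [DecidableEq V] (G : SimpleGraph V)
      [DecidableRel G.Adj] (V₁ : Set V), Admissible G θ → G.IsBipartiteWith V₁ V₁ᶜ →
      SubexpGrowth G c₀ α → L₀ ≤ Real.log (Fintype.card V) →
      tvDist (law (noisyVoterGenerator G 2 θ) (alternating V₁)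
        ((Real.log (Fintype.card V) + C * Real.log (Fintype.card V) ^ (1 - α / 2))
          / min (4 - 2 * θ) (4 * θ))) (noisyVoterStationary G 2 θ) < ε := by
  have hp : 0 < 1 - α / 2 := by linarith
  set M := min (4 - 2 * θ) (4 * θ) with hM
  have hM0 : 0 < M := lt_min (by linarith) (by linarith)
  have hMm : M = 2 * min (2 - θ) (2 * θ) := by
    rw [mul_min_of_nonneg _ _ (by norm_num : (0 : ℝ) ≤ 2), hM]; congr 1 <;> ring
  set Δ := c₀ * Real.exp 1 with hΔdef
  have hΔ0 : 0 < Δ := by positivity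
  set b := Real.log (1 + θ)
  have hb0 : 0 < b := Real.log_pos (by linarith)
  set a := 5 / b + 1
  have ha1 : 1 ≤ a := by
    have : 0 ≤ 5 / b := by positivity
    linarith
  set q := Real.log (2 / θ)
  have hq0 : 0 ≤ q := Real.log_nonneg (by rw [le_div_iff₀ hθ0]; linarith)
  -- K ≤ 2l makes (2/θ)^{2K} at most e^{4ql}; the remaining l leaves nχ ≤ 4e^{-l}. In `C₂` below, a
  -- pays for D, one unit for K ≤ 2e^l, the logarithm for constants, and one unit is left over.
  set C₁ := 4 * q + 1 with hC₁
  set C₂ := a + 2 + |Real.log (2 * c₀ * Δ)| with hC₂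
  have hC₂1 : 1 ≤ C₂ := by
    have := abs_nonneg (Real.log (2 * c₀ * Δ))
    linarith
  set K₀ := 4 / θ ^ 2 + 16 / ε + 2 * Δ with hK₀
  obtain ⟨L₀, hL₀⟩ := Filter.eventually_atTop.1
    ((eventually_const_mul_exp_neg_rpow_le K₀ hp hε).and
      ((eventually_const_mul_exp_neg_rpow_le 4 hp one_pos).and (Filter.eventually_ge_atTop 1)))
  refine ⟨C₁ + M * (C₂ / θ), L₀, by positivity, fun V _ _ G _ V₁ h hbip hg hL => ?_⟩
  have : Nonempty V := h.connected.nonempty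
  have hcard : (0 : ℝ) < Fintype.card V := by exact_mod_cast Fintype.card_pos
  obtain ⟨h1, h2, hL1⟩ := hL₀ _ hL
  set L := Real.log (Fintype.card V) with hLdef
  have hLn : (Fintype.card V : ℝ) = Real.exp L := (Real.exp_log hcard).symm
  have hL0 : 0 < L := by linarith
  set l := L ^ (1 - α / 2)
  have hl1 : 1 ≤ l := Real.one_le_rpow hL1 hp.le
  have hlL : l ≤ L := by
    calc l ≤ L ^ (1 : ℝ) := Real.rpow_le_rpow_of_exponent_le hL1 (by linarith)
      _ = L := Real.rpow_one L
  set k := L ^ (α / 2) with hk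
  have hk1 : 1 ≤ k := Real.one_le_rpow hL1 (by linarith)
  have hkl : k ≤ l := Real.rpow_le_rpow_of_exponent_le hL1 (by linarith)
  have hlk : l * k = L := by
    rw [hk, ← Real.rpow_add hL0]
    have : 1 - α / 2 + α / 2 = 1 := by ring
    rw [this, Real.rpow_one]
  -- K ≥ L^{α/2} is what is needed for n e^{-lK} ≤ 1, because l · L^{α/2} = L.
  set K := ⌈k⌉₊
  have hkK : k ≤ K := Nat.le_ceil k
  have hK2 : (K : ℝ) ≤ 2 * l := by
    have := (Nat.ceil_lt_add_one (by linarith : 0 ≤ k)).le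
    linarith
  set R := ⌈5 * L / b⌉₊
  have hR1 : 5 * L / b ≤ R := Nat.le_ceil _
  have hRpos : 1 ≤ R := Nat.one_le_ceil_iff.2 (by positivity)
  have hRa : (R : ℝ) ≤ a * L := by
    have := (Nat.ceil_lt_add_one (by positivity : 0 ≤ 5 * L / b)).le
    have e : a * L = 5 * L / b + L := by simp only [a]; ring
    linarith
  set D := c₀ * Real.exp ((R : ℝ) ^ (1 - α)) with hD
  have hDle : D ≤ c₀ * Real.exp (a * l) := by
    rw [hD]
    refine mul_le_mul_of_nonneg_left (Real.exp_le_exp.2 ?_) hc.le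
    calc (R : ℝ) ^ (1 - α) ≤ (a * L) ^ (1 - α) :=
          Real.rpow_le_rpow (Nat.cast_nonneg _) hRa (by linarith)
      _ = a ^ (1 - α) * L ^ (1 - α) := Real.mul_rpow (by linarith) hL0.le
      _ ≤ a * l := by
          refine mul_le_mul ?_ (Real.rpow_le_rpow_of_exponent_le hL1 (by linarith))
            (by positivity) (by linarith)
          calc a ^ (1 - α) ≤ a ^ (1 : ℝ) := Real.rpow_le_rpow_of_exponent_le ha1 (by linarith)
            _ = a := Real.rpow_one a
  have hD0 : 0 ≤ D := by positivity
  set t := (L + C₁ * l) / M with ht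
  set s := C₂ / θ * l with hs
  have hC₁0 : 0 ≤ C₁ := by positivity
  have ht0 : 0 ≤ t := by positivity
  have hs0 : 0 ≤ s := by positivity
  have hts : (L + (C₁ + M * (C₂ / θ)) * l) / M = t + s := by
    rw [ht, hs]; field_simp; ring
  rw [hts]
  set χ := (2 * Real.exp (-(min (2 - θ) (2 * θ)) * t) / (θ / 2) ^ K) ^ 2 with hχ
  have main := tvDist_alternating_le h hbip hc hg (K := K) hRpos ht0 hs0 (half_pos hε) hχ hD hΔdef
  have hχ0 : 0 ≤ χ := by positivity
  have hχle : Fintype.card V * χ ≤ 4 * Real.exp (-l) := by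
    have e1 : χ = 4 * Real.exp (-(L + C₁ * l) + 2 * (K * q)) := by
      have e2 : (θ / 2) ^ K = Real.exp (-(K * q)) := by
        have e5 : -((K : ℝ) * q) = K * (-q) := by ring
        rw [e5, Real.exp_nat_mul, Real.exp_neg, Real.exp_log (by positivity), inv_div]
      have e3 : -(min (2 - θ) (2 * θ)) * t = -(L + C₁ * l) / 2 := by
        rw [ht, hMm]
        have : min (2 - θ) (2 * θ) ≠ 0 := by
          rw [hMm] at hM0
          intro h0
          simp [h0] at hM0
        field_simp
      rw [hχ, e2, e3, mul_div_assoc, ← Real.exp_sub, mul_pow, ← Real.exp_nat_mul]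
      norm_num
      ring
    rw [e1, hLn, mul_left_comm, ← Real.exp_add]
    refine mul_le_mul_of_nonneg_left (Real.exp_le_exp.2 ?_) (by norm_num)
    have : (K : ℝ) * q ≤ 2 * l * q := mul_le_mul_of_nonneg_right hK2 hq0
    rw [hC₁]
    linarith
  have hterm2 : ((1 + χ) ^ Fintype.card V - 1) / (ε / 2) ≤ 16 / ε * Real.exp (-l) := by
    have h3 := one_add_pow_sub_one_le hχ0 (Fintype.card V) (hχle.trans h2)
    rw [div_le_iff₀ (half_pos hε)]
    have : 16 / ε * Real.exp (-l) * (ε / 2) = 8 * Real.exp (-l) := by field_simp; norm_num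
    rw [this]
    linarith
  have hterm1 : 4 / θ ^ 2 * (Fintype.card V : ℝ) ^ 4 * (1 + θ)⁻¹ ^ R
      ≤ 4 / θ ^ 2 * Real.exp (-l) := by
    rw [mul_assoc]
    refine mul_le_mul_of_nonneg_left ?_ (by positivity)
    have e2 : (1 + θ)⁻¹ ^ R = Real.exp (-(R * b)) := by
      have e5 : -((R : ℝ) * b) = R * (-b) := by ring
      rw [e5, Real.exp_nat_mul, Real.exp_neg, Real.exp_log (by positivity)]
    rw [e2, hLn, ← Real.exp_nat_mul, ← Real.exp_add, Real.exp_le_exp]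
    have h3 : 5 * L ≤ R * b := by rwa [div_le_iff₀ hb0] at hR1
    push_cast
    linarith
  have hterm3 : Fintype.card V * (K * D) ^ K * (Δ * Real.exp (-θ * s)) ^ (K + 1)
      ≤ Δ * Real.exp (-l) := by
    have hθs : -θ * s = -(C₂ * l) := by rw [hs]; field_simp
    have h3 : K * D * (Δ * Real.exp (-θ * s)) ≤ Real.exp (-l) := by
      have h4 : (K : ℝ) ≤ 2 * Real.exp l := by linarith [Real.add_one_le_exp l]
      calc K * D * (Δ * Real.exp (-θ * s))
          ≤ 2 * Real.exp l * (c₀ * Real.exp (a * l)) * (Δ * Real.exp (-θ * s)) := by gcongr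
        _ = (2 * c₀ * Δ) * (Real.exp l * Real.exp (a * l) * Real.exp (-θ * s)) := by ring
        _ ≤ Real.exp (|Real.log (2 * c₀ * Δ)| * l)
            * (Real.exp l * Real.exp (a * l) * Real.exp (-θ * s)) := by
            refine mul_le_mul_of_nonneg_right ?_ (by positivity)
            calc 2 * c₀ * Δ = Real.exp (Real.log (2 * c₀ * Δ)) :=
                  (Real.exp_log (by positivity)).symm
              _ ≤ _ := Real.exp_le_exp.2 ((le_abs_self _).trans
                  (le_mul_of_one_le_right (abs_nonneg _) hl1))
        _ = Real.exp (-l) := by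
            rw [hθs, ← Real.exp_add, ← Real.exp_add, ← Real.exp_add, hC₂]
            congr 1; ring
    have h5 : Δ * Real.exp (-θ * s) ≤ Δ * Real.exp (-l) := by
      refine mul_le_mul_of_nonneg_left (Real.exp_le_exp.2 ?_) hΔ0.le
      rw [hθs]
      have := mul_le_mul_of_nonneg_right hC₂1 (by linarith : 0 ≤ l)
      linarith
    calc Fintype.card V * (K * D) ^ K * (Δ * Real.exp (-θ * s)) ^ (K + 1)
        = (Fintype.card V * (K * D * (Δ * Real.exp (-θ * s))) ^ K)
          * (Δ * Real.exp (-θ * s)) := by rw [pow_succ, mul_pow (K * D)]; ring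
      _ ≤ 1 * (Δ * Real.exp (-l)) := by
          refine mul_le_mul ?_ h5 (by positivity) zero_le_one
          calc Fintype.card V * (K * D * (Δ * Real.exp (-θ * s))) ^ K
              ≤ Fintype.card V * Real.exp (-l) ^ K := by gcongr
            _ ≤ 1 := by
                rw [hLn, ← Real.exp_nat_mul, ← Real.exp_add, Real.exp_le_one_iff]
                have := mul_le_mul_of_nonneg_left hkK (by linarith : 0 ≤ l)
                linarith
      _ = _ := one_mul _
  have htot : K₀ * Real.exp (-l) = 4 / θ ^ 2 * Real.exp (-l) + 16 / ε * Real.exp (-l)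
      + 2 * (Δ * Real.exp (-l)) := by rw [hK₀]; ring
  linarith

/-! ### Mixing times -/

section MixingTime

variable {V : Type*} [Fintype V] [DecidableEq V] {G : SimpleGraph V} [DecidableRel G.Adj] {θ : ℝ}

theorem mixingTime_nonneg {Ω : Type*} [Fintype Ω] [DecidableEq Ω] (Q : Matrix Ω Ω ℝ) (μ : Ω → ℝ)
    (x : Ω) (ε : ℝ) : 0 ≤ mixingTime Q μ x ε :=
  Real.sInf_nonneg fun _ ht => ht.1

theorem mixingTime_le {Ω : Type*} [Fintype Ω] [DecidableEq Ω] {Q : Matrix Ω Ω ℝ} {μ : Ω → ℝ}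
    {x : Ω} {ε t : ℝ} (ht : 0 ≤ t) (hlt : tvDist (law Q x t) μ < ε) : mixingTime Q μ x ε ≤ t :=
  csInf_le ⟨0, fun _ hs => hs.1⟩ ⟨ht, hlt⟩

theorem tvDist_law_le (h : Admissible G θ) {t : ℝ} (ht : 0 ≤ t) (x : V → Fin 2) :
    tvDist (law (noisyVoterGenerator G 2 θ) x t) (noisyVoterStationary G 2 θ)
      ≤ Fintype.card V * Real.exp (-θ ^ 2 * t) := by
  obtain ⟨F, hF1, hF⟩ := exists_sum_mul_eq_tvDist (law (noisyVoterGenerator G 2 θ) x t)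
    (noisyVoterStationary G 2 θ)
  have h1 := abs_evolve_sub_stationary_le h ht hF1 x
  simp only [sub_mul, Finset.sum_sub_distrib, sum_law_mul] at hF
  have h2 := (le_abs_self _).trans h1
  linarith

theorem tvDist_law_lt (h : Admissible G θ) {ε : ℝ} (hε : 0 < ε) (x : V → Fin 2) :
    tvDist (law (noisyVoterGenerator G 2 θ) x
      ((Real.log (Fintype.card V) + |Real.log (ε / 2)|) / θ ^ 2)) (noisyVoterStationary G 2 θ)
      < ε := by
  have := h.connected.nonempty
  have hcard : (1 : ℝ) ≤ Fintype.card V := by exact_mod_cast Fintype.card_pos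
  have hθ := h.pos
  have hlog := Real.log_nonneg hcard
  refine (tvDist_law_le h (by positivity) x).trans_lt ?_
  have e : -θ ^ 2 * ((Real.log (Fintype.card V) + |Real.log (ε / 2)|) / θ ^ 2)
      = -Real.log (Fintype.card V) + -|Real.log (ε / 2)| := by field_simp; ring
  rw [e, Real.exp_add, Real.exp_neg, Real.exp_log (by linarith), ← mul_assoc,
    mul_inv_cancel₀ (by linarith), one_mul]
  calc Real.exp (-|Real.log (ε / 2)|) ≤ Real.exp (Real.log (ε / 2)) :=
        Real.exp_le_exp.2 (neg_abs_le _)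
    _ = ε / 2 := Real.exp_log (by positivity)
    _ < ε := by linarith

theorem noisyVoterMixingTime_le (h : Admissible G θ) {ε : ℝ} (hε : 0 < ε) (x : V → Fin 2) :
    noisyVoterMixingTime G 2 θ x ε
      ≤ (Real.log (Fintype.card V) + |Real.log (ε / 2)|) / θ ^ 2 := by
  refine mixingTime_le ?_ (tvDist_law_lt h hε x)
  have := h.connected.nonempty
  have hcard : (1 : ℝ) ≤ Fintype.card V := by exact_mod_cast Fintype.card_pos
  have := Real.log_nonneg hcard
  positivity

/-- The infimum of an empty set of reals is 0 by default, so the crude bound `tvDist_law_lt` is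
needed to know that the distance eventually falls below ε. -/
theorem le_noisyVoterMixingTime (h : Admissible G θ) {ε : ℝ} (hε : 0 < ε) (x : V → Fin 2) {T : ℝ}
    (hT : ∀ t, 0 ≤ t → t ≤ T →
      ε ≤ tvDist (law (noisyVoterGenerator G 2 θ) x t) (noisyVoterStationary G 2 θ)) :
    T ≤ noisyVoterMixingTime G 2 θ x ε := by
  have := h.connected.nonempty
  have hcard : (1 : ℝ) ≤ Fintype.card V := by exact_mod_cast Fintype.card_pos
  have := Real.log_nonneg hcard
  refine le_csInf ⟨_, by positivity, tvDist_law_lt h hε x⟩ fun t ht => ?_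
  by_contra hlt
  push Not at hlt
  exact absurd ht.2 (not_lt.2 (hT t ht.1 hlt.le))

end MixingTime

/-- Two-sided bounds on mixing times at large volume. -/
theorem exists_mixingTime_bounds {θ α c₀ ε : ℝ} (hθ0 : 0 < θ) (hθ1 : θ ≤ 1) (hα0 : 0 < α)
    (hα1 : α < 1) (hc : 0 < c₀) (hε0 : 0 < ε) (hε1 : ε < 1) :
    ∃ C L₀ : ℝ, 0 ≤ C ∧ 1 ≤ L₀ ∧ ∀ (V : Type u) [Fintype V] [DecidableEq V] (G : SimpleGraph V)
      [DecidableRel G.Adj], Admissible G θ → SubexpGrowth G c₀ α →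
      L₀ ≤ Real.log (Fintype.card V) →
      (∀ x, Real.log (Fintype.card V) * (1 - C * Real.log (Fintype.card V) ^ (-(α / 2)))
        ≤ min (4 - 2 * θ) (4 * θ) * noisyVoterMixingTime G 2 θ x ε) ∧
      ∀ V₁ : Set V, G.IsBipartiteWith V₁ V₁ᶜ →
        min (4 - 2 * θ) (4 * θ) * noisyVoterMixingTime G 2 θ (alternating V₁) ε
          ≤ Real.log (Fintype.card V) * (1 + C * Real.log (Fintype.card V) ^ (-(α / 2))) := by
  obtain ⟨C₁, L₁, hlow⟩ := exists_lower_bound.{u} hθ0 hα0 hα1 hc hε1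
  obtain ⟨C₂, L₂, hC₂, hup⟩ := exists_upper_bound.{u} hθ0 hθ1 hα0 hα1 hc hε0
  have hM0 : 0 < min (4 - 2 * θ) (4 * θ) := lt_min (by linarith) (by linarith)
  refine ⟨max C₁ C₂, max (max L₁ L₂) 1, hC₂.trans (le_max_right _ _), le_max_right _ _,
    fun V _ _ G _ h hg hL => ?_⟩
  set L := Real.log (Fintype.card V)
  have hL1 : 1 ≤ L := (le_max_right _ _).trans hL
  have hL0 : 0 < L := by linarith
  have hl : L * L ^ (-(α / 2)) = L ^ (1 - α / 2) := by
    nth_rewrite 1 [← Real.rpow_one L]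
    rw [← Real.rpow_add hL0, sub_eq_add_neg]
  have hl0 : 0 ≤ L ^ (1 - α / 2) := by positivity
  have h1 : C₁ * L ^ (1 - α / 2) ≤ max C₁ C₂ * L ^ (1 - α / 2) :=
    mul_le_mul_of_nonneg_right (le_max_left _ _) hl0
  have h2 : C₂ * L ^ (1 - α / 2) ≤ max C₁ C₂ * L ^ (1 - α / 2) :=
    mul_le_mul_of_nonneg_right (le_max_right _ _) hl0
  have hl' : L * (max C₁ C₂ * L ^ (-(α / 2))) = max C₁ C₂ * L ^ (1 - α / 2) := by
    rw [← hl]; ring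
  constructor
  · intro x
    have := le_noisyVoterMixingTime h hε0 x (T := (L - C₁ * L ^ (1 - α / 2))
      / min (4 - 2 * θ) (4 * θ)) fun t ht hle => by
        refine hlow V G x t h hg ((le_max_left _ _).trans ((le_max_left _ _).trans hL)) ht ?_
        rw [le_div_iff₀ hM0] at hle
        linarith
    rw [div_le_iff₀ hM0] at this
    linarith
  · intro V₁ hb
    have h3 := hup V G V₁ h hb hg ((le_max_right _ _).trans ((le_max_left _ _).trans hL))
    have h4 : noisyVoterMixingTime G 2 θ (alternating V₁) ε ≤ _ :=
      mixingTime_le (by positivity) h3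
    rw [le_div_iff₀ hM0] at h4
    linarith

/-- The mixing time from the alternating state. -/
theorem exists_mixingTime_alternating_eq {θ α c₀ ε : ℝ} (hθ0 : 0 < θ) (hθ1 : θ ≤ 1) (hα0 : 0 < α)
    (hα1 : α < 1) (hc : 0 < c₀) (hε0 : 0 < ε) (hε1 : ε < 1) :
    ∃ C : ℝ, ∀ (V : Type u) [Fintype V] [DecidableEq V] (G : SimpleGraph V)
      [DecidableRel G.Adj] (V₁ : Set V), Admissible G θ → G.IsBipartiteWith V₁ V₁ᶜ →
      SubexpGrowth G c₀ α →
      ∃ δ : ℝ, |δ| ≤ C * Real.log (Fintype.card V) ^ (-(α / 2)) ∧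
        noisyVoterMixingTime G 2 θ (alternating V₁) ε =
          (1 + δ) / min (4 - 2 * θ) (4 * θ) * Real.log (Fintype.card V) := by
  obtain ⟨C, L₀, hC0, hL₀, hbd⟩ := exists_mixingTime_bounds.{u} hθ0 hθ1 hα0 hα1 hc hε0 hε1
  set M := min (4 - 2 * θ) (4 * θ)
  have hM0 : 0 < M := lt_min (by linarith) (by linarith)
  have hlog2 : 0 < Real.log 2 := Real.log_pos (by norm_num)
  -- Covers graphs with L below the threshold: the crude bound divided by L, using L ≥ log 2, with 1
  -- added because δ = MT/L - 1.
  set B := M * ((1 + |Real.log (ε / 2)| / Real.log 2) / θ ^ 2) + 1 with hB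
  have hB0 : 0 ≤ B := by positivity
  refine ⟨C + B * L₀ ^ (α / 2), fun V _ _ G _ V₁ h hb hg => ?_⟩
  set T := noisyVoterMixingTime G 2 θ (alternating V₁) ε
  have hT0 : 0 ≤ T := mixingTime_nonneg _ _ _ _
  have hcard : (2 : ℝ) ≤ Fintype.card V := by
    have := Fintype.one_lt_card_iff_nontrivial.2 h.nontrivial
    exact_mod_cast this
  set L := Real.log (Fintype.card V) with hLdef
  have hL2 : Real.log 2 ≤ L := Real.log_le_log (by norm_num) hcard
  have hL0 : 0 < L := by linarith
  have hLp : 0 < L ^ (-(α / 2)) := by positivity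
  refine ⟨M * T / L - 1, ?_, by field_simp; ring⟩
  rw [add_mul]
  rcases le_total L₀ L with hbig | hsmall
  · obtain ⟨hlow, hup⟩ := hbd V G h hg hbig
    have h1 := hlow (alternating V₁)
    have h2 := hup V₁ hb
    have h3 : |M * T / L - 1| ≤ C * L ^ (-(α / 2)) := by
      rw [abs_le]
      constructor
      · have : 1 - C * L ^ (-(α / 2)) ≤ M * T / L := by
          rw [le_div_iff₀ hL0]; linarith
        linarith
      · have : M * T / L ≤ 1 + C * L ^ (-(α / 2)) := by
          rw [div_le_iff₀ hL0]; linarith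
        linarith
    have : 0 ≤ B * L₀ ^ (α / 2) * L ^ (-(α / 2)) := by positivity
    linarith
  · have h1 : T ≤ (L + |Real.log (ε / 2)|) / θ ^ 2 := noisyVoterMixingTime_le h hε0 _
    have h2 : T / L ≤ (1 + |Real.log (ε / 2)| / Real.log 2) / θ ^ 2 := by
      rw [div_le_iff₀ hL0]
      refine h1.trans ?_
      rw [div_mul_eq_mul_div]
      refine div_le_div_of_nonneg_right ?_ (by positivity)
      have : |Real.log (ε / 2)| ≤ |Real.log (ε / 2)| / Real.log 2 * L := by
        rw [div_mul_eq_mul_div, le_div_iff₀ hlog2]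
        exact mul_le_mul_of_nonneg_left hL2 (abs_nonneg _)
      linarith
    have h3 : |M * T / L - 1| ≤ B := by
      have h4 : M * T / L ≤ M * ((1 + |Real.log (ε / 2)| / Real.log 2) / θ ^ 2) := by
        rw [mul_div_assoc]; exact mul_le_mul_of_nonneg_left h2 hM0.le
      have h5 : 0 ≤ M * T / L := by positivity
      have h6 : 0 ≤ M * ((1 + |Real.log (ε / 2)| / Real.log 2) / θ ^ 2) := by positivity
      rw [abs_le]
      constructor <;> linarith
    -- For small graphs L^{-α/2} is bounded below, so a bounded δ fits the required form after
    -- enlarging the constant.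
    have h4 : 1 ≤ L₀ ^ (α / 2) * L ^ (-(α / 2)) := by
      rw [Real.rpow_neg hL0.le, ← div_eq_mul_inv, one_le_div (by positivity)]
      exact Real.rpow_le_rpow hL0.le hsmall (by linarith)
    have h5 : B * 1 ≤ B * (L₀ ^ (α / 2) * L ^ (-(α / 2))) := mul_le_mul_of_nonneg_left h4 hB0
    have h6 : 0 ≤ C * L ^ (-(α / 2)) := by positivity
    linarith

/-- The alternating state is asymptotically the fastest initial state. -/
theorem one_le_liminf_mixingTime_ratio {θ α c₀ ε : ℝ} (hθ0 : 0 < θ) (hθ1 : θ ≤ 1) (hα0 : 0 < α)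
    (hα1 : α < 1) (hc : 0 < c₀) (hε0 : 0 < ε) (hε1 : ε < 1)
    (V : ℕ → Type u) [∀ k, Fintype (V k)] [∀ k, DecidableEq (V k)]
    (G : ∀ k, SimpleGraph (V k)) [∀ k, DecidableRel (G k).Adj]
    (V₁ : ∀ k, Set (V k)) (x₀ : ∀ k, V k → Fin 2)
    (hcard : Filter.Tendsto (fun k => Fintype.card (V k)) Filter.atTop Filter.atTop)
    (hG : ∀ᶠ k in Filter.atTop, Admissible (G k) θ ∧ (G k).IsBipartiteWith (V₁ k) (V₁ k)ᶜ ∧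
      SubexpGrowth (G k) c₀ α) :
    1 ≤ Filter.liminf (fun k => ((noisyVoterMixingTime (G k) 2 θ (x₀ k) ε /
      noisyVoterMixingTime (G k) 2 θ (alternating (V₁ k)) ε : ℝ) : EReal)) Filter.atTop := by
  obtain ⟨C, L₀, hC0, hL₀, hbd⟩ := exists_mixingTime_bounds.{u} hθ0 hθ1 hα0 hα1 hc hε0 hε1
  set M := min (4 - 2 * θ) (4 * θ)
  have hM0 : 0 < M := lt_min (by linarith) (by linarith)
  have hL : Filter.Tendsto (fun k => Real.log (Fintype.card (V k))) Filter.atTop Filter.atTop :=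
    Real.tendsto_log_atTop.comp (tendsto_natCast_atTop_atTop.comp hcard)
  set z : ℕ → ℝ := fun k => C * Real.log (Fintype.card (V k)) ^ (-(α / 2))
  have hz : Filter.Tendsto z Filter.atTop (nhds 0) := by
    have := ((tendsto_rpow_neg_atTop (half_pos hα0)).comp hL).const_mul C
    simpa using this
  have hr : Filter.Tendsto (fun k => (1 - z k) / (1 + z k)) Filter.atTop (nhds 1) := by
    have : Filter.Tendsto (fun k => (1 - z k) / (1 + z k)) Filter.atTop
        (nhds ((1 - 0) / (1 + 0))) := (hz.const_sub 1).div (hz.const_add 1) (by norm_num)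
    simpa using this
  have hr' : Filter.Tendsto (fun k => (((1 - z k) / (1 + z k) : ℝ) : EReal)) Filter.atTop
      (nhds ((1 : ℝ) : EReal)) := EReal.tendsto_coe.2 hr
  have h1 := hr'.liminf_eq
  rw [EReal.coe_one] at h1
  rw [← h1]
  refine Filter.liminf_le_liminf ?_
  filter_upwards [hG, hL.eventually_ge_atTop L₀, hz.eventually (gt_mem_nhds one_pos)] with
    k ⟨hadm, hbip, hg⟩ hLk hzk
  obtain ⟨hlow, hup⟩ := hbd (V k) (G k) hadm hg hLk
  rw [EReal.coe_le_coe_iff]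
  have hL0 : 0 < Real.log (Fintype.card (V k)) := by linarith
  have hz0 : 0 ≤ z k := by positivity
  set L := Real.log (Fintype.card (V k))
  set T := noisyVoterMixingTime (G k) 2 θ (x₀ k) ε
  set T' := noisyVoterMixingTime (G k) 2 θ (alternating (V₁ k)) ε
  have h2 : L * (1 - z k) ≤ M * T := hlow (x₀ k)
  have h3 : L * (1 - z k) ≤ M * T' := hlow (alternating (V₁ k))
  have h4 : M * T' ≤ L * (1 + z k) := hup (V₁ k) hbip
  have h5 : 0 < M * T' := lt_of_lt_of_le (mul_pos hL0 (by linarith)) h3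
  have h6 : T / T' = M * T / (M * T') := by rw [mul_div_mul_left _ _ hM0.ne']
  rw [h6, ← mul_div_mul_left (1 - z k) (1 + z k) hL0.ne']
  have h7 : 0 ≤ L * (1 - z k) := mul_nonneg hL0.le (by linarith)
  exact div_le_div₀ (h7.trans h2) h2 h5 h4

/-! ### Glauber dynamics for the Ising model -/

section Ising

variable {V : Type*} [Fintype V] [DecidableEq V] {G : SimpleGraph V} [DecidableRel G.Adj]

/-- Weights satisfying detailed balance with a single-site dynamics yield a stationary
distribution. -/
theorem isStationary_of_detailed_balance {p : V → (V → Fin 2) → Fin 2 → ℝ}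
    (hp1 : ∀ u x, ∑ j, p u x j = 1) {w : (V → Fin 2) → ℝ} (hw : ∀ x, 0 < w x)
    (hdb : ∀ u x j, w x * p u x j = w (Function.update x u j) * p u (Function.update x u j) (x u)) :
    IsStationary (siteGenerator p) (fun x => w x / ∑ y, w y) := by
  have hZ : 0 < ∑ y, w y := Finset.sum_pos (fun y _ => hw y) Finset.univ_nonempty
  have key : ∀ f : (V → Fin 2) → ℝ, ∑ x, w x * act (siteGenerator p) f x = 0 := by
    intro f
    simp only [act_siteGenerator, Finset.mul_sum]
    rw [Finset.sum_comm]
    refine Finset.sum_eq_zero fun u _ => ?_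
    simp only [mul_sub, Finset.sum_sub_distrib]
    rw [sub_eq_zero]
    -- Reversal of an update: exchange the old and the new value at u. Detailed balance says that
    -- this involution preserves the flow w·p.
    have hinv : Function.Involutive
        (fun q : (V → Fin 2) × Fin 2 => (Function.update q.1 u q.2, q.1 u)) := by
      rintro ⟨x, j⟩
      simp
    calc ∑ x, w x * ∑ j, p u x j * f (Function.update x u j)
        = ∑ q : (V → Fin 2) × Fin 2, w q.1 * p u q.1 q.2 * f (Function.update q.1 u q.2) := by
          rw [Fintype.sum_prod_type]
          refine Finset.sum_congr rfl fun x _ => ?_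
          rw [Finset.mul_sum]
          exact Finset.sum_congr rfl fun j _ => by ring
      _ = ∑ q : (V → Fin 2) × Fin 2, w q.1 * p u q.1 q.2 * f q.1 := by
          refine Fintype.sum_equiv hinv.toPerm _ _ fun q => ?_
          rw [hdb]
          rfl
      _ = ∑ x, w x * f x := by
          rw [Fintype.sum_prod_type]
          refine Finset.sum_congr rfl fun x _ => ?_
          dsimp only
          rw [← Finset.sum_mul, ← Finset.mul_sum, hp1, mul_one]
  refine ⟨fun x => (div_pos (hw x) hZ).le, ?_, ?_⟩
  · rw [← Finset.sum_div, div_self hZ.ne']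
  · funext y
    have h1 := key (Pi.single y 1)
    simp only [act, Pi.single_apply, mul_ite, mul_one, mul_zero, Finset.sum_ite_eq',
      Finset.mem_univ, if_true] at h1
    simp only [Matrix.vecMul, dotProduct, Pi.zero_apply, div_mul_eq_mul_div]
    rw [← Finset.sum_div, h1, zero_div]

/-- The interaction energy. -/
def isingEnergy (G : SimpleGraph V) [DecidableRel G.Adj] (x : V → Fin 2) : ℝ :=
  (1 / 2) * ∑ u, ∑ v ∈ G.neighborFinset u, spin (x u) * spin (x v)

theorem sum_neighbor_update (u : V) (x : V → Fin 2) (j : Fin 2) :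
    ∑ v ∈ G.neighborFinset u, spin (Function.update x u j v)
      = ∑ v ∈ G.neighborFinset u, spin (x v) := by
  refine Finset.sum_congr rfl fun v hv => ?_
  rw [Function.update_of_ne]
  rintro rfl
  exact G.loopless.irrefl _ ((G.mem_neighborFinset _ _).1 hv)

/-- Isolates the bonds at u: each occurs twice in the ordered double sum, which cancels the factor
1/2, and the remainder does not involve the spin at u. -/
theorem isingEnergy_eq (u : V) (x : V → Fin 2) :
    isingEnergy G x = spin (x u) * ∑ v ∈ G.neighborFinset u, spin (x v)
      + (1 / 2) * ∑ a ∈ Finset.univ.erase u, ∑ b ∈ (G.neighborFinset a).erase u,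
        spin (x a) * spin (x b) := by
  have h1 : ∀ a ∈ Finset.univ.erase u, ∑ b ∈ G.neighborFinset a, spin (x a) * spin (x b)
      = (if a ∈ G.neighborFinset u then spin (x u) * spin (x a) else 0)
        + ∑ b ∈ (G.neighborFinset a).erase u, spin (x a) * spin (x b) := by
    intro a _
    by_cases hau : u ∈ G.neighborFinset a
    · have hua : a ∈ G.neighborFinset u := by
        rw [SimpleGraph.mem_neighborFinset] at hau ⊢; exact hau.symm
      rw [if_pos hua, ← Finset.add_sum_erase _ _ hau, mul_comm (spin (x a)) (spin (x u))]
    · have hua : a ∉ G.neighborFinset u := by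
        rw [SimpleGraph.mem_neighborFinset] at hau ⊢; exact fun hh => hau hh.symm
      rw [if_neg hua, zero_add, Finset.erase_eq_of_notMem hau]
  have h2 : ∑ a ∈ Finset.univ.erase u,
      (if a ∈ G.neighborFinset u then spin (x u) * spin (x a) else 0)
      = spin (x u) * ∑ v ∈ G.neighborFinset u, spin (x v) := by
    rw [← Finset.sum_filter, Finset.mul_sum]
    refine Finset.sum_congr ?_ fun _ _ => rfl
    ext a
    simp only [Finset.mem_filter, Finset.mem_erase, Finset.mem_univ, and_true,
      SimpleGraph.mem_neighborFinset, and_iff_right_iff_imp]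
    rintro hh rfl
    exact G.loopless.irrefl _ hh
  unfold isingEnergy
  rw [← Finset.add_sum_erase _ _ (Finset.mem_univ u), Finset.sum_congr rfl h1,
    Finset.sum_add_distrib, h2, Finset.mul_sum (G.neighborFinset u)]
  ring

theorem isingEnergy_update (u : V) (x : V → Fin 2) (j : Fin 2) :
    isingEnergy G (Function.update x u j) + spin (x u) * ∑ v ∈ G.neighborFinset u, spin (x v)
      = isingEnergy G x + spin j * ∑ v ∈ G.neighborFinset u, spin (x v) := by
  rw [isingEnergy_eq u x, isingEnergy_eq u (Function.update x u j), sum_neighbor_update,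
    Function.update_self]
  have : ∑ a ∈ Finset.univ.erase u, ∑ b ∈ (G.neighborFinset a).erase u,
      spin (Function.update x u j a) * spin (Function.update x u j b)
      = ∑ a ∈ Finset.univ.erase u, ∑ b ∈ (G.neighborFinset a).erase u,
        spin (x a) * spin (x b) := by
    refine Finset.sum_congr rfl fun a ha => Finset.sum_congr rfl fun b hb => ?_
    rw [Function.update_of_ne (Finset.ne_of_mem_erase ha),
      Function.update_of_ne (Finset.ne_of_mem_erase hb)]
  rw [this]
  ring

/-- Puts the heat-bath rule in Gibbs form. The denominator depends only on the neighbours of the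
updated site and so cancels in detailed balance. -/
theorem one_add_spin_mul_tanh (j : Fin 2) (z : ℝ) :
    (1 + spin j * Real.tanh z) / 2 = Real.exp (spin j * z) / (2 * Real.cosh z) := by
  have hc := (Real.cosh_pos z).ne'
  rw [Real.tanh_eq_sinh_div_cosh]
  fin_cases j
  · simp only [Fin.zero_eta, spin_zero]
    rw [neg_one_mul, neg_one_mul, ← Real.cosh_sub_sinh]
    field_simp
    ring
  · simp only [Fin.mk_one, spin_one]
    rw [one_mul, one_mul, ← Real.cosh_add_sinh]
    field_simp

theorem isStationary_isingGibbs (β : ℝ) :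
    IsStationary (isingGenerator G β) (isingGibbs G β) := by
  refine isStationary_of_detailed_balance (fun u x => ?_) (fun x => Real.exp_pos _)
    fun u x j => ?_
  · simp only [isingUpdate, Fin.sum_univ_two, spin_zero, spin_one]
    ring
  · simp only [isingUpdate, sum_neighbor_update, one_add_spin_mul_tanh]
    rw [mul_div_assoc', mul_div_assoc']
    congr 1
    change Real.exp (β * isingEnergy G x) * _
      = Real.exp (β * isingEnergy G (Function.update x u j)) * _
    rw [← Real.exp_add, ← Real.exp_add]
    congr 1
    have := isingEnergy_update (G := G) u x j
    linear_combination (-β) * this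

/-- On a 2-regular graph Glauber dynamics is a noisy voter model. -/
theorem isingGenerator_eq (hdeg : ∀ u, G.degree u = 2) (β : ℝ) :
    isingGenerator G β = noisyVoterGenerator G 2 (1 - Real.tanh (2 * β)) := by
  unfold isingGenerator noisyVoterGenerator
  congr 1
  funext u x j
  obtain ⟨a, b, hab, hN⟩ := Finset.card_eq_two.1 (hdeg u)
  unfold isingUpdate noisyVoterUpdate
  -- With two neighbours the spin sum is 0 or ±2, and tanh(βs) = (s/2) tanh(2β) at these three
  -- values: the rule is linear in the neighbour average, as for the voter model.
  rw [hdeg, hN, Finset.sum_pair hab, Finset.card_filter, Finset.sum_pair hab]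
  have h2 : β * (1 + 1) = 2 * β := by ring
  have h3 : β * (-1 + -1) = -(2 * β) := by ring
  generalize x a = i
  generalize x b = k
  fin_cases i <;> fin_cases k <;> fin_cases j <;>
    simp [spin_zero, spin_one, h2, h3, Real.tanh_neg] <;> ring

end Ising

/-! ### The cycle -/

section Cycle

theorem admissible_cycleGraph {n : ℕ} (hn : 3 ≤ n) {θ : ℝ} (hθ0 : 0 < θ) (hθ1 : θ ≤ 1) :
    Admissible (SimpleGraph.cycleGraph n) θ := by
  obtain ⟨m, rfl⟩ : ∃ m, n = m + 3 := ⟨n - 3, by omega⟩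
  exact ⟨SimpleGraph.cycleGraph_connected, inferInstance, hθ0, hθ1⟩

theorem degree_cycleGraph {n : ℕ} (hn : 3 ≤ n) (u : Fin n) :
    (SimpleGraph.cycleGraph n).degree u = 2 := by
  obtain ⟨m, rfl⟩ : ∃ m, n = m + 3 := ⟨n - 3, by omega⟩
  exact SimpleGraph.cycleGraph_degree_three_le

theorem cycleGraph_isBipartiteWith (k : ℕ) :
    (SimpleGraph.cycleGraph (2 * k)).IsBipartiteWith {i : Fin (2 * k) | Odd i.val}
      {i : Fin (2 * k) | Odd i.val}ᶜ := by
  refine ⟨disjoint_compl_right, fun v w hvw => ?_⟩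
  have key : ∀ a b : Fin (2 * k), (a - b).val = 1 → (Odd a.val ↔ ¬ Odd b.val) := by
    intro a b hab
    rw [Fin.val_sub] at hab
    have ha := a.2
    have hb := b.2
    have h1 : 2 * k - b.val + a.val = 1 ∨ 2 * k - b.val + a.val = 1 + 2 * k := by
      rcases Nat.lt_or_ge (2 * k - b.val + a.val) (2 * k) with hlt | hge
      · rw [Nat.mod_eq_of_lt hlt] at hab; exact Or.inl hab
      · rw [Nat.mod_eq_sub_mod hge, Nat.mod_eq_of_lt (by omega)] at hab
        right; omega
    rw [Nat.odd_iff, Nat.odd_iff]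
    omega
  have h2 : Odd v.val ↔ ¬ Odd w.val := by
    rcases SimpleGraph.cycleGraph_adj'.1 hvw with h | h
    · exact key v w h
    · have := key w v h
      tauto
  change (Odd v.val ∧ ¬ Odd w.val) ∨ (¬ Odd v.val ∧ Odd w.val)
  tauto

theorem cycleGraph_walk_eq {m : ℕ} {v w : Fin (m + 2)}
    (p : (SimpleGraph.cycleGraph (m + 2)).Walk v w) :
    ∃ a b : ℕ, a ≤ p.length ∧ b ≤ p.length ∧
      w = v + a • (1 : Fin (m + 2)) - b • (1 : Fin (m + 2)) := by
  induction p with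
  | nil => exact ⟨0, 0, le_rfl, le_rfl, by simp⟩
  | @cons v v' w hadj q ih =>
    obtain ⟨a, b, ha, hb, hw⟩ := ih
    rw [SimpleGraph.Walk.length_cons]
    rcases SimpleGraph.cycleGraph_adj.1 hadj with h | h
    · refine ⟨a, b + 1, by omega, by omega, ?_⟩
      have : v' = v - 1 := by rw [← h]; abel
      rw [hw, this, succ_nsmul]; abel
    · refine ⟨a + 1, b, by omega, by omega, ?_⟩
      have : v' = v + 1 := by rw [← h]; abel
      rw [hw, this, succ_nsmul]; abel

/-- Forward and backward step counts determine the endpoint, so balls have at most (r+1)² ≤ 4r²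
points. As r² = (√r)⁴ ≤ 4! e^{√r}, the constant 4 · 24 = 96 works with α = 1/2. -/
theorem subexpGrowth_cycleGraph {n : ℕ} (hn : 3 ≤ n) :
    SubexpGrowth (SimpleGraph.cycleGraph n) 96 (1 / 2) := by
  obtain ⟨m, rfl⟩ : ∃ m, n = m + 2 := ⟨n - 2, by omega⟩
  intro v r hr
  have hsub : {w | (SimpleGraph.cycleGraph (m + 2)).dist v w ≤ r}
      ⊆ (((Finset.range (r + 1) ×ˢ Finset.range (r + 1)).image fun q : ℕ × ℕ =>
        v + q.1 • (1 : Fin (m + 2)) - q.2 • (1 : Fin (m + 2)) : Finset (Fin (m + 2))) :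
          Set (Fin (m + 2))) := by
    intro w hw
    obtain ⟨p, hp⟩ := (SimpleGraph.cycleGraph_preconnected v w).exists_walk_length_eq_dist
    obtain ⟨a, b, ha, hb, he⟩ := cycleGraph_walk_eq p
    have hw' : (SimpleGraph.cycleGraph (m + 2)).dist v w ≤ r := hw
    rw [Finset.mem_coe, Finset.mem_image]
    exact ⟨(a, b), Finset.mem_product.2 ⟨Finset.mem_range.2 (by omega),
      Finset.mem_range.2 (by omega)⟩, he.symm⟩
  have h1 := Set.ncard_le_ncard hsub (Finset.finite_toSet _)
  rw [Set.ncard_coe_finset] at h1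
  have h2 := h1.trans Finset.card_image_le
  rw [Finset.card_product, Finset.card_range] at h2
  have h3 : (({w | (SimpleGraph.cycleGraph (m + 2)).dist v w ≤ r}.ncard : ℕ) : ℝ)
      ≤ (r + 1) * (r + 1) := by exact_mod_cast h2
  have hr' : (1 : ℝ) ≤ r := by exact_mod_cast hr
  have h4 := Real.pow_div_factorial_le_exp ((r : ℝ) ^ (1 - 1 / 2 : ℝ)) (by positivity) 4
  have h5 : ((r : ℝ) ^ (1 - 1 / 2 : ℝ)) ^ 4 = r ^ 2 := by
    rw [← Real.rpow_natCast, ← Real.rpow_mul (by linarith), ← Real.rpow_natCast]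
    norm_num
  rw [h5] at h4
  have h6 : ((Nat.factorial 4 : ℕ) : ℝ) = 24 := by norm_num [Nat.factorial]
  rw [h6] at h4
  refine h3.trans ?_
  nlinarith

/-- For k ≥ 2 the cycle is 2-regular, so both generators agree; the Gibbs measure is stationary and,
by uniqueness, is the voter equilibrium. Mixing times then coincide, and smaller k do not affect the
lower limit. -/
theorem one_le_liminf_isingMixingTime_ratio {ε β : ℝ} (hε0 : 0 < ε) (hε1 : ε < 1) (hβ : 0 < β)
    (x₀ : ∀ k : ℕ, Fin (2 * k) → Fin 2) :
    1 ≤ Filter.liminf (fun k : ℕ =>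
      ((isingMixingTime (SimpleGraph.cycleGraph (2 * k)) β (x₀ k) ε /
        isingMixingTime (SimpleGraph.cycleGraph (2 * k)) β
          (alternating {i : Fin (2 * k) | Odd i.val}) ε : ℝ) : EReal)) Filter.atTop := by
  set θ := 1 - Real.tanh (2 * β)
  have hθ0 : 0 < θ := sub_pos.2 (Real.tanh_lt_one _)
  have hθ1 : θ ≤ 1 := by
    have : 0 < Real.tanh (2 * β) := by
      rw [Real.tanh_eq_sinh_div_cosh]
      exact div_pos (Real.sinh_pos_iff.2 (by linarith)) (Real.cosh_pos _)
    linarith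
  have hmix : ∀ k, 2 ≤ k → ∀ x, isingMixingTime (SimpleGraph.cycleGraph (2 * k)) β x ε
      = noisyVoterMixingTime (SimpleGraph.cycleGraph (2 * k)) 2 θ x ε := by
    intro k hk x
    have hadm := admissible_cycleGraph (n := 2 * k) (by omega) hθ0 hθ1
    have hgen := isingGenerator_eq (G := SimpleGraph.cycleGraph (2 * k))
      (degree_cycleGraph (by omega)) β
    have := hadm.nontrivial
    have hst := (isStationary_noisyVoterStationary (SimpleGraph.cycleGraph (2 * k)) hadm.connected
      2 (by norm_num) θ hθ0 hθ1).2 _ (hgen ▸ isStationary_isingGibbs β)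
    unfold isingMixingTime noisyVoterMixingTime
    rw [hgen, hst]
  have main := one_le_liminf_mixingTime_ratio hθ0 hθ1 (α := 1 / 2) (c₀ := 96) (by norm_num)
    (by norm_num) (by norm_num) hε0 hε1 (fun k => Fin (2 * k))
    (fun k => SimpleGraph.cycleGraph (2 * k)) (fun k => {i : Fin (2 * k) | Odd i.val}) x₀
    (by
      simp only [Fintype.card_fin]
      exact Filter.tendsto_id.const_mul_atTop' (by norm_num))
    (Filter.eventually_atTop.2 ⟨2, fun k hk => ⟨admissible_cycleGraph (by omega) hθ0 hθ1,
      cycleGraph_isBipartiteWith k, subexpGrowth_cycleGraph (by omega)⟩⟩)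
  refine main.trans (le_of_eq (Filter.liminf_congr ?_))
  filter_upwards [Filter.eventually_ge_atTop 2] with k hk
  rw [hmix k hk, hmix k hk]

end Cycle

end SpinDynamics
end

/-! ### The three assertions together -/

theorem corollary1p2 (ε : ℝ) (hε0 : 0 < ε) (hε1 : ε < 1) :
    (∀ θ α c₀ : ℝ, 0 < θ → θ ≤ 1 → 0 < α → α < 1 → 0 < c₀ →
      (∃ C : ℝ, ∀ (V : Type u) [Fintype V] [DecidableEq V] (G : SimpleGraph V)
          [DecidableRel G.Adj] (V₁ : Set V),
          2 ≤ Fintype.card V → G.Connected → G.IsBipartiteWith V₁ V₁ᶜ → SpinDynamics.SubexpGrowth G c₀ α →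
          ∃ δ : ℝ, |δ| ≤ C * Real.log (Fintype.card V) ^ (-(α / 2)) ∧
            SpinDynamics.noisyVoterMixingTime G 2 θ (SpinDynamics.alternating V₁) ε =
              (1 + δ) / min (4 - 2 * θ) (4 * θ) * Real.log (Fintype.card V)) ∧
      (∀ (V : ℕ → Type u) [∀ k, Fintype (V k)] [∀ k, DecidableEq (V k)]
          (G : ∀ k, SimpleGraph (V k)) [∀ k, DecidableRel (G k).Adj]
          (V₁ : ∀ k, Set (V k)) (x₀ : ∀ k, V k → Fin 2),
          Filter.Tendsto (fun k => Fintype.card (V k)) Filter.atTop Filter.atTop →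
          (∀ k, (G k).Connected) → (∀ k, (G k).IsBipartiteWith (V₁ k) (V₁ k)ᶜ) →
          (∀ k, SpinDynamics.SubexpGrowth (G k) c₀ α) →
          1 ≤ Filter.liminf (fun k => ((SpinDynamics.noisyVoterMixingTime (G k) 2 θ (x₀ k) ε /
            SpinDynamics.noisyVoterMixingTime (G k) 2 θ (SpinDynamics.alternating (V₁ k)) ε : ℝ) : EReal)) Filter.atTop)) ∧
    (∀ β : ℝ, 0 < β → ∀ x₀ : ∀ k : ℕ, Fin (2 * k) → Fin 2,
      1 ≤ Filter.liminf (fun k : ℕ =>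
        ((SpinDynamics.isingMixingTime (SimpleGraph.cycleGraph (2 * k)) β (x₀ k) ε /
          SpinDynamics.isingMixingTime (SimpleGraph.cycleGraph (2 * k)) β
            (SpinDynamics.alternating {i : Fin (2 * k) | Odd i.val}) ε : ℝ) : EReal)) Filter.atTop) := by
  refine ⟨fun θ α c₀ hθ0 hθ1 hα0 hα1 hc => ⟨?_, ?_⟩, fun β hβ x₀ =>
    SpinDynamics.one_le_liminf_isingMixingTime_ratio hε0 hε1 hβ x₀⟩
  · obtain ⟨C, hC⟩ := SpinDynamics.exists_mixingTime_alternating_eq.{u} hθ0 hθ1 hα0 hα1 hc hε0 hε1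
    refine ⟨C, fun V _ _ G _ V₁ hcard hconn hbip hg => ?_⟩
    exact hC V G V₁ ⟨hconn, Fintype.one_lt_card_iff_nontrivial.1 hcard, hθ0, hθ1⟩ hbip hg
  · intro V _ _ G _ V₁ x₀ hcard hconn hbip hg
    refine SpinDynamics.one_le_liminf_mixingTime_ratio hθ0 hθ1 hα0 hα1 hc hε0 hε1 V G V₁ x₀ hcard ?_
    -- Early graphs of the sequence may have a single vertex, so admissibility holds only
    -- eventually, which is enough for the lower limit.
    filter_upwards [hcard.eventually_ge_atTop 2] with k hk
    exact ⟨⟨hconn k, Fintype.one_lt_card_iff_nontrivial.1 hk, hθ0, hθ1⟩, hbip k, hg k⟩
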